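/- Manifolds are smooth, finite-dimensional, Hausdorff, second countable and without boundary; functions are complex-valued unless stated otherwise. **Data.** Let $G\rightrightarrows M$ be a Lie groupoid with source $s$ and target $t$, let $\tau:A\to M$ be its Lie algebroid ($A=\ker ds|_M$), with a Riemannian metric on the bundle $A$, and let $d\mu$ be an everywhere positive smooth density on the fibres of $A$. Each dual fibre $A_q^*$ carries the dual Lebesgue measure (up to a fixed positive normalising constant $c$, for instance the one for which Fourier inversion holds), also written $d\mu$. Let $\alpha:W\to V$ be a diffeomorphism from an open neighbourhood $W$ of the zero section $M\subset A$ onto an open neighbourhood $V$ of the units $M\subset G$ such that $\alpha(0_q)=q$, $s\circ\alpha=\tau$, and the differential at $0$ of $\alpha|_{A_q}$ is the identity of $A_q$. Let $\psi$ be a smooth function on $A$ with $\mathrm{supp}\,\psi\subset W$, with $\psi\equiv1$ on $\frac12W$, and such that $\alpha(\mathrm{supp}\,\psi)$ is closed in $G$ (so that $\psi\circ\alpha^{-1}$, extended by $0$, is smooth on $G$ with support in $V$). **Tangent groupoid.** $\widetilde G=(\mathbb R\setminus\{0\})\times G\,\sqcup\,\{0\}\times A$ is a groupoid over $\mathbb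 R\times M$, with $(\hbar,x)(\hbar,z)=(\hbar,xz)$ for $\hbar\ne0$ and the addition of the fibres of $A$ at $\hbar=0$. Its smooth structure is the one for which $(\mathbb R\setminus\{0\})\times G$ is open and $\widetilde\alpha(\hbar,X)=(\hbar,\alpha(\hbar X))$ ($\hbar\neq0$), $\widetilde\alpha(0,X)=(0,X)$ is a diffeomorphism from $\{(\hbar,X)\in\mathbb R\times A:\hbar X\in W\}$ onto an open subset of $\widetilde G$. **$\mathfrak{Op}$.** For a groupoid $\Gamma\rightrightarrows B$ with source $s$ and target $t$, $\mathfrak{Op}(\Gamma)$ is the set of families $(E_q)_{q\in B}$ of linear forms on $C_c^\infty(s^{-1}(q))$ such that for every manifold $N$ and every $H\in C_c^\infty(N\times\Gamma)$ the function $(u,z)\mapsto E_{t(z)}\big(x\mapsto H(u,xz)\big)$ is smooth and compactly supported on $N\times\Gamma$. **Operators.** For $h\in C_c^\infty(A_q)$ let $\mathfrak F(h)(X)=\int_{A_q}e^{-i\langle X,\xi\rangle}h(\xi)\,d\mu(\xi)$, $X\in A_q^*$. For a function $f$ on $A^*$ let $\mathfrak F(D_f)_q(h)=\int_{A_q^*}f(X)\,\mathfrak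 F(h)(X)\,d\mu(X)$, and let $$\widetilde{\mathfrak F(D_f)}_{(\hbar,q)}(h)=\mathfrak F(D_f)_q\big(X\mapsto\psi(\hbar X)\,h(\widetilde\alpha(\hbar,X))\big),\qquad h\in C_c^\infty(\widetilde s^{-1}(\hbar,q)),$$ where the function of $X$ is $0$ when $\hbar X\notin W$. **Acceptable functions.** A smooth function $f$ on $A^*$ is *acceptable for quantisation* if: 0. for all $q\in M$ and $h\in C_c^\infty(A_q)$ there is $m_f(q)h\in C_c^\infty(A_q)$ with $f|_{A_q^*}\,\mathfrak F(h)=\mathfrak F(m_f(q)h)$; 1. $f$ has polynomial controlled growth: in coordinates given by a chart of $M$ and a trivialisation of $A^*$, for each $q_0\in M$ and each order $k$ there are a neighbourhood $B$ of $q_0$ and $C,m$ such that the partial derivatives of $f$ of order $k$ are bounded by $C(1+\|Y\|^2)^m$ at every $Y\in A^*|_B$; 2. $m_f$, acting fibrewise, preserves $C_c^\infty(A)$; 3. for every manifold $N$ and smooth map $\theta:N\to M$, $m_f$, acting fibrewise, preserves the set $C_{sc}^\infty(\theta^*A)$ of sufficiently compact functions. Here a smooth function $H$ on $\theta^*A$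 is *sufficiently compact* if its restriction to each fibre is compactly supported and if, for each closed $K\subset A$ such that $K\setminus M$ has compact closure in $A$, the set $(\mathrm{supp}\,H+\Theta^{-1}K)\cap N$ is relatively compact in $N$, where $\Theta:\theta^*A\to A$ is the canonical bundle map, the sum is fibrewise, and $N\subset\theta^*A$ is the zero section. **Proposition.** If $f$ is acceptable for quantisation, then $\widetilde{\mathfrak F(D_f)}$ lies in $\mathfrak{Op}(\widetilde G)$. -/

import Mathlib

open Bundle Manifold MeasureTheory Set
open scoped ContDiff Topology

universe u

noncomputable section

set_option linter.unusedSectionVars false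

/-! ### Groupoids given by a set of arrows and a set of objects -/

/-- A groupoid with arrows `G`, objects `M`, source `s` and target `t`. The product `mul x y` is
only meaningful (and only constrained) when `s x = t y`. -/
structure ArrowGroupoid (G M : Type u) where
  s : G → M
  t : G → M
  one : M → G
  inv : G → G
  mul : G → G → G
  s_one : ∀ q, s (one q) = q
  t_one : ∀ q, t (one q) = q
  s_inv : ∀ x, s (inv x) = t x
  t_inv : ∀ x, t (inv x) = s x
  s_mul : ∀ x y, s x = t y → s (mul x y) = s y
  t_mul : ∀ x y, s x = t y → t (mul x y) = t x
  mul_assoc : ∀ x y z, s x = t y → s y = t z → mul (mul x y) z = mul x (mul y z)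
  one_mul : ∀ x, mul (one (t x)) x = x
  mul_one : ∀ x, mul x (one (s x)) = x
  inv_mul : ∀ x, mul (inv x) x = one (s x)
  mul_inv : ∀ x, mul x (inv x) = one (t x)

/-- The groupoid is a Lie groupoid: the structure maps are smooth and the source map is a
submersion (hence so is the target map). The set of composable pairs is then a closed submanifold
of `G × G`, and smoothness of the product on it is smoothness within that set. -/
structure ArrowGroupoid.IsLie {G M : Type u}
    {EG : Type*} [NormedAddCommGroup EG] [NormedSpace ℝ EG] {HG : Type*} [TopologicalSpace HG]
    (IG : ModelWithCorners ℝ EG HG) [TopologicalSpace G] [ChartedSpace HG G]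
    {EM : Type*} [NormedAddCommGroup EM] [NormedSpace ℝ EM] {HM : Type*} [TopologicalSpace HM]
    (IM : ModelWithCorners ℝ EM HM) [TopologicalSpace M] [ChartedSpace HM M]
    (𝒢 : ArrowGroupoid G M) : Prop where
  contMDiff_s : ContMDiff IG IM ∞ 𝒢.s
  contMDiff_t : ContMDiff IG IM ∞ 𝒢.t
  contMDiff_one : ContMDiff IM IG ∞ 𝒢.one
  contMDiff_inv : ContMDiff IG IG ∞ 𝒢.inv
  contMDiffOn_mul : ContMDiffOn (IG.prod IG) IG ∞ (fun p : G × G => 𝒢.mul p.1 p.2)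
    {p | 𝒢.s p.1 = 𝒢.t p.2}
  surjective_mfderiv_s : ∀ x, Function.Surjective (mfderiv IG IM 𝒢.s x)

/-! ### The space of operators `𝔒𝔭(G)` -/

section Op

variable {G B : Type u}
  {EG : Type*} [NormedAddCommGroup EG] [NormedSpace ℝ EG] {HG : Type*} [TopologicalSpace HG]
  (IG : ModelWithCorners ℝ EG HG) [TopologicalSpace G] [ChartedSpace HG G]

/-- `h` is a compactly supported smooth function on the submanifold `s⁻¹(q)`. -/
def ArrowGroupoid.IsCcOnSourceFibre (𝒢 : ArrowGroupoid G B) (q : B)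
    (h : {x : G // 𝒢.s x = q} → ℂ) : Prop :=
  HasCompactSupport h ∧
    ∃ H : G → ℂ, ContMDiffOn IG 𝓘(ℝ, ℂ) ∞ H {x | 𝒢.s x = q} ∧ ∀ x, h x = H x.1

/-- The `s`-family of operators `D` lies in `𝔒𝔭(G)`: each `D q` is a linear form on the compactly
supported smooth functions on `s⁻¹(q)` (its values on other functions are irrelevant), and for each
manifold `N` and each compactly supported smooth `H` on `N × G`, the function
`(u, z) ↦ D (t z) (x ↦ H (u, x z))` is smooth and compactly supported on `N × G`. -/
structure ArrowGroupoid.IsOp (𝒢 : ArrowGroupoid G B)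
    (D : ∀ q : B, ({x : G // 𝒢.s x = q} → ℂ) → ℂ) : Prop where
  map_add : ∀ q h₁ h₂, 𝒢.IsCcOnSourceFibre IG q h₁ → 𝒢.IsCcOnSourceFibre IG q h₂ →
    D q (h₁ + h₂) = D q h₁ + D q h₂
  map_smul : ∀ q (c : ℂ) h, 𝒢.IsCcOnSourceFibre IG q h → D q (c • h) = c * D q h
  smooth_compact : ∀ (EN : Type u) [NormedAddCommGroup EN] [NormedSpace ℝ EN]
    [FiniteDimensional ℝ EN] (HN : Type u) [TopologicalSpace HN] (IN : ModelWithCorners ℝ EN HN)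
    [IN.Boundaryless] (N : Type u) [TopologicalSpace N] [ChartedSpace HN N] [IsManifold IN ∞ N]
    [T2Space N] [SecondCountableTopology N] (H : N × G → ℂ),
    ContMDiff (IN.prod IG) 𝓘(ℝ, ℂ) ∞ H → HasCompactSupport H →
      ContMDiff (IN.prod IG) 𝓘(ℝ, ℂ) ∞
          (fun p : N × G => D (𝒢.t p.2) (fun x => H (p.1, 𝒢.mul x.1 p.2))) ∧
        HasCompactSupport
          (fun p : N × G => D (𝒢.t p.2) (fun x => H (p.1, 𝒢.mul x.1 p.2)))

end Op

/-! ### The Lie algebroid and the tangent groupoid -/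

section Bundle

variable {E F : Type u} [NormedAddCommGroup E] [NormedSpace ℝ E]
  [NormedAddCommGroup F] [NormedSpace ℝ F]
  {M : Type u} [TopologicalSpace M] [ChartedSpace E M]
  {G : Type u} [TopologicalSpace G] [ChartedSpace (ModelProd E F) G]
  {A : M → Type u} [TopologicalSpace (TotalSpace F A)]
  [∀ q, NormedAddCommGroup (A q)] [∀ q, InnerProductSpace ℝ (A q)]
  [FiberBundle F A] [VectorBundle ℝ F A]

/-- Scalar multiplication `(ħ, X) ↦ ħ X` in the fibres of a vector bundle. -/
def fibreSmul (p : ℝ × TotalSpace F A) : TotalSpace F A := ⟨p.2.proj, p.1 • p.2.snd⟩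

theorem continuous_fibreSmul : Continuous (fibreSmul : ℝ × TotalSpace F A → TotalSpace F A) := by
  rw [continuous_iff_continuousAt]
  intro p
  rw [FiberBundle.continuousAt_totalSpace]
  have hp : ContinuousAt (fun x : ℝ × TotalSpace F A => x.2.proj) p :=
    ((FiberBundle.continuous_proj F A).comp continuous_snd).continuousAt
  refine ⟨hp, ?_⟩
  set e := trivializationAt F A (fibreSmul p).proj with he
  have hmem : p.2.proj ∈ e.baseSet := FiberBundle.mem_baseSet_trivializationAt' _
  have h2 : ContinuousAt (fun x : ℝ × TotalSpace F A => x.1 • (e x.2).2) p := by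
    refine continuousAt_fst.smul ?_
    have := (e.continuousAt (e.mem_source.2 hmem)).comp (f := fun x : ℝ × TotalSpace F A => x.2)
      (x := p) continuousAt_snd
    exact continuousAt_snd.comp this
  refine h2.congr ?_
  filter_upwards [hp (e.open_baseSet.mem_nhds hmem)] with x hx
  exact ((e.linear ℝ hx).map_smul x.1 x.2.snd).symm

/-- `ι` identifies the vector bundle `A → M` with the Lie algebroid of `𝒢`, that is with the
restriction to the units of the kernel of the differential of the source map. -/
structure IsLieAlgebroidIdentification [IsManifold (𝓘(ℝ, E).prod 𝓘(ℝ, F)) ∞ G]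
    (𝒢 : ArrowGroupoid G M)
    (ι : ∀ q, A q →L[ℝ] TangentSpace (𝓘(ℝ, E).prod 𝓘(ℝ, F)) (𝒢.one q)) : Prop where
  contMDiff : ContMDiff (𝓘(ℝ, E).prod 𝓘(ℝ, F)) (𝓘(ℝ, E).prod 𝓘(ℝ, F)).tangent ∞
    (fun X : TotalSpace F A =>
      (⟨𝒢.one X.proj, ι X.proj X.snd⟩ : TangentBundle (𝓘(ℝ, E).prod 𝓘(ℝ, F)) G))
  injective : ∀ q, Function.Injective (ι q)
  range_eq : ∀ q, range (ι q) =
    {v | mfderiv (𝓘(ℝ, E).prod 𝓘(ℝ, F)) 𝓘(ℝ, E) 𝒢.s (𝒢.one q) v = 0}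

/-- A diffeomorphism `α` from an open neighbourhood `W = α.source` of the zero section of `A` to an
open neighbourhood `V = α.target` of the units of `G`, with `α(0_q) = q`, `s ∘ α = τ`, and such that
the differential at zero of the restriction of `α` to `A_q` is the identity (through the
identification `ι` of `A_q` with `ker ds`). -/
structure ExponentialChart (𝒢 : ArrowGroupoid G M)
    (ι : ∀ q, A q →L[ℝ] TangentSpace (𝓘(ℝ, E).prod 𝓘(ℝ, F)) (𝒢.one q)) where
  α : OpenPartialHomeomorph (TotalSpace F A) G
  contMDiffOn_α : ContMDiffOn (𝓘(ℝ, E).prod 𝓘(ℝ, F)) (𝓘(ℝ, E).prod 𝓘(ℝ, F)) ∞ α α.source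
  contMDiffOn_α_symm :
    ContMDiffOn (𝓘(ℝ, E).prod 𝓘(ℝ, F)) (𝓘(ℝ, E).prod 𝓘(ℝ, F)) ∞ α.symm α.target
  zero_mem : ∀ q, (⟨q, 0⟩ : TotalSpace F A) ∈ α.source
  α_zero : ∀ q, α ⟨q, 0⟩ = 𝒢.one q
  s_α : ∀ X ∈ α.source, 𝒢.s (α X) = X.proj
  hasMFDerivAt_α : ∀ q, HasMFDerivAt 𝓘(ℝ, A q) (𝓘(ℝ, E).prod 𝓘(ℝ, F))
    (fun X : A q => α (⟨q, X⟩ : TotalSpace F A)) 0 (ι q)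

variable {𝒢 : ArrowGroupoid G M}
  {ι : ∀ q, A q →L[ℝ] TangentSpace (𝓘(ℝ, E).prod 𝓘(ℝ, F)) (𝒢.one q)}

/-- The arrows of the tangent groupoid: the disjoint union of `G × (ℝ ∖ {0})` and `A`. It carries
the smooth structure for which `G × (ℝ ∖ {0})` is open and `α̃`, built from the exponential chart
`a`, is a diffeomorphism onto an open set. -/
inductive TangentGroupoid (a : ExponentialChart 𝒢 ι) : Type u
  | off (ħ : ℝ) (hħ : ħ ≠ 0) (x : G) : TangentGroupoid a
  | zero (X : TotalSpace F A) : TangentGroupoid a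

namespace TangentGroupoid

variable (a : ExponentialChart 𝒢 ι)

/-- The open set `W̃ = {(ħ, X) | ħ X ∈ W}` of `ℝ × A`. -/
def tildeW : Set (ℝ × TotalSpace F A) := fibreSmul ⁻¹' a.α.source

theorem isOpen_tildeW : IsOpen (tildeW a) := a.α.open_source.preimage continuous_fibreSmul

theorem zero_mem_tildeW (X : TotalSpace F A) : ((0 : ℝ), X) ∈ tildeW a := by
  have : fibreSmul ((0 : ℝ), X) = ⟨X.proj, 0⟩ := by simp [fibreSmul]
  simpa [tildeW, this] using a.zero_mem X.proj

/-- The map `α̃`: `(ħ, X) ↦ (ħ, α (ħ X))` for `ħ ≠ 0` and `(0, X) ↦ (0, X)`; only its values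
on `W̃` matter. -/
def tildeα (p : ℝ × TotalSpace F A) : TangentGroupoid a :=
  if h : p.1 ≠ 0 then off p.1 h (a.α (fibreSmul p)) else zero p.2

/-- The inverse of `α̃`. -/
def tildeαInv : TangentGroupoid a → ℝ × TotalSpace F A
  | off ħ _ x => (ħ, fibreSmul (ħ⁻¹, a.α.symm x))
  | zero X => (0, X)

/-- The image `Ṽ` of `α̃`. -/
def tildeV : Set (TangentGroupoid a) := {x | match x with
  | off _ _ x => x ∈ a.α.target
  | zero _ => True}

/-- The inclusion `(ħ, x) ↦ (ħ, x)` of `(ℝ ∖ {0}) × G` (junk at `ħ = 0`). -/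
def incl (p : ℝ × G) : TangentGroupoid a :=
  if h : p.1 ≠ 0 then off p.1 h p.2 else zero ⟨𝒢.s p.2, 0⟩

/-- The inverse of the inclusion of `(ℝ ∖ {0}) × G`. -/
def inclInv : TangentGroupoid a → ℝ × G
  | off ħ _ x => (ħ, x)
  | zero X => (0, 𝒢.one X.proj)

/-- The open set of arrows over `ħ ≠ 0`. -/
def offSet : Set (TangentGroupoid a) := {x | match x with
  | off _ _ _ => True
  | zero _ => False}

/-- A set is open when its traces on `(ℝ ∖ {0}) × G` and, through `α̃`, on `W̃` are open. -/
instance : TopologicalSpace (TangentGroupoid a) where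
  IsOpen U := IsOpen ({p : ℝ × G | p.1 ≠ 0} ∩ incl a ⁻¹' U) ∧ IsOpen (tildeW a ∩ tildeα a ⁻¹' U)
  isOpen_univ := by
    refine ⟨?_, ?_⟩
    · rw [preimage_univ, inter_univ]
      exact isOpen_ne_fun continuous_fst continuous_const
    · rw [preimage_univ, inter_univ]
      exact isOpen_tildeW a
  isOpen_inter U V hU hV := by
    refine ⟨?_, ?_⟩
    · rw [preimage_inter, inter_inter_distrib_left]
      exact hU.1.inter hV.1
    · rw [preimage_inter, inter_inter_distrib_left]
      exact hU.2.inter hV.2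
  isOpen_sUnion S hS := by
    refine ⟨?_, ?_⟩
    · simp only [preimage_sUnion, inter_iUnion]
      exact isOpen_biUnion fun U hU => (hS U hU).1
    · simp only [preimage_sUnion, inter_iUnion]
      exact isOpen_biUnion fun U hU => (hS U hU).2

theorem isOpen_iff {U : Set (TangentGroupoid a)} :
    IsOpen U ↔ IsOpen ({p : ℝ × G | p.1 ≠ 0} ∩ incl a ⁻¹' U) ∧
      IsOpen (tildeW a ∩ tildeα a ⁻¹' U) := Iff.rfl

theorem fibreSmul_inv_smul {ħ : ℝ} (h : ħ ≠ 0) (X : TotalSpace F A) :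
    fibreSmul (ħ⁻¹, fibreSmul (ħ, X)) = X := by
  change (⟨X.proj, ħ⁻¹ • ħ • X.snd⟩ : TotalSpace F A) = X
  rw [inv_smul_smul₀ h]

theorem fibreSmul_smul_inv {ħ : ℝ} (h : ħ ≠ 0) (X : TotalSpace F A) :
    fibreSmul (ħ, fibreSmul (ħ⁻¹, X)) = X := by
  change (⟨X.proj, ħ • ħ⁻¹ • X.snd⟩ : TotalSpace F A) = X
  rw [smul_inv_smul₀ h]

theorem tildeα_mem (p) (hp : p ∈ tildeW a) : tildeα a p ∈ tildeV a := by
  unfold tildeα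
  split_ifs with h
  · exact a.α.map_source hp
  · trivial

theorem tildeαInv_mem (x) (hx : x ∈ tildeV a) : tildeαInv a x ∈ tildeW a := by
  cases x with
  | off ħ h x =>
    change fibreSmul (ħ, fibreSmul (ħ⁻¹, a.α.symm x)) ∈ a.α.source
    rw [fibreSmul_smul_inv h]
    exact a.α.map_target hx
  | zero X => exact zero_mem_tildeW a X

theorem tildeα_left_inv (p) (hp : p ∈ tildeW a) : tildeαInv a (tildeα a p) = p := by
  obtain ⟨ħ, X⟩ := p
  by_cases h : ħ = 0
  · subst h; simp [tildeα, tildeαInv]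
  · have : a.α.symm (a.α (fibreSmul (ħ, X))) = fibreSmul (ħ, X) := a.α.left_inv hp
    simp [tildeα, tildeαInv, h, this, fibreSmul_inv_smul]

theorem tildeα_right_inv (x) (hx : x ∈ tildeV a) : tildeα a (tildeαInv a x) = x := by
  cases x with
  | off ħ h x =>
    have : a.α (a.α.symm x) = x := a.α.right_inv hx
    simp [tildeα, tildeαInv, h, fibreSmul_smul_inv h, this]
  | zero X => simp [tildeα, tildeαInv]

theorem isOpen_gluing {U : Set (ℝ × TotalSpace F A)} (hU : IsOpen U) :
    IsOpen ({p : ℝ × G | p.1 ≠ 0} ∩ incl a ⁻¹' (tildeV a ∩ tildeαInv a ⁻¹' U)) := by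
  have h1 : IsOpen {p : ℝ × G | p.1 ≠ 0 ∧ p.2 ∈ a.α.target} :=
    (isOpen_ne_fun continuous_fst continuous_const).inter
      (a.α.open_target.preimage continuous_snd)
  have h2 : ContinuousOn (fun p : ℝ × G => (p.1, fibreSmul (p.1⁻¹, a.α.symm p.2)))
      {p : ℝ × G | p.1 ≠ 0 ∧ p.2 ∈ a.α.target} := by
    refine continuousOn_fst.prodMk (continuous_fibreSmul.comp_continuousOn ?_)
    refine (continuousOn_fst.inv₀ fun p hp => hp.1).prodMk ?_
    exact a.α.continuousOn_symm.comp continuousOn_snd fun p hp => hp.2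
  convert h2.isOpen_inter_preimage h1 hU using 1
  ext ⟨ħ, x⟩
  by_cases h : ħ = 0 <;> simp [incl, tildeV, tildeαInv, h]

theorem isOpen_gluing' {U : Set (ℝ × G)} (hU : IsOpen U) :
    IsOpen (tildeW a ∩ tildeα a ⁻¹' (offSet a ∩ inclInv a ⁻¹' U)) := by
  have h1 : IsOpen (tildeW a ∩ {p | p.1 ≠ 0}) :=
    (isOpen_tildeW a).inter (isOpen_ne_fun continuous_fst continuous_const)
  have h2 : ContinuousOn (fun p : ℝ × TotalSpace F A => (p.1, a.α (fibreSmul p)))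
      (tildeW a ∩ {p | p.1 ≠ 0}) :=
    continuousOn_fst.prodMk
      (a.α.continuousOn.comp continuous_fibreSmul.continuousOn fun p hp => hp.1)
  convert h2.isOpen_inter_preimage h1 hU using 1
  ext ⟨ħ, X⟩
  by_cases h : ħ = 0 <;> simp [tildeα, offSet, inclInv, h]

/-- `α̃` as a homeomorphism from the open set `W̃` onto the open set `Ṽ`. -/
def tildeαHomeo : OpenPartialHomeomorph (ℝ × TotalSpace F A) (TangentGroupoid a) where
  toFun := tildeα a
  invFun := tildeαInv a
  source := tildeW a
  target := tildeV a
  map_source' := tildeα_mem a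
  map_target' := tildeαInv_mem a
  left_inv' := tildeα_left_inv a
  right_inv' := tildeα_right_inv a
  open_source := isOpen_tildeW a
  open_target := by
    refine ⟨by simpa using isOpen_gluing a isOpen_univ, ?_⟩
    rw [inter_eq_left.2 (show tildeW a ⊆ tildeα a ⁻¹' tildeV a from tildeα_mem a)]
    exact isOpen_tildeW a
  continuousOn_toFun := by
    rw [continuousOn_open_iff (isOpen_tildeW a)]
    exact fun t ht => ht.2
  continuousOn_invFun := by
    rw [continuousOn_open_iff]
    · refine fun U hU => ⟨isOpen_gluing a hU, ?_⟩
      convert (isOpen_tildeW a).inter hU using 1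
      ext p
      constructor
      · rintro ⟨h1, -, h2⟩
        refine ⟨h1, ?_⟩
        rwa [mem_preimage, tildeα_left_inv a p h1] at h2
      · rintro ⟨h1, h2⟩
        refine ⟨h1, tildeα_mem a p h1, ?_⟩
        rwa [mem_preimage, tildeα_left_inv a p h1]
    · refine ⟨by simpa using isOpen_gluing a isOpen_univ, ?_⟩
      rw [inter_eq_left.2 (show tildeW a ⊆ tildeα a ⁻¹' tildeV a from tildeα_mem a)]
      exact isOpen_tildeW a

theorem incl_mem (p : ℝ × G) (hp : p ∈ {p : ℝ × G | p.1 ≠ 0}) : incl a p ∈ offSet a := by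
  have hp' : p.1 ≠ 0 := hp
  simp [incl, hp', offSet]

theorem inclInv_incl (p : ℝ × G) (hp : p ∈ {p : ℝ × G | p.1 ≠ 0}) : inclInv a (incl a p) = p := by
  have hp' : p.1 ≠ 0 := hp
  simp [incl, hp', inclInv]

theorem isOpen_offSet : IsOpen (offSet a) := by
  refine ⟨?_, by simpa using isOpen_gluing' a isOpen_univ⟩
  rw [inter_eq_left.2 (show {p : ℝ × G | p.1 ≠ 0} ⊆ incl a ⁻¹' offSet a from incl_mem a)]
  exact isOpen_ne_fun continuous_fst continuous_const

/-- The inclusion of `(ℝ ∖ {0}) × G` as a homeomorphism onto an open set. -/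
def inclHomeo : OpenPartialHomeomorph (ℝ × G) (TangentGroupoid a) where
  toFun := incl a
  invFun := inclInv a
  source := {p | p.1 ≠ 0}
  target := offSet a
  map_source' := incl_mem a
  map_target' x hx := by
    cases x with
    | off ħ h x => exact h
    | zero X => exact hx.elim
  left_inv' := inclInv_incl a
  right_inv' x hx := by
    cases x with
    | off ħ h x => simp [inclInv, incl, h]
    | zero X => exact hx.elim
  open_source := isOpen_ne_fun continuous_fst continuous_const
  open_target := isOpen_offSet a
  continuousOn_toFun := by
    rw [continuousOn_open_iff (isOpen_ne_fun continuous_fst continuous_const)]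
    exact fun t ht => ht.1
  continuousOn_invFun := by
    rw [continuousOn_open_iff (isOpen_offSet a)]
    refine fun U hU => ⟨?_, isOpen_gluing' a hU⟩
    convert (isOpen_ne_fun continuous_fst continuous_const).inter hU using 1
    · ext p
      constructor
      · rintro ⟨h1, -, h2⟩
        refine ⟨h1, ?_⟩
        rwa [mem_preimage, inclInv_incl a p h1] at h2
      · rintro ⟨h1, h2⟩
        refine ⟨h1, incl_mem a p h1, ?_⟩
        rwa [mem_preimage, inclInv_incl a p h1]

/-- The charts of the tangent groupoid are the charts of `(ℝ ∖ {0}) × G`, and those of `W̃`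
transported by `α̃`. -/
instance : ChartedSpace (ModelProd ℝ (ModelProd E F)) (TangentGroupoid a) where
  atlas := range (fun p : ℝ × G =>
      (inclHomeo a).symm ≫ₕ chartAt (ModelProd ℝ (ModelProd E F)) p) ∪
    range (fun p : ℝ × TotalSpace F A =>
      (tildeαHomeo a).symm ≫ₕ chartAt (ModelProd ℝ (ModelProd E F)) p)
  chartAt
    | off ħ _ x => (inclHomeo a).symm ≫ₕ chartAt (ModelProd ℝ (ModelProd E F)) (ħ, x)
    | zero X => (tildeαHomeo a).symm ≫ₕ chartAt (ModelProd ℝ (ModelProd E F)) ((0 : ℝ), X)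
  mem_chart_source
    | off ħ _ x =>
      ⟨trivial, mem_chart_source (ModelProd ℝ (ModelProd E F)) ((ħ, x) : ℝ × G)⟩
    | zero X =>
      ⟨trivial, mem_chart_source (ModelProd ℝ (ModelProd E F)) (((0 : ℝ), X) : ℝ × TotalSpace F A)⟩
  chart_mem_atlas
    | off ħ _ x => Or.inl ⟨(ħ, x), rfl⟩
    | zero X => Or.inr ⟨((0 : ℝ), X), rfl⟩

theorem contMDiff_fibreSmul [ContMDiffVectorBundle ∞ F A 𝓘(ℝ, E)] :
    ContMDiff (𝓘(ℝ, ℝ).prod (𝓘(ℝ, E).prod 𝓘(ℝ, F))) (𝓘(ℝ, E).prod 𝓘(ℝ, F)) ∞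
      (fibreSmul : ℝ × TotalSpace F A → TotalSpace F A) := by
  intro p
  rw [contMDiffAt_totalSpace]
  have hp : ContMDiffAt (𝓘(ℝ, ℝ).prod (𝓘(ℝ, E).prod 𝓘(ℝ, F))) 𝓘(ℝ, E) ∞
      (fun x : ℝ × TotalSpace F A => x.2.proj) p :=
    (contMDiff_proj A).contMDiffAt.comp p contMDiffAt_snd
  refine ⟨hp, ?_⟩
  set e := trivializationAt F A (fibreSmul p).proj with he
  have hmem : p.2.proj ∈ e.baseSet := FiberBundle.mem_baseSet_trivializationAt' _
  have h2 : ContMDiffAt (𝓘(ℝ, ℝ).prod (𝓘(ℝ, E).prod 𝓘(ℝ, F))) 𝓘(ℝ, F) ∞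
      (fun x : ℝ × TotalSpace F A => x.1 • (e x.2).2) p := by
    refine contMDiffAt_fst.smul ?_
    have h3 : ContMDiffAt (𝓘(ℝ, E).prod 𝓘(ℝ, F)) (𝓘(ℝ, E).prod 𝓘(ℝ, F)) ∞ e p.2 :=
      e.contMDiffOn.contMDiffAt (e.open_source.mem_nhds (e.mem_source.2 hmem))
    exact contMDiffAt_snd.comp p (h3.comp p contMDiffAt_snd)
  refine h2.congr_of_eventuallyEq ?_
  filter_upwards [hp.continuousAt (e.open_baseSet.mem_nhds hmem)] with x hx
  exact (e.linear ℝ hx).map_smul x.1 x.2.snd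

theorem transition_contDiffOn {EH H : Type*} [NormedAddCommGroup EH] [NormedSpace ℝ EH]
    [TopologicalSpace H] (I : ModelWithCorners ℝ EH H) {P P' X : Type*} [TopologicalSpace P]
    [TopologicalSpace P'] [TopologicalSpace X] [ChartedSpace H P] [ChartedSpace H P']
    [IsManifold I ∞ P] [IsManifold I ∞ P'] (κ : OpenPartialHomeomorph P X)
    (κ' : OpenPartialHomeomorph P' X)
    (hκ : ContMDiffOn I I ∞ (κ'.symm ∘ κ) (κ.source ∩ κ ⁻¹' κ'.target)) (p : P) (p' : P') :
    ContDiffOn ℝ ∞ (I ∘ ((κ.symm ≫ₕ chartAt H p).symm ≫ₕ (κ'.symm ≫ₕ chartAt H p')) ∘ I.symm)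
      (I.symm ⁻¹' ((κ.symm ≫ₕ chartAt H p).symm ≫ₕ (κ'.symm ≫ₕ chartAt H p')).source ∩
        range I) := by
  rw [← contMDiffOn_iff_contDiffOn]
  have h0 := ModelWithCorners.contMDiff (n := ∞) I
  have h1 := contMDiffOn_of_mem_maximalAtlas
    (IsManifold.chart_mem_maximalAtlas (I := I) (n := ∞) p')
  have h2 := contMDiffOn_extend_symm (I := I) (n := ∞)
    (IsManifold.chart_mem_maximalAtlas (I := I) (n := ∞) p)
  refine h0.comp_contMDiffOn (h1.comp (hκ.comp (h2.mono ?_) ?_) ?_)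
  · rintro _ ⟨hx, y, rfl⟩
    simp only [mem_preimage, I.left_inv] at hx
    exact ⟨y, by simpa using hx.1.1, rfl⟩
  · rintro _ ⟨hx, y, rfl⟩
    simp only [mem_preimage, I.left_inv] at hx
    have := hx
    simp at this
    simp
    tauto
  · rintro _ ⟨hx, y, rfl⟩
    simp only [mem_preimage, I.left_inv] at hx
    have := hx
    simp at this
    simp
    tauto

/-- The tangent groupoid is a smooth manifold. -/
instance [IsManifold 𝓘(ℝ, E) ∞ M] [IsManifold (𝓘(ℝ, E).prod 𝓘(ℝ, F)) ∞ G]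
    [ContMDiffVectorBundle ∞ F A 𝓘(ℝ, E)] :
    IsManifold (𝓘(ℝ, ℝ).prod (𝓘(ℝ, E).prod 𝓘(ℝ, F))) ∞ (TangentGroupoid a) := by
  have h11 : ContMDiffOn (𝓘(ℝ, ℝ).prod (𝓘(ℝ, E).prod 𝓘(ℝ, F)))
      (𝓘(ℝ, ℝ).prod (𝓘(ℝ, E).prod 𝓘(ℝ, F))) ∞ ((inclHomeo a).symm ∘ inclHomeo a)
      ((inclHomeo a).source ∩ inclHomeo a ⁻¹' (inclHomeo a).target) :=
    contMDiffOn_id.congr fun x hx => (inclHomeo a).left_inv hx.1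
  have h22 : ContMDiffOn (𝓘(ℝ, ℝ).prod (𝓘(ℝ, E).prod 𝓘(ℝ, F)))
      (𝓘(ℝ, ℝ).prod (𝓘(ℝ, E).prod 𝓘(ℝ, F))) ∞ ((tildeαHomeo a).symm ∘ tildeαHomeo a)
      ((tildeαHomeo a).source ∩ tildeαHomeo a ⁻¹' (tildeαHomeo a).target) :=
    contMDiffOn_id.congr fun x hx => (tildeαHomeo a).left_inv hx.1
  have h12 : ContMDiffOn (𝓘(ℝ, ℝ).prod (𝓘(ℝ, E).prod 𝓘(ℝ, F)))
      (𝓘(ℝ, ℝ).prod (𝓘(ℝ, E).prod 𝓘(ℝ, F))) ∞ ((tildeαHomeo a).symm ∘ inclHomeo a)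
      ((inclHomeo a).source ∩ inclHomeo a ⁻¹' (tildeαHomeo a).target) := by
    have : ContMDiffOn (𝓘(ℝ, ℝ).prod (𝓘(ℝ, E).prod 𝓘(ℝ, F)))
        (𝓘(ℝ, ℝ).prod (𝓘(ℝ, E).prod 𝓘(ℝ, F))) ∞
        (fun p : ℝ × G => (p.1, fibreSmul (p.1⁻¹, a.α.symm p.2)))
        {p : ℝ × G | p.1 ≠ 0 ∧ p.2 ∈ a.α.target} := by
      refine contMDiffOn_fst.prodMk (contMDiff_fibreSmul.comp_contMDiffOn ?_)
      refine ContMDiffOn.prodMk ?_ ?_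
      · intro p hp
        exact ((contDiffAt_inv ℝ hp.1).contMDiffAt.comp p contMDiffAt_fst).contMDiffWithinAt
      · exact a.contMDiffOn_α_symm.comp contMDiffOn_snd fun p hp => hp.2
    refine (this.mono ?_).congr ?_
    · rintro ⟨ħ, x⟩ ⟨h1, h2⟩
      have h1' : ħ ≠ 0 := h1
      refine ⟨h1, ?_⟩
      have h2' : incl a (ħ, x) ∈ tildeV a := h2
      simpa [incl, h1', tildeV] using h2'
    · rintro ⟨ħ, x⟩ ⟨h1, h2⟩
      have h1' : ħ ≠ 0 := h1
      change tildeαInv a (incl a (ħ, x)) = _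
      simp [incl, h1', tildeαInv]
  have h21 : ContMDiffOn (𝓘(ℝ, ℝ).prod (𝓘(ℝ, E).prod 𝓘(ℝ, F)))
      (𝓘(ℝ, ℝ).prod (𝓘(ℝ, E).prod 𝓘(ℝ, F))) ∞ ((inclHomeo a).symm ∘ tildeαHomeo a)
      ((tildeαHomeo a).source ∩ tildeαHomeo a ⁻¹' (inclHomeo a).target) := by
    have : ContMDiffOn (𝓘(ℝ, ℝ).prod (𝓘(ℝ, E).prod 𝓘(ℝ, F)))
        (𝓘(ℝ, ℝ).prod (𝓘(ℝ, E).prod 𝓘(ℝ, F))) ∞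
        (fun p : ℝ × TotalSpace F A => (p.1, a.α (fibreSmul p))) (tildeW a) :=
      contMDiffOn_fst.prodMk (a.contMDiffOn_α.comp contMDiff_fibreSmul.contMDiffOn fun p hp => hp)
    refine (this.mono inter_subset_left).congr ?_
    rintro ⟨ħ, X⟩ ⟨h1, h2⟩
    have h2' : tildeα a (ħ, X) ∈ offSet a := h2
    change inclInv a (tildeα a (ħ, X)) = _
    by_cases h : ħ = 0
    · subst h
      simp [tildeα, offSet] at h2'
    · simp [tildeα, h, inclInv]
  refine isManifold_of_contDiffOn _ _ _ ?_
  rintro _ _ (⟨p, rfl⟩ | ⟨p, rfl⟩) (⟨p', rfl⟩ | ⟨p', rfl⟩)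
  · exact transition_contDiffOn _ _ _ h11 p p'
  · exact transition_contDiffOn _ _ _ h12 p p'
  · exact transition_contDiffOn _ _ _ h21 p p'
  · exact transition_contDiffOn _ _ _ h22 p p'

/-- The source map of the tangent groupoid. -/
def source : TangentGroupoid a → ℝ × M
  | off ħ _ x => (ħ, 𝒢.s x)
  | zero X => (0, X.proj)

/-- The target map of the tangent groupoid. -/
def target : TangentGroupoid a → ℝ × M
  | off ħ _ x => (ħ, 𝒢.t x)
  | zero X => (0, X.proj)

/-- The unit of the tangent groupoid at `(ħ, q)`. -/
def unit (p : ℝ × M) : TangentGroupoid a :=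
  if h : p.1 ≠ 0 then off p.1 h (𝒢.one p.2) else zero ⟨p.2, 0⟩

/-- The inverse of an arrow of the tangent groupoid. -/
def inverse : TangentGroupoid a → TangentGroupoid a
  | off ħ h x => off ħ h (𝒢.inv x)
  | zero X => zero ⟨X.proj, -X.snd⟩

open Classical in
/-- The product of the tangent groupoid: `(ħ, x) (ħ, z) = (ħ, x z)` for `ħ ≠ 0`, and the addition
of `A_q` for `ħ = 0` (junk on non-composable pairs). -/
def product : TangentGroupoid a → TangentGroupoid a → TangentGroupoid a
  | off ħ h x, off _ _ z => off ħ h (𝒢.mul x z)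
  | zero ⟨p, X⟩, zero ⟨q, Y⟩ => if h : p = q then zero ⟨q, h ▸ X + Y⟩ else zero ⟨q, Y⟩
  | x, _ => x

end TangentGroupoid

/-- The tangent groupoid of `𝒢`, a groupoid over `ℝ × M`. -/
def tangentGroupoid (a : ExponentialChart 𝒢 ι) : ArrowGroupoid (TangentGroupoid a) (ℝ × M) where
  s := TangentGroupoid.source a
  t := TangentGroupoid.target a
  one := TangentGroupoid.unit a
  inv := TangentGroupoid.inverse a
  mul := TangentGroupoid.product a
  s_one := by
    rintro ⟨ħ, q⟩
    by_cases h : ħ = 0 <;> simp [TangentGroupoid.unit, TangentGroupoid.source, h, 𝒢.s_one]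
  t_one := by
    rintro ⟨ħ, q⟩
    by_cases h : ħ = 0 <;> simp [TangentGroupoid.unit, TangentGroupoid.target, h, 𝒢.t_one]
  s_inv := by
    rintro (⟨ħ, h, x⟩ | ⟨q, X⟩) <;>
      simp [TangentGroupoid.inverse, TangentGroupoid.source, TangentGroupoid.target, 𝒢.s_inv]
  t_inv := by
    rintro (⟨ħ, h, x⟩ | ⟨q, X⟩) <;>
      simp [TangentGroupoid.inverse, TangentGroupoid.source, TangentGroupoid.target, 𝒢.t_inv]
  s_mul := by
    rintro (⟨ħ, h, x⟩ | ⟨q, X⟩) (⟨ħ', h', y⟩ | ⟨q', Y⟩) hxy <;>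
      simp only [TangentGroupoid.source, TangentGroupoid.target, Prod.mk.injEq] at hxy
    · simp [TangentGroupoid.product, TangentGroupoid.source, hxy.1, 𝒢.s_mul x y hxy.2]
    · exact (h hxy.1).elim
    · exact (h' hxy.1.symm).elim
    · obtain rfl := hxy.2
      simp [TangentGroupoid.product, TangentGroupoid.source]
  t_mul := by
    rintro (⟨ħ, h, x⟩ | ⟨q, X⟩) (⟨ħ', h', y⟩ | ⟨q', Y⟩) hxy <;>
      simp only [TangentGroupoid.source, TangentGroupoid.target, Prod.mk.injEq] at hxy
    · simp [TangentGroupoid.product, TangentGroupoid.target, 𝒢.t_mul x y hxy.2]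
    · exact (h hxy.1).elim
    · exact (h' hxy.1.symm).elim
    · obtain rfl := hxy.2
      simp [TangentGroupoid.product, TangentGroupoid.target]
  mul_assoc := by
    rintro (⟨ħ, h, x⟩ | ⟨q, X⟩) (⟨ħ', h', y⟩ | ⟨q', Y⟩) (⟨ħ'', h'', z⟩ | ⟨q'', Z⟩) hxy hyz <;>
      simp only [TangentGroupoid.source, TangentGroupoid.target, Prod.mk.injEq] at hxy hyz
    · simp [TangentGroupoid.product, 𝒢.mul_assoc x y z hxy.2 hyz.2]
    · exact (h' hyz.1).elim
    · exact (h hxy.1).elim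
    · exact (h hxy.1).elim
    · exact (h' hxy.1.symm).elim
    · exact (h' hxy.1.symm).elim
    · exact (h'' hyz.1.symm).elim
    · obtain rfl := hxy.2
      obtain rfl := hyz.2
      simp [TangentGroupoid.product, add_assoc]
  one_mul := by
    rintro (⟨ħ, h, x⟩ | ⟨q, X⟩)
    · simp [TangentGroupoid.product, TangentGroupoid.target, TangentGroupoid.unit, 𝒢.one_mul, h]
    · simp [TangentGroupoid.product, TangentGroupoid.target, TangentGroupoid.unit]
      exact zero_add (M := A q) X
  mul_one := by
    rintro (⟨ħ, h, x⟩ | ⟨q, X⟩)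
    · simp [TangentGroupoid.product, TangentGroupoid.source, TangentGroupoid.unit, 𝒢.mul_one, h]
    · simp [TangentGroupoid.product, TangentGroupoid.source, TangentGroupoid.unit]
      exact add_zero (M := A q) X
  inv_mul := by
    rintro (⟨ħ, h, x⟩ | ⟨q, X⟩)
    · simp [TangentGroupoid.product, TangentGroupoid.source, TangentGroupoid.unit,
        TangentGroupoid.inverse, 𝒢.inv_mul, h]
    · simp [TangentGroupoid.product, TangentGroupoid.source, TangentGroupoid.unit,
        TangentGroupoid.inverse]
      rfl
  mul_inv := by
    rintro (⟨ħ, h, x⟩ | ⟨q, X⟩)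
    · simp [TangentGroupoid.product, TangentGroupoid.target, TangentGroupoid.unit,
        TangentGroupoid.inverse, 𝒢.mul_inv, h]
    · simp [TangentGroupoid.product, TangentGroupoid.target, TangentGroupoid.unit,
        TangentGroupoid.inverse]
      rfl

theorem tangentGroupoid_s_tildeα (a : ExponentialChart 𝒢 ι) {p : ℝ × TotalSpace F A}
    (hp : p ∈ TangentGroupoid.tildeW a) :
    (tangentGroupoid a).s (TangentGroupoid.tildeα a p) = (p.1, p.2.proj) := by
  obtain ⟨ħ, X⟩ := p
  by_cases h : ħ = 0
  · simp [tangentGroupoid, TangentGroupoid.tildeα, TangentGroupoid.source, h]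
  · have h1 : 𝒢.s (a.α (fibreSmul (ħ, X))) = X.proj := a.s_α _ hp
    simp [tangentGroupoid, TangentGroupoid.tildeα, TangentGroupoid.source, h, h1]

open Classical in
/-- The `s̃`-family `D̃` on the tangent groupoid obtained from a `τ`-family `D` on `A`:
`D̃ (ħ, q) h = D q (X ↦ ψ (ħ X) h (α̃ (ħ, X)))`, the function being `0` where `ħ X ∉ W`. -/
def tildeOperator (a : ExponentialChart 𝒢 ι) (ψ : TotalSpace F A → ℂ)
    (D : ∀ q, (A q → ℂ) → ℂ) (p : ℝ × M)
    (h : {x : TangentGroupoid a // (tangentGroupoid a).s x = p} → ℂ) : ℂ :=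
  D p.2 fun X =>
    if hX : (p.1, (⟨p.2, X⟩ : TotalSpace F A)) ∈ TangentGroupoid.tildeW a then
      ψ (fibreSmul (p.1, ⟨p.2, X⟩)) *
        h ⟨TangentGroupoid.tildeα a (p.1, ⟨p.2, X⟩), tangentGroupoid_s_tildeα a hX⟩
    else 0

end Bundle

/-! ### Fourier transform and functions acceptable for quantisation -/

section Fourier

variable {E F : Type u} [NormedAddCommGroup E] [NormedSpace ℝ E]
  [NormedAddCommGroup F] [NormedSpace ℝ F]
  {M : Type u} [TopologicalSpace M] [ChartedSpace E M]
  {A : M → Type u}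
  [∀ q, NormedAddCommGroup (A q)] [∀ q, InnerProductSpace ℝ (A q)]
  [∀ q, FiniteDimensional ℝ (A q)] [∀ q, MeasurableSpace (A q)] [∀ q, BorelSpace (A q)]

/-- The fibres of the dual bundle `A*`. -/
abbrev DualBundle (A : M → Type u) [∀ q, NormedAddCommGroup (A q)]
    [∀ q, InnerProductSpace ℝ (A q)] (q : M) : Type u := A q →L[ℝ] Bundle.Trivial M ℝ q

/-- The Lebesgue measure `dμ` on `A_q` with density `ρ q` with respect to the volume of the
Riemannian metric. -/
def fibreMeasure (ρ : M → ℝ) (q : M) : Measure (A q) := ENNReal.ofReal (ρ q) • volume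

/-- The dual Lebesgue measure on `A*_q`, multiplied by the normalising constant `c`. -/
def dualFibreMeasure (ρ : M → ℝ) (c : ℝ) (q : M) : Measure (DualBundle A q) :=
  ENNReal.ofReal (c / ρ q) • Measure.map (InnerProductSpace.toDualMap ℝ (A q)) volume

/-- The Fourier transform of a function on `A_q`. -/
def fibreFourier (ρ : M → ℝ) (q : M) (h : A q → ℂ) (X : DualBundle A q) : ℂ :=
  ∫ ξ : A q, Complex.exp (-Complex.I * ((X ξ : ℝ) : ℂ)) * h ξ ∂(fibreMeasure ρ q)

/-- The Fourier transform `𝔉(D_f)` of the operator `D_f`, as a `τ`-family on `A`. -/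
def fourierOperator (ρ : M → ℝ) (c : ℝ) (f : TotalSpace (F →L[ℝ] ℝ) (DualBundle A) → ℂ)
    (q : M) (h : A q → ℂ) : ℂ :=
  ∫ X : DualBundle A q, f ⟨q, X⟩ * fibreFourier ρ q h X ∂(dualFibreMeasure ρ c q)

/-- A compactly supported smooth function on a normed space. -/
def IsCc {V : Type*} [NormedAddCommGroup V] [NormedSpace ℝ V] (h : V → ℂ) : Prop :=
  ContDiff ℝ ∞ h ∧ HasCompactSupport h

/-- `k = m_f(q) h`: the function `k` is smooth and compactly supported and `f_q 𝔉(h) = 𝔉(k)`. -/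
def IsFourierMultiple (ρ : M → ℝ) (f : TotalSpace (F →L[ℝ] ℝ) (DualBundle A) → ℂ) (q : M)
    (h k : A q → ℂ) : Prop :=
  IsCc k ∧ ∀ X : DualBundle A q, f ⟨q, X⟩ * fibreFourier ρ q h X = fibreFourier ρ q k X

open Classical in
/-- The operator `m_f(q)` (zero where it is not defined). -/
def fourierMultiplier (ρ : M → ℝ) (f : TotalSpace (F →L[ℝ] ℝ) (DualBundle A) → ℂ) (q : M)
    (h : A q → ℂ) : A q → ℂ :=
  if H : ∃ k, IsFourierMultiple ρ f q h k then H.choose else 0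

variable [TopologicalSpace (TotalSpace F A)] [FiberBundle F A] [VectorBundle ℝ F A]

variable (E) in
/-- Polynomial controlled growth: over a neighbourhood of each point, every derivative of `f` in
the coordinates given by a chart of `M` and a trivialisation of `A*` grows at most polynomially in
the fibre variable. -/
def HasPolynomialControlledGrowth (f : TotalSpace (F →L[ℝ] ℝ) (DualBundle A) → ℂ) : Prop :=
  ∀ (q₀ : M) (k : ℕ), ∃ B ∈ 𝓝 q₀, ∃ (C : ℝ) (m : ℕ), ∀ q ∈ B, ∀ Y : DualBundle A q,
    ‖iteratedFDeriv ℝ k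
        (f ∘ (extChartAt (𝓘(ℝ, E).prod 𝓘(ℝ, F →L[ℝ] ℝ))
          (⟨q₀, 0⟩ : TotalSpace (F →L[ℝ] ℝ) (DualBundle A))).symm)
        (extChartAt (𝓘(ℝ, E).prod 𝓘(ℝ, F →L[ℝ] ℝ))
          (⟨q₀, 0⟩ : TotalSpace (F →L[ℝ] ℝ) (DualBundle A)) ⟨q, Y⟩)‖
      ≤ C * (1 + ‖Y‖ ^ 2) ^ m

/-- A subset of `A` is compact modulo `M`: it is closed and the complement in it of the zero
section has compact closure. -/
def IsCompactModuloBase (K : Set (TotalSpace F A)) : Prop :=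
  IsClosed K ∧ IsCompact (closure {X ∈ K | X.snd ≠ 0})

section Pullback

variable {EN : Type u} [NormedAddCommGroup EN] [NormedSpace ℝ EN] {HN : Type u}
  [TopologicalSpace HN] {IN : ModelWithCorners ℝ EN HN} {N : Type u} [TopologicalSpace N]
  [ChartedSpace HN N]

/-- A smooth function on `θ*A` is sufficiently compact: its restriction to each fibre has compact
support, and for each `K` compact modulo `M` the set of points of `N` (the zero section) lying in
`supp H + Θ⁻¹ K` is relatively compact. -/
structure IsSufficientlyCompact (θ : ContMDiffMap IN 𝓘(ℝ, E) N M ∞)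
    (H : TotalSpace F (θ *ᵖ A) → ℂ) : Prop where
  contMDiff : ContMDiff (IN.prod 𝓘(ℝ, F)) 𝓘(ℝ, ℂ) ∞ H
  hasCompactSupport_fibre : ∀ n : N, HasCompactSupport
    (fun ξ : A (θ n) => H (⟨n, ξ⟩ : TotalSpace F (θ *ᵖ A)))
  isCompact_closure : ∀ K : Set (TotalSpace F A), IsCompactModuloBase K →
    IsCompact (closure {n : N | ∃ ξ ζ : A (θ n),
      (⟨n, ξ⟩ : TotalSpace F (θ *ᵖ A)) ∈ tsupport H ∧ (⟨θ n, ζ⟩ : TotalSpace F A) ∈ K ∧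
        ξ + ζ = 0})

end Pullback

variable (E) in
/-- `f` is acceptable for quantisation. -/
structure AcceptableForQuantisation (ρ : M → ℝ)
    (f : TotalSpace (F →L[ℝ] ℝ) (DualBundle A) → ℂ) : Prop where
  contMDiff : ContMDiff (𝓘(ℝ, E).prod 𝓘(ℝ, F →L[ℝ] ℝ)) 𝓘(ℝ, ℂ) ∞ f
  exists_multiple : ∀ (q : M) (h : A q → ℂ), IsCc h → ∃ k, IsFourierMultiple ρ f q h k
  growth : HasPolynomialControlledGrowth E f
  preserves_cc : ∀ H : TotalSpace F A → ℂ,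
    ContMDiff (𝓘(ℝ, E).prod 𝓘(ℝ, F)) 𝓘(ℝ, ℂ) ∞ H → HasCompactSupport H →
      ContMDiff (𝓘(ℝ, E).prod 𝓘(ℝ, F)) 𝓘(ℝ, ℂ) ∞
          (fun X : TotalSpace F A => fourierMultiplier ρ f X.proj (fun ξ => H ⟨X.proj, ξ⟩) X.snd) ∧
        HasCompactSupport
          (fun X : TotalSpace F A => fourierMultiplier ρ f X.proj (fun ξ => H ⟨X.proj, ξ⟩) X.snd)
  preserves_sc : ∀ (EN : Type u) [NormedAddCommGroup EN] [NormedSpace ℝ EN]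
    [FiniteDimensional ℝ EN] (HN : Type u) [TopologicalSpace HN] (IN : ModelWithCorners ℝ EN HN)
    [IN.Boundaryless] (N : Type u) [TopologicalSpace N] [ChartedSpace HN N] [IsManifold IN ∞ N]
    [T2Space N] [SecondCountableTopology N] (θ : ContMDiffMap IN 𝓘(ℝ, E) N M ∞)
    (H : TotalSpace F (θ *ᵖ A) → ℂ), IsSufficientlyCompact θ H →
      IsSufficientlyCompact θ (fun X : TotalSpace F (θ *ᵖ A) =>
        fourierMultiplier ρ f (θ X.proj)
          (fun ξ : A (θ X.proj) => H (⟨X.proj, ξ⟩ : TotalSpace F (θ *ᵖ A))) X.snd)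

end Fourier

end

set_option linter.unusedSectionVars false

noncomputable section

/-! ### Hadamard's lemma with parameters -/

/-! By Fourier inversion on the fibres, `𝔉(D_f)_q h` is a constant times the value at zero of
`m_f(q) h` (`fourierOperator_eq`); the constant is `c (2π)^r`, where `r` is the rank of `A`. For a
test function `H` on `N × G̃`, let `θ : N × G̃ → M` send `(u, z)` to the base point of the target of
`z`, and let `Φ` be the function `((u, z), X) ↦ ψ(ħX) H(u, α̃(ħ, X) z)` on `θ*A`. The function
required to be smooth and compactly supported is then a constant multiple of the restriction of `m_f
Φ` to the zero section. If `Φ` is sufficiently compact, condition 3 says that `m_f Φ` is too. It is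
therefore smooth along the zero section, and taking for `K` the zero section of `A` in the
definition of sufficient compactness shows that its restriction has compact support. So the whole
proof consists in showing that `Φ` is sufficiently compact
(`isSufficientlyCompact_translatedFunction`).

Smoothness of `Φ` requires the product of the tangent groupoid to be smooth up to `ħ = 0`
(`contMDiffOn_product`). In exponential coordinates the fibre coordinate `m(b, ζ, x)` of a product
vanishes at `ζ = x = 0`, and there its derivative along the fibre is `ζ + x`, because multiplying by
a unit changes nothing. By Hadamard's lemma `ħ⁻¹ m(b, ħζ, ħx)` extends smoothly to `ħ = 0` by this
derivative, which is the addition of `A`. The same argument for the inverse, with derivative `-ζ`,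
gives the continuity of inversion.

The compactness conditions come from two facts. First, `α̃` restricted to the pairs with `ħX` in the
support of `ψ` is proper, because the image of that support under `α` is closed in `G`
(`isCompact_setOf_tildeα_mem`). Secondly, suppose `((u, z), ξ)` is in the support of `Φ` with `-ξ`
in `K`. If `ξ = 0`, then `α̃(ħ, ξ)` is a unit and `(u, z)` is in the support of `H`. Otherwise `x =
α̃(ħ, ξ)` stays in a compact set, and `z = x⁻¹ (x z)` with `(u, x z)` in the support of `H`, so `(u,
z)` stays in a compact set. -/

theorem contDiff_integral_zero_one {P W : Type*} [NormedAddCommGroup P] [NormedSpace ℝ P]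
    [NormedAddCommGroup W] [NormedSpace ℝ W] {g : P × ℝ → W}
    (hg : ContDiff ℝ ∞ g) : ContDiff ℝ ∞ (fun p => ∫ t in (0 : ℝ)..1, g (p, t)) := by
  let χ : ContDiffBump (0 : ℝ) := ⟨1, 2, one_pos, one_lt_two⟩
  let φ : ℝ → ℝ := (Icc (0 : ℝ) 1).indicator 1
  have hφ : LocallyIntegrable φ volume :=
    ((integrable_indicator_iff measurableSet_Icc).2 (integrableOn_const (by simp) (by simp) :
      IntegrableOn (fun _ => (1 : ℝ)) _ _)).locallyIntegrable
  -- The integral is the value at `0` of the convolution of the indicator of `[0, 1]` with `x ↦ g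
  -- (p, -x)`. The bump `χ`, equal to `1` on `[-1, 1]`, makes the second factor compactly supported
  -- without changing that value.
  have key := contDiffOn_convolution_right_with_param (n := ⊤) (μ := volume) (f := φ)
    (ContinuousLinearMap.lsmul ℝ ℝ : ℝ →L[ℝ] W →L[ℝ] W)
    (g := fun p x => χ x • g (p, -x)) (s := univ) (k := Metric.closedBall (0 : ℝ) 2) isOpen_univ
    (isCompact_closedBall _ _) (fun p x _ hx => by
      have : χ x = 0 := by
        rw [← Function.notMem_support, χ.support_eq]
        exact fun h => hx (Metric.ball_subset_closedBall h)
      simp [this]) hφ (by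
      refine ContDiff.contDiffOn ?_
      exact (χ.contDiff.comp contDiff_snd).smul
        (hg.comp (contDiff_fst.prodMk contDiff_snd.neg)))
  rw [univ_prod_univ, contDiffOn_univ] at key
  convert key.comp (contDiff_id.prodMk (contDiff_const (c := (0 : ℝ)))) using 1
  ext p
  rw [intervalIntegral.integral_of_le zero_le_one, ← integral_Icc_eq_integral_Ioc,
    ← integral_indicator measurableSet_Icc]
  simp only [convolution, Function.comp_apply, id]
  congr 1
  ext t
  by_cases ht : t ∈ Icc (0 : ℝ) 1
  · have : χ (-t) = 1 := χ.one_of_mem_closedBall (by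
      rw [mem_closedBall_zero_iff, norm_neg, Real.norm_eq_abs, abs_of_nonneg ht.1]; exact ht.2)
    simp [φ, ht, this]
  · simp [φ, ht]

/-- Hadamard's lemma: a smooth function vanishing on the zero section is, locally, the value of a
smooth family of linear maps. -/
theorem exists_contDiff_linear_factor {B V W : Type*} [NormedAddCommGroup B] [NormedSpace ℝ B]
    [FiniteDimensional ℝ B] [NormedAddCommGroup V] [NormedSpace ℝ V] [FiniteDimensional ℝ V]
    [NormedAddCommGroup W] [NormedSpace ℝ W] [CompleteSpace W]
    {m : B × V → W} {b₀ : B} (hm : ∀ᶠ p in 𝓝 (b₀, 0), ContDiffAt ℝ ∞ m p)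
    (h0 : ∀ᶠ b in 𝓝 b₀, m (b, 0) = 0) :
    ∃ L : B × V → V →L[ℝ] W, ContDiff ℝ ∞ L ∧ (∀ᶠ p in 𝓝 (b₀, (0 : V)), m p = L p p.2) ∧
      ∀ᶠ b in 𝓝 b₀, L (b, 0) = fderiv ℝ m (b, 0) ∘L ContinuousLinearMap.inr ℝ B V := by
  -- Only germs at `(b₀, 0)` matter, so `m` is cut off by a bump function to a globally smooth map.
  obtain ⟨m', hm', hmm'⟩ : ∃ m' : B × V → W, ContDiff ℝ ∞ m' ∧ m =ᶠ[𝓝 (b₀, (0 : V))] m' := by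
    obtain ⟨ε, hε, hU⟩ := Metric.eventually_nhds_iff_ball.1 hm
    let χ : ContDiffBump (b₀, (0 : V)) := ⟨ε / 4, ε / 2, by positivity, by linarith⟩
    refine ⟨fun p => χ p • m p, contDiff_iff_contDiffAt.2 fun p => ?_, ?_⟩
    · by_cases hp : p ∈ Metric.ball (b₀, (0 : V)) ε
      · exact χ.contDiff.contDiffAt.smul (hU p hp)
      · have hp' : p ∉ tsupport χ := by
          rw [χ.tsupport_eq]
          exact fun h => hp (Metric.closedBall_subset_ball (half_lt_self hε) h)
        refine (contDiffAt_const (c := (0 : W))).congr_of_eventuallyEq ?_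
        filter_upwards [notMem_tsupport_iff_eventuallyEq.1 hp'] with x hx
        simp [hx]
    · filter_upwards [χ.eventuallyEq_one] with p hp
      simp [hp]
  -- The factor is `L (b, v) = ∫₀¹ ∂_V m' (b, t v) dt`; the fundamental theorem of calculus along `t
  -- ↦ (b, t v)` gives `m' (b, v) = L (b, v) v`.
  have hD : ContDiff ℝ ∞ (fun p : (B × V) × ℝ =>
      fderiv ℝ m' (p.1.1, p.2 • p.1.2) ∘L ContinuousLinearMap.inr ℝ B V) := by
    refine ContDiff.clm_comp ?_ contDiff_const
    exact (hm'.fderiv_right (m := ∞) (by simp)).comp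
      (contDiff_fst.fst.prodMk (contDiff_snd.smul contDiff_fst.snd))
  refine ⟨_, contDiff_integral_zero_one hD, ?_, ?_⟩
  · have h0' : ∀ᶠ p in 𝓝 (b₀, (0 : V)), m' (p.1, 0) = 0 := by
      have h1 : Filter.Tendsto (fun p : B × V => (p.1, (0 : V))) (𝓝 (b₀, 0)) (𝓝 (b₀, 0)) :=
        (continuous_fst.prodMk continuous_const).tendsto' _ _ rfl
      have h2 : Filter.Tendsto (fun p : B × V => p.1) (𝓝 (b₀, 0)) (𝓝 b₀) :=
        continuous_fst.tendsto' _ _ rfl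
      filter_upwards [h1.eventually hmm', h2.eventually h0] with p hp hp'
      rw [← hp, hp']
    filter_upwards [hmm', h0'] with ⟨b, v⟩ hp hp'
    rw [hp]
    have hder : ∀ t : ℝ, HasDerivAt (fun t : ℝ => m' (b, t • v))
        ((fderiv ℝ m' (b, t • v) ∘L ContinuousLinearMap.inr ℝ B V) v) t := by
      intro t
      have h1 : HasDerivAt (fun t : ℝ => (b, t • v)) ((0 : B), v) t := by
        simpa using (hasDerivAt_const t b).prodMk ((hasDerivAt_id t).smul_const v)
      exact ((hm'.differentiable (by simp)) _).hasFDerivAt.comp_hasDerivAt t h1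
    have hcont : Continuous fun t : ℝ =>
        fderiv ℝ m' (b, t • v) ∘L ContinuousLinearMap.inr ℝ B V :=
      hD.continuous.comp (by fun_prop : Continuous fun t : ℝ => ((b, v), t))
    have := intervalIntegral.integral_eq_sub_of_hasDerivAt (a := 0) (b := 1) (fun t _ => hder t)
      ((hcont.clm_apply continuous_const).intervalIntegrable _ _)
    simp only [one_smul, zero_smul] at this
    dsimp only at hp' ⊢
    rw [hp', sub_zero] at this
    rw [← this, ContinuousLinearMap.intervalIntegral_apply (hcont.intervalIntegrable _ _)]
  · have h1 : Filter.Tendsto (fun b : B => (b, (0 : V))) (𝓝 b₀) (𝓝 (b₀, 0)) :=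
      (continuous_id.prodMk continuous_const).tendsto' _ _ rfl
    filter_upwards [h1.eventually hmm'.eventuallyEq_nhds] with b hb
    simp [hb.fderiv_eq]

/-- The deformation `(ħ, b, v) ↦ ħ⁻¹ m (b, ħ v)` of a smooth map vanishing on the zero section
extends smoothly to `ħ = 0` by the derivative along the fibre. -/
theorem contDiffAt_deformation {B V W : Type*} [NormedAddCommGroup B] [NormedSpace ℝ B]
    [FiniteDimensional ℝ B] [NormedAddCommGroup V] [NormedSpace ℝ V] [FiniteDimensional ℝ V]
    [NormedAddCommGroup W] [NormedSpace ℝ W] [CompleteSpace W]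
    {m : B × V → W} {b₀ : B} (hm : ∀ᶠ p in 𝓝 (b₀, 0), ContDiffAt ℝ ∞ m p)
    (h0 : ∀ᶠ b in 𝓝 b₀, m (b, 0) = 0)
    (v₀ : V) :
    ContDiffAt ℝ ∞ (fun p : ℝ × B × V =>
      if p.1 = 0 then fderiv ℝ m (p.2.1, 0) (0, p.2.2) else p.1⁻¹ • m (p.2.1, p.1 • p.2.2))
      (0, b₀, v₀) := by
  obtain ⟨L, hL, hmL, hL0⟩ := exists_contDiff_linear_factor hm h0
  -- Since `m (b, ħ v) = L (b, ħ v) (ħ v)`, the factor `ħ⁻¹` cancels, and the smooth function `L (b,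
  -- ħ v) v` gives both branches of the definition.
  have h1 : ContDiff ℝ ∞ (fun p : ℝ × B × V => L (p.2.1, p.1 • p.2.2) p.2.2) :=
    (hL.comp (contDiff_snd.fst.prodMk (contDiff_fst.smul contDiff_snd.snd))).clm_apply
      contDiff_snd.snd
  refine h1.contDiffAt.congr_of_eventuallyEq ?_
  have h2 : Filter.Tendsto (fun p : ℝ × B × V => (p.2.1, p.1 • p.2.2)) (𝓝 (0, b₀, v₀))
      (𝓝 (b₀, 0)) := by
    refine Continuous.tendsto' (by fun_prop) _ _ (by simp)
  have h3 : Filter.Tendsto (fun p : ℝ × B × V => p.2.1) (𝓝 (0, b₀, v₀)) (𝓝 b₀) :=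
    Continuous.tendsto' (by fun_prop) _ _ rfl
  filter_upwards [h2.eventually hmL, h3.eventually hL0] with p hp hp'
  split_ifs with h
  · simp [h, hp']
  · rw [hp]
    simp [h]

/-! ### Fourier inversion on the fibres -/

section Fourier

open scoped FourierTransform RealInnerProductSpace

/-- Fourier inversion at `0`. The kernel here is `e^{-i⟨v, ξ⟩}`, against `e^{-2πi⟨v, ξ⟩}` for `𝓕`;
the substitution `v ↦ (2π)⁻¹ v` produces the power of `2π`. The transform is integrable because `k`
is a Schwartz function. -/
theorem integral_exp_inner_exp_inner {V : Type*} [NormedAddCommGroup V] [InnerProductSpace ℝ V]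
    [FiniteDimensional ℝ V] [MeasurableSpace V] [BorelSpace V] {k : V → ℂ} (hk : IsCc k) :
    ∫ v : V, ∫ ξ : V, Complex.exp (-Complex.I * ((⟪v, ξ⟫ : ℝ) : ℂ)) * k ξ =
      (2 * Real.pi) ^ Module.finrank ℝ V * k 0 := by
  let K := hk.2.toSchwartzMap hk.1
  have hK : (K : V → ℂ) = k := rfl
  have h1 : ∀ v : V, ∫ ξ : V, Complex.exp (-Complex.I * ((⟪v, ξ⟫ : ℝ) : ℂ)) * k ξ =
      𝓕 k ((2 * Real.pi)⁻¹ • v) := by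
    intro v
    rw [Real.fourier_eq']
    congr 1
    ext ξ
    rw [smul_eq_mul, real_inner_smul_right, real_inner_comm]
    congr 2
    push_cast
    field_simp
  have h2 : ∫ v, 𝓕 k v = k 0 := by
    have h3 : 𝓕⁻ (𝓕 k) 0 = k 0 := by
      refine MeasureTheory.Integrable.fourierInv_fourier_eq ?_ ?_ hk.1.continuous.continuousAt
      · exact K.integrable
      · rw [← hK, ← SchwartzMap.fourier_coe]
        exact (𝓕 K).integrable
    rw [← h3, Real.fourierInv_eq']
    simp
  simp_rw [h1]
  rw [Measure.integral_comp_smul volume (fun v => 𝓕 k v), h2]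
  have h3 : ((2 : ℂ) * Real.pi) ^ Module.finrank ℝ V ≠ 0 :=
    pow_ne_zero _ (mul_ne_zero two_ne_zero (by exact_mod_cast Real.pi_ne_zero))
  rw [inv_pow, inv_inv, abs_of_pos (by positivity)]
  simp

variable {F : Type u} [NormedAddCommGroup F] [NormedSpace ℝ F]
  {M : Type u} {A : M → Type u}
  [∀ q, NormedAddCommGroup (A q)] [∀ q, InnerProductSpace ℝ (A q)]
  [∀ q, FiniteDimensional ℝ (A q)] [∀ q, MeasurableSpace (A q)] [∀ q, BorelSpace (A q)]

/-- Fourier inversion: `𝔉(D_f)` is, up to a constant, evaluation at zero of the Fourier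
multiplier. -/
theorem fourierOperator_eq {ρ : M → ℝ} {c : ℝ} (hc : 0 < c)
    {f : TotalSpace (F →L[ℝ] ℝ) (DualBundle A) → ℂ} {q : M} (hρ : 0 < ρ q) {h k : A q → ℂ}
    (hk : IsFourierMultiple ρ f q h k) :
    fourierOperator ρ c f q h = c * (2 * Real.pi) ^ Module.finrank ℝ (A q) * k 0 := by
  have hemb : MeasurableEmbedding (InnerProductSpace.toDualMap ℝ (A q)) :=
    (InnerProductSpace.toDualMap ℝ (A q)).isometry.isClosedEmbedding.measurableEmbedding
  have h1 : ∀ v : A q, fibreFourier ρ q k (InnerProductSpace.toDualMap ℝ (A q) v) =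
      ρ q * ∫ ξ : A q, Complex.exp (-Complex.I * ((⟪v, ξ⟫ : ℝ) : ℂ)) * k ξ := by
    intro v
    rw [fibreFourier, fibreMeasure, integral_smul_measure, ENNReal.toReal_ofReal hρ.le]
    simp
  -- The density `ρ q` of the measure on `A q` cancels against the `1 / ρ q` of the dual measure, so
  -- only `c` is left.
  rw [fourierOperator, dualFibreMeasure, integral_smul_measure, ENNReal.toReal_ofReal (by positivity)]
  simp_rw [hk.2]
  rw [hemb.integral_map]
  simp_rw [h1]
  rw [integral_const_mul, integral_exp_inner_exp_inner hk.1]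
  have : (ρ q : ℂ) ≠ 0 := by exact_mod_cast hρ.ne'
  simp only [Complex.real_smul]
  push_cast
  field_simp

theorem fibreFourier_add {ρ : M → ℝ} {q : M} {h₁ h₂ : A q → ℂ} (hh₁ : IsCc h₁) (hh₂ : IsCc h₂)
    (X : DualBundle A q) :
    fibreFourier ρ q (h₁ + h₂) X = fibreFourier ρ q h₁ X + fibreFourier ρ q h₂ X := by
  have hint : ∀ h : A q → ℂ, IsCc h → Integrable (fun ξ : A q =>
      Complex.exp (-Complex.I * ((X ξ : ℝ) : ℂ)) * h ξ) (fibreMeasure ρ q) := by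
    intro h hh
    refine Integrable.smul_measure ?_ ENNReal.ofReal_ne_top
    refine Continuous.integrable_of_hasCompactSupport ?_ hh.2.mul_left
    have hX : Continuous fun ξ : A q => (X ξ : ℝ) := X.continuous
    exact (Complex.continuous_exp.comp (continuous_const.mul
      (Complex.continuous_ofReal.comp hX))).mul hh.1.continuous
  simp only [fibreFourier, Pi.add_apply, mul_add]
  exact integral_add (hint h₁ hh₁) (hint h₂ hh₂)

theorem fibreFourier_smul (ρ : M → ℝ) (q : M) (z : ℂ) (h : A q → ℂ) (X : DualBundle A q) :
    fibreFourier ρ q (z • h) X = z * fibreFourier ρ q h X := by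
  simp only [fibreFourier, Pi.smul_apply, smul_eq_mul]
  rw [← integral_const_mul]
  congr 1
  ext ξ
  ring

theorem isFourierMultiple_fourierMultiplier {ρ : M → ℝ}
    {f : TotalSpace (F →L[ℝ] ℝ) (DualBundle A) → ℂ} {q : M} {h : A q → ℂ}
    (H : ∃ k, IsFourierMultiple ρ f q h k) :
    IsFourierMultiple ρ f q h (fourierMultiplier ρ f q h) := by
  rw [fourierMultiplier, dif_pos H]
  exact H.choose_spec

/-- As `fourierOperator_eq` accepts any Fourier multiple, this lemma and the next give the linearity
of the operator without any appeal to uniqueness or linearity of the chosen `fourierMultiplier`. -/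
theorem IsFourierMultiple.add {ρ : M → ℝ} {f : TotalSpace (F →L[ℝ] ℝ) (DualBundle A) → ℂ} {q : M}
    {h₁ h₂ k₁ k₂ : A q → ℂ} (hh₁ : IsCc h₁) (hh₂ : IsCc h₂) (H₁ : IsFourierMultiple ρ f q h₁ k₁)
    (H₂ : IsFourierMultiple ρ f q h₂ k₂) : IsFourierMultiple ρ f q (h₁ + h₂) (k₁ + k₂) :=
  ⟨⟨H₁.1.1.add H₂.1.1, H₁.1.2.add H₂.1.2⟩, fun X => by
    rw [fibreFourier_add hh₁ hh₂, fibreFourier_add H₁.1 H₂.1, ← H₁.2, ← H₂.2, mul_add]⟩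

theorem IsFourierMultiple.smul {ρ : M → ℝ} {f : TotalSpace (F →L[ℝ] ℝ) (DualBundle A) → ℂ} {q : M}
    {h k : A q → ℂ} (z : ℂ) (H : IsFourierMultiple ρ f q h k) :
    IsFourierMultiple ρ f q (z • h) (z • k) :=
  ⟨⟨contDiff_const.smul H.1.1, H.1.2.mul_left (f := fun _ => z)⟩, fun X => by
    rw [fibreFourier_smul, fibreFourier_smul, ← H.2, mul_left_comm]⟩

end Fourier

/-! ### The manifold structure of the total space of a vector bundle and of the tangent groupoid -/

/-- When the charts of `P` transported by `κ` are charts of `X`, the map `κ` is the identity in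
these charts. Applied to `α̃` and to the inclusion of `(ℝ ∖ {0}) × G`, this gives the smoothness
built into the definition of the tangent groupoid. -/
theorem contMDiffOn_of_transported_charts {EH H : Type*} [NormedAddCommGroup EH] [NormedSpace ℝ EH]
    [TopologicalSpace H] (I : ModelWithCorners ℝ EH H) {P X : Type*} [TopologicalSpace P]
    [TopologicalSpace X] [ChartedSpace H P] [ChartedSpace H X]
    [IsManifold I ∞ P] [IsManifold I ∞ X] (κ : OpenPartialHomeomorph P X)
    (hκ : ∀ p, κ.symm ≫ₕ chartAt H p ∈ atlas H X) :
    ContMDiffOn I I ∞ κ κ.source ∧ ContMDiffOn I I ∞ κ.symm κ.target := by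
  have hmem : ∀ p, κ.symm ≫ₕ chartAt H p ∈ IsManifold.maximalAtlas I ∞ X :=
    fun p => IsManifold.subset_maximalAtlas (hκ p)
  have h1 : ∀ p : P, ContMDiffOn I I ∞ (chartAt H p) (chartAt H p).source := fun p =>
    contMDiffOn_of_mem_maximalAtlas (IsManifold.chart_mem_maximalAtlas p)
  have h2 : ∀ p : P, ContMDiffOn I I ∞ (chartAt H p).symm (chartAt H p).target := fun p =>
    contMDiffOn_symm_of_mem_maximalAtlas (IsManifold.chart_mem_maximalAtlas p)
  constructor
  · intro p hp
    have h3 := contMDiffOn_symm_of_mem_maximalAtlas (hmem p)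
    have hU : IsOpen (κ.source ∩ (chartAt H p).source) :=
      κ.open_source.inter (chartAt H p).open_source
    have hc := h3.comp ((h1 p).mono (inter_subset_right (s := κ.source))) (by
      rintro y ⟨hy1, hy2⟩
      simp [hy1, hy2])
    refine ((hc.congr ?_).contMDiffAt (hU.mem_nhds ⟨hp, mem_chart_source H p⟩)).contMDiffWithinAt
    rintro y ⟨hy1, hy2⟩
    simp [hy2]
  · intro x hx
    have h3 := contMDiffOn_of_mem_maximalAtlas (hmem (κ.symm x))
    have hc := (h2 (κ.symm x)).comp h3 (by
      intro y hy
      simp at hy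
      simp [hy])
    have hxs : x ∈ (κ.symm ≫ₕ chartAt H (κ.symm x)).source := by simp [hx]
    refine ((hc.congr ?_).contMDiffAt
      ((OpenPartialHomeomorph.open_source _).mem_nhds hxs)).contMDiffWithinAt
    intro y hy
    simp at hy
    simp [hy]

theorem OpenPartialHomeomorph.exists_disjoint_isOpen {X Y : Type*} [TopologicalSpace X]
    [TopologicalSpace Y] [T2Space Y] (e : OpenPartialHomeomorph X Y) {x y : X} (hx : x ∈ e.source)
    (hy : y ∈ e.source) (hxy : x ≠ y) :
    ∃ U V : Set X, IsOpen U ∧ IsOpen V ∧ x ∈ U ∧ y ∈ V ∧ Disjoint U V := by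
  obtain ⟨U, V, hU, hV, hxU, hyV, hUV⟩ := t2_separation fun h => hxy (e.injOn hx hy h)
  exact ⟨e.source ∩ e ⁻¹' U, e.source ∩ e ⁻¹' V, e.isOpen_inter_preimage hU,
    e.isOpen_inter_preimage hV, ⟨hx, hxU⟩, ⟨hy, hyV⟩,
    (hUV.preimage e).mono inter_subset_right inter_subset_right⟩

/-! ### Topology of the total space of a vector bundle. -/

section Bundle

variable {E F : Type u} [NormedAddCommGroup E] [NormedSpace ℝ E]
  [NormedAddCommGroup F] [NormedSpace ℝ F]
  {M : Type u} [TopologicalSpace M] [ChartedSpace E M]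
  {A : M → Type u} [TopologicalSpace (TotalSpace F A)]
  [∀ q, NormedAddCommGroup (A q)] [∀ q, InnerProductSpace ℝ (A q)]
  [FiberBundle F A] [VectorBundle ℝ F A]

theorem t2Space_totalSpace [T2Space M] : T2Space (TotalSpace F A) := by
  refine ⟨fun X Y hXY => ?_⟩
  by_cases h : X.proj = Y.proj
  · refine (trivializationAt F A X.proj).exists_disjoint_isOpen ?_ ?_ hXY
    · exact FiberBundle.mem_trivializationAt_proj_source
    · rw [h]
      exact FiberBundle.mem_trivializationAt_proj_source
  · obtain ⟨U, V, hU, hV, hX, hY, hUV⟩ := t2_separation h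
    exact ⟨_, _, hU.preimage (FiberBundle.continuous_proj F A),
      hV.preimage (FiberBundle.continuous_proj F A), hX, hY, hUV.preimage _⟩

theorem secondCountableTopology_totalSpace [SecondCountableTopology M]
    [SecondCountableTopology F] : SecondCountableTopology (TotalSpace F A) := by
  obtain ⟨S, hS, hcov⟩ := TopologicalSpace.countable_cover_nhds (α := M)
    (f := fun q => (trivializationAt F A q).baseSet)
    fun q => (trivializationAt F A q).open_baseSet.mem_nhds
      (FiberBundle.mem_baseSet_trivializationAt' q)
  have := hS.to_subtype
  have : ∀ q : S, SecondCountableTopology ((trivializationAt F A q.1).source) := fun q =>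
    (trivializationAt F A q.1).secondCountableTopology_source
  refine TopologicalSpace.secondCountableTopology_of_countable_cover
    (fun q : S => (trivializationAt F A q.1).open_source) (eq_univ_of_forall fun X => ?_)
  have hX : X.proj ∈ ⋃ q ∈ S, (trivializationAt F A q).baseSet := hcov ▸ mem_univ _
  simp only [mem_iUnion] at hX ⊢
  obtain ⟨q, hq, hX⟩ := hX
  exact ⟨⟨q, hq⟩, (Trivialization.mem_source _).2 hX⟩

/-- The zero section is the fixed set of the continuous map `X ↦ 0 · X`. -/
theorem isClosed_zeroSection [T2Space (TotalSpace F A)] :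
    IsClosed {X : TotalSpace F A | X.snd = 0} := by
  have : {X : TotalSpace F A | X.snd = 0} = {X | fibreSmul ((0 : ℝ), X) = X} := by
    ext ⟨q, X⟩
    simp [fibreSmul, TotalSpace.ext_iff, eq_comm]
  rw [this]
  exact isClosed_eq (continuous_fibreSmul.comp (continuous_const.prodMk continuous_id))
    continuous_id

theorem contMDiff_totalSpaceMk [IsManifold 𝓘(ℝ, E) ∞ M] (q : M) :
    ContMDiff 𝓘(ℝ, A q) (𝓘(ℝ, E).prod 𝓘(ℝ, F)) ∞ (fun ξ : A q => (⟨q, ξ⟩ : TotalSpace F A)) := by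
  intro ξ
  rw [contMDiffAt_totalSpace]
  refine ⟨contMDiffAt_const, ?_⟩
  have hq := FiberBundle.mem_baseSet_trivializationAt' (F := F) (E := A) q
  refine (((trivializationAt F A q).continuousLinearEquivAt ℝ q hq).contDiff.contMDiff.contMDiffAt
    (x := ξ)).congr_of_eventuallyEq ?_
  filter_upwards with ζ
  simp

theorem finrank_fibre (q : M) : Module.finrank ℝ (A q) = Module.finrank ℝ F :=
  (((trivializationAt F A q).continuousLinearEquivAt ℝ q
    (FiberBundle.mem_baseSet_trivializationAt' q)).toLinearEquiv).finrank_eq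

end Bundle

/-! ### Smooth charts of the tangent groupoid; its source and target; it is Hausdorff and second
countable. -/

namespace TangentGroupoid

variable {E F : Type u} [NormedAddCommGroup E] [NormedSpace ℝ E]
  [NormedAddCommGroup F] [NormedSpace ℝ F]
  {M : Type u} [TopologicalSpace M] [ChartedSpace E M] [IsManifold 𝓘(ℝ, E) ∞ M]
  {G : Type u} [TopologicalSpace G] [ChartedSpace (ModelProd E F) G]
  [IsManifold (𝓘(ℝ, E).prod 𝓘(ℝ, F)) ∞ G]
  {𝒢 : ArrowGroupoid G M}
  {A : M → Type u} [TopologicalSpace (TotalSpace F A)]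
  [∀ q, NormedAddCommGroup (A q)] [∀ q, InnerProductSpace ℝ (A q)]
  [FiberBundle F A] [VectorBundle ℝ F A]
  {ι : ∀ q, A q →L[ℝ] TangentSpace (𝓘(ℝ, E).prod 𝓘(ℝ, F)) (𝒢.one q)}
  (a : ExponentialChart 𝒢 ι)

@[simp] theorem tildeα_zero (X : TotalSpace F A) : tildeα a (0, X) = zero X := by simp [tildeα]

theorem tildeα_of_ne {ħ : ℝ} (h : ħ ≠ 0) (X : TotalSpace F A) :
    tildeα a (ħ, X) = off ħ h (a.α (fibreSmul (ħ, X))) := by simp [tildeα, h]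

theorem incl_of_ne {ħ : ℝ} (h : ħ ≠ 0) (x : G) : incl a (ħ, x) = off ħ h x := by simp [incl, h]

theorem isOpen_tildeV : IsOpen (tildeV a) := (tildeαHomeo a).open_target

theorem fibreSmul_zero (X : TotalSpace F A) : fibreSmul ((0 : ℝ), X) = ⟨X.proj, 0⟩ := by
  simp [fibreSmul]

section Smooth

variable [ContMDiffVectorBundle ∞ F A 𝓘(ℝ, E)]

theorem contMDiffOn_tildeα : ContMDiffOn (𝓘(ℝ, ℝ).prod (𝓘(ℝ, E).prod 𝓘(ℝ, F)))
    (𝓘(ℝ, ℝ).prod (𝓘(ℝ, E).prod 𝓘(ℝ, F))) ∞ (tildeα a) (tildeW a) :=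
  (contMDiffOn_of_transported_charts (H := ModelProd ℝ (ModelProd E F)) _
    (tildeαHomeo a) fun p => Or.inr ⟨p, rfl⟩).1

theorem contMDiffOn_tildeαInv : ContMDiffOn (𝓘(ℝ, ℝ).prod (𝓘(ℝ, E).prod 𝓘(ℝ, F)))
    (𝓘(ℝ, ℝ).prod (𝓘(ℝ, E).prod 𝓘(ℝ, F))) ∞ (tildeαInv a) (tildeV a) :=
  (contMDiffOn_of_transported_charts (H := ModelProd ℝ (ModelProd E F)) _
    (tildeαHomeo a) fun p => Or.inr ⟨p, rfl⟩).2

theorem contMDiffOn_incl : ContMDiffOn (𝓘(ℝ, ℝ).prod (𝓘(ℝ, E).prod 𝓘(ℝ, F)))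
    (𝓘(ℝ, ℝ).prod (𝓘(ℝ, E).prod 𝓘(ℝ, F))) ∞ (incl a) {p | p.1 ≠ 0} :=
  (contMDiffOn_of_transported_charts (H := ModelProd ℝ (ModelProd E F)) _
    (inclHomeo a) fun p => Or.inl ⟨p, rfl⟩).1

theorem contMDiffOn_inclInv : ContMDiffOn (𝓘(ℝ, ℝ).prod (𝓘(ℝ, E).prod 𝓘(ℝ, F)))
    (𝓘(ℝ, ℝ).prod (𝓘(ℝ, E).prod 𝓘(ℝ, F))) ∞ (inclInv a) (offSet a) :=
  (contMDiffOn_of_transported_charts (H := ModelProd ℝ (ModelProd E F)) _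
    (inclHomeo a) fun p => Or.inl ⟨p, rfl⟩).2

/-- In the chart `α̃` the target is `(ħ, t (α (ħ X)))`. This smooth formula also holds at `ħ = 0`,
since `t` fixes the units. -/
theorem contMDiff_target (h𝒢 : 𝒢.IsLie (𝓘(ℝ, E).prod 𝓘(ℝ, F)) 𝓘(ℝ, E)) :
    ContMDiff (𝓘(ℝ, ℝ).prod (𝓘(ℝ, E).prod 𝓘(ℝ, F))) (𝓘(ℝ, ℝ).prod 𝓘(ℝ, E)) ∞ (target a) := by
  intro x
  cases x with
  | off ħ h x =>
    have h1 := (contMDiff_fst.prodMk (h𝒢.contMDiff_t.comp contMDiff_snd)).comp_contMDiffOn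
      (contMDiffOn_inclInv a)
    refine ((h1.congr ?_).contMDiffAt ((isOpen_offSet a).mem_nhds trivial))
    rintro (⟨ħ', h', y⟩ | Y) hy
    · rfl
    · exact hy.elim
  | zero X =>
    have h1 := (contMDiffOn_fst.prodMk (h𝒢.contMDiff_t.comp_contMDiffOn
      (a.contMDiffOn_α.comp contMDiff_fibreSmul.contMDiffOn fun _ h => h))).comp
      (contMDiffOn_tildeαInv a) (tildeαInv_mem a)
    refine ((h1.congr ?_).contMDiffAt ((isOpen_tildeV a).mem_nhds trivial))
    rintro (⟨ħ', h', y⟩ | Y) hy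
    · have hy' : a.α (a.α.symm y) = y := a.α.right_inv hy
      simp [target, tildeαInv, fibreSmul_smul_inv h', hy']
    · simp [target, tildeαInv, fibreSmul_zero, a.α_zero, 𝒢.t_one]

end Smooth

theorem continuous_source (h𝒢 : 𝒢.IsLie (𝓘(ℝ, E).prod 𝓘(ℝ, F)) 𝓘(ℝ, E)) :
    Continuous (source a) := by
  rw [continuous_iff_continuousAt]
  intro x
  cases x with
  | off ħ h x =>
    have h1 := ((continuous_fst.prodMk (h𝒢.contMDiff_s.continuous.comp
      continuous_snd)).comp_continuousOn (inclHomeo a).continuousOn_symm)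
    refine ((h1.congr ?_).continuousAt ((isOpen_offSet a).mem_nhds trivial))
    rintro (⟨ħ', h', y⟩ | Y) hy
    · rfl
    · exact hy.elim
  | zero X =>
    have h1 := ((continuous_fst.prodMk ((FiberBundle.continuous_proj F A).comp
      continuous_snd)).comp_continuousOn (tildeαHomeo a).continuousOn_symm)
    refine ((h1.congr ?_).continuousAt ((isOpen_tildeV a).mem_nhds trivial))
    rintro (⟨ħ', h', y⟩ | Y) hy
    · have hy' : a.α (a.α.symm y) = y := a.α.right_inv hy
      have := a.s_α _ (a.α.map_target hy)
      rw [hy'] at this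
      exact Prod.ext rfl this
    · rfl

/-- Arrows over different values of `ħ` are separated by the continuous function `ħ`. Two arrows
over the same `ħ` both lie in the image of `(ℝ ∖ {0}) × G` or both lie in that of `α̃`, and each
image is open and homeomorphic to a Hausdorff space. -/
theorem t2Space [T2Space M] [T2Space G] (h𝒢 : 𝒢.IsLie (𝓘(ℝ, E).prod 𝓘(ℝ, F)) 𝓘(ℝ, E)) :
    T2Space (TangentGroupoid a) := by
  have hA : T2Space (TotalSpace F A) := t2Space_totalSpace
  refine ⟨fun x y hxy => ?_⟩
  by_cases h : (source a x).1 = (source a y).1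
  · cases x with
    | off ħ hħ x =>
      cases y with
      | off ħ' h' y => exact (inclHomeo a).symm.exists_disjoint_isOpen trivial trivial hxy
      | zero Y => exact (hħ h).elim
    | zero X =>
      cases y with
      | off ħ' h' y => exact (h' h.symm).elim
      | zero Y => exact (tildeαHomeo a).symm.exists_disjoint_isOpen trivial trivial hxy
  · obtain ⟨U, V, hU, hV, hX, hY, hUV⟩ := t2_separation h
    have hc := continuous_fst.comp (continuous_source a h𝒢)
    exact ⟨_, _, hU.preimage hc, hV.preimage hc, hX, hY, hUV.preimage _⟩

theorem secondCountableTopology [SecondCountableTopology M] [SecondCountableTopology G]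
    [SecondCountableTopology F] : SecondCountableTopology (TangentGroupoid a) := by
  have hA : SecondCountableTopology (TotalSpace F A) := secondCountableTopology_totalSpace
  have h1 : ∀ b : Bool, SecondCountableTopology
      ((if b then offSet a else tildeV a : Set (TangentGroupoid a))) := by
    rintro (_ | _)
    · exact (tildeαHomeo a).symm.secondCountableTopology_source
    · exact (inclHomeo a).symm.secondCountableTopology_source
  refine TopologicalSpace.secondCountableTopology_of_countable_cover
    (U := fun b : Bool => if b then offSet a else tildeV a) ?_ (eq_univ_of_forall fun x => ?_)
  · rintro (_ | _)
    · exact isOpen_tildeV a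
    · exact isOpen_offSet a
  · cases x with
    | off ħ h x => exact mem_iUnion.2 ⟨true, trivial⟩
    | zero X => exact mem_iUnion.2 ⟨false, trivial⟩

end TangentGroupoid

/-! ### Local coordinates of a vector bundle and of the groupoid operations -/

/-- Reads a derivative along the fibre off the restriction of the map to a line through the zero
section. -/
theorem fderiv_fibre_eq {B V W : Type*} [NormedAddCommGroup B] [NormedSpace ℝ B]
    [NormedAddCommGroup V] [NormedSpace ℝ V] [NormedAddCommGroup W] [NormedSpace ℝ W]
    {m : B × V → W} {b : B} (hm : DifferentiableAt ℝ m (b, 0)) {v : V} {w : W}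
    (h : ∀ᶠ r : ℝ in 𝓝 0, m (b, r • v) = r • w) : fderiv ℝ m (b, 0) (0, v) = w := by
  have h1 : HasDerivAt (fun r : ℝ => (b, r • v)) ((0 : B), v) 0 := by
    simpa using (hasDerivAt_const (0 : ℝ) b).prodMk ((hasDerivAt_id (0 : ℝ)).smul_const v)
  have h2 : HasDerivAt (fun r : ℝ => m (b, r • v)) (fderiv ℝ m (b, 0) (0, v)) 0 := by
    refine HasFDerivAt.comp_hasDerivAt (0 : ℝ) ?_ h1
    simpa using hm.hasFDerivAt
  have h3 : HasDerivAt (fun r : ℝ => r • w) w 0 := by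
    simpa using (hasDerivAt_id (0 : ℝ)).smul_const w
  exact h2.unique (h3.congr_of_eventuallyEq h)

section Coord

variable {E F : Type u} [NormedAddCommGroup E] [NormedSpace ℝ E]
  [NormedAddCommGroup F] [NormedSpace ℝ F]
  {M : Type u} [TopologicalSpace M] [ChartedSpace E M] [IsManifold 𝓘(ℝ, E) ∞ M]
  {A : M → Type u} [TopologicalSpace (TotalSpace F A)]
  [∀ q, NormedAddCommGroup (A q)] [∀ q, InnerProductSpace ℝ (A q)]
  [FiberBundle F A] [VectorBundle ℝ F A]

/-- The local coordinates `E × F → A` given by the preferred chart and trivialisation at `q₀`. -/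
def bundleCoord (A : M → Type u) [TopologicalSpace (TotalSpace F A)]
    [∀ q, NormedAddCommGroup (A q)] [∀ q, InnerProductSpace ℝ (A q)]
    [FiberBundle F A] [VectorBundle ℝ F A] (q₀ : M) (p : E × F) : TotalSpace F A :=
  ⟨(chartAt E q₀).symm p.1, (trivializationAt F A q₀).symmL ℝ ((chartAt E q₀).symm p.1) p.2⟩

/-- The inverse of `bundleCoord`. -/
def bundleCoordInv (q₀ : M) (X : TotalSpace F A) : E × F :=
  (chartAt E q₀ X.proj, (trivializationAt F A q₀ X).2)

variable (F A) in
/-- The open set of base points over which the coordinates at `q₀` are defined. -/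
def coordBase (q₀ : M) : Set M := (chartAt E q₀).source ∩ (trivializationAt F A q₀).baseSet

variable (F A) in
/-- The values of the base coordinate over `coordBase`. -/
def coordDomain (q₀ : M) : Set E :=
  (chartAt E q₀).target ∩ (chartAt E q₀).symm ⁻¹' (trivializationAt F A q₀).baseSet

theorem isOpen_coordBase (q₀ : M) : IsOpen (coordBase (E := E) F A q₀) :=
  (chartAt E q₀).open_source.inter (trivializationAt F A q₀).open_baseSet

theorem isOpen_coordDomain (q₀ : M) : IsOpen (coordDomain (E := E) F A q₀) :=
  (chartAt E q₀).isOpen_inter_preimage_symm (trivializationAt F A q₀).open_baseSet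

theorem mem_coordBase_self (q₀ : M) : q₀ ∈ coordBase (E := E) F A q₀ :=
  ⟨mem_chart_source E q₀, FiberBundle.mem_baseSet_trivializationAt' q₀⟩

theorem chart_mem_coordDomain {q₀ q : M} (hq : q ∈ coordBase (E := E) F A q₀) :
    chartAt E q₀ q ∈ coordDomain F A q₀ :=
  ⟨(chartAt E q₀).map_source hq.1, by simpa [(chartAt E q₀).left_inv hq.1] using hq.2⟩

theorem symm_mem_coordBase {q₀ : M} {b : E} (hb : b ∈ coordDomain F A q₀) :
    (chartAt E q₀).symm b ∈ coordBase (E := E) F A q₀ :=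
  ⟨(chartAt E q₀).map_target hb.1, hb.2⟩

theorem fibreSmul_bundleCoord (q₀ : M) (ħ : ℝ) (b : E) (ζ : F) :
    fibreSmul (ħ, bundleCoord A q₀ (b, ζ)) = bundleCoord A q₀ (b, ħ • ζ) := by
  change (⟨_, ħ • (trivializationAt F A q₀).symmL ℝ ((chartAt E q₀).symm b) ζ⟩ :
    TotalSpace F A) = ⟨_, (trivializationAt F A q₀).symmL ℝ ((chartAt E q₀).symm b) (ħ • ζ)⟩
  rw [map_smul]

theorem bundleCoord_zero (q₀ : M) (b : E) :
    bundleCoord A q₀ (b, (0 : F)) = ⟨(chartAt E q₀).symm b, 0⟩ := by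
  simp [bundleCoord]

theorem bundleCoord_bundleCoordInv {q₀ : M} {X : TotalSpace F A}
    (hX : X.proj ∈ coordBase (E := E) F A q₀) :
    bundleCoord A q₀ (bundleCoordInv (E := E) q₀ X) = X := by
  obtain ⟨q, X⟩ := X
  -- The base point returned by the chart equals `q` only propositionally; it is generalised to `q'`
  -- so that the equality can be substituted in the dependent fibre component.
  have key : ∀ q', q' = q → (⟨q', (trivializationAt F A q₀).symmL ℝ q'
      (trivializationAt F A q₀ ⟨q, X⟩).2⟩ : TotalSpace F A) = ⟨q, X⟩ := by
    rintro _ rfl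
    rw [Trivialization.symmL_apply _ hX.2, Trivialization.symm_apply_apply_mk _ hX.2]
  exact key _ ((chartAt E q₀).left_inv hX.1)

theorem bundleCoordInv_bundleCoord {q₀ : M} {p : E × F} (hp : p.1 ∈ coordDomain F A q₀) :
    bundleCoordInv q₀ (bundleCoord A q₀ p) = p := by
  refine Prod.ext ((chartAt E q₀).right_inv hp.1) ?_
  simp only [bundleCoord, bundleCoordInv]
  rw [Trivialization.symmL_apply _ hp.2, Trivialization.apply_mk_symm _ hp.2]

variable [ContMDiffVectorBundle ∞ F A 𝓘(ℝ, E)]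

theorem contMDiffAt_bundleCoord {q₀ : M} {p : E × F} (hp : p.1 ∈ coordDomain F A q₀) :
    ContMDiffAt 𝓘(ℝ, E × F) (𝓘(ℝ, E).prod 𝓘(ℝ, F)) ∞ (bundleCoord A q₀) p := by
  have hev : ∀ᶠ p' in 𝓝 p, p'.1 ∈ coordDomain F A q₀ :=
    continuous_fst.continuousAt ((isOpen_coordDomain q₀).mem_nhds hp)
  rw [(trivializationAt F A q₀).contMDiffAt_iff
    ((Trivialization.mem_source _).2 (symm_mem_coordBase hp).2)]
  constructor
  · exact ((contMDiffOn_chart_symm (H := E) (I := 𝓘(ℝ, E)) (n := ∞) (x := q₀)).contMDiffAt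
      ((chartAt E q₀).open_target.mem_nhds hp.1)).comp p
      (contDiff_fst.contMDiff.contMDiffAt (I := 𝓘(ℝ, E × F)))
  · refine (contDiff_snd.contMDiff.contMDiffAt (I := 𝓘(ℝ, E × F))).congr_of_eventuallyEq ?_
    filter_upwards [hev] with p' hp'
    exact congrArg Prod.snd (bundleCoordInv_bundleCoord hp')

theorem contMDiffAt_bundleCoordInv {q₀ : M} {X : TotalSpace F A}
    (hX : X.proj ∈ coordBase (E := E) F A q₀) :
    ContMDiffAt (𝓘(ℝ, E).prod 𝓘(ℝ, F)) 𝓘(ℝ, E × F) ∞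
      (bundleCoordInv (E := E) q₀) X := by
  refine ContMDiffAt.prodMk_space ?_ ?_
  · exact ((contMDiffOn_chart (H := E) (I := 𝓘(ℝ, E)) (n := ∞) (x := q₀)).contMDiffAt
      ((chartAt E q₀).open_source.mem_nhds hX.1)).comp X
      (contMDiff_proj (IB := 𝓘(ℝ, E)) A).contMDiffAt
  · exact (((trivializationAt F A q₀).contMDiffAt_iff
      ((Trivialization.mem_source _).2 hX.2)).1 contMDiffAt_id).2

end Coord

/-! ### The groupoid operations near the units, in exponential coordinates. -/

theorem ArrowGroupoid.inv_one {G M : Type u} (𝒢 : ArrowGroupoid G M) (q : M) :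
    𝒢.inv (𝒢.one q) = 𝒢.one q := by
  have h1 := 𝒢.inv_mul (𝒢.one q)
  have h2 := 𝒢.mul_one (𝒢.inv (𝒢.one q))
  rw [𝒢.s_inv, 𝒢.t_one] at h2
  rwa [h2, 𝒢.s_one] at h1

/-- Smoothness of the product is only given within the composable pairs; a pair of smooth maps that
stays composable near `y` turns it into smoothness at `y`. The coordinates of `mulArrow` provide
such a pair: the base point of the left factor is computed from the right factor, so that all of
`(b, ζ, x)` are free. -/
theorem ArrowGroupoid.IsLie.contMDiffAt_mul {G M : Type u}
    {EG : Type*} [NormedAddCommGroup EG] [NormedSpace ℝ EG] {HG : Type*} [TopologicalSpace HG]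
    {IG : ModelWithCorners ℝ EG HG} [TopologicalSpace G] [ChartedSpace HG G]
    {EM : Type*} [NormedAddCommGroup EM] [NormedSpace ℝ EM] {HM : Type*} [TopologicalSpace HM]
    {IM : ModelWithCorners ℝ EM HM} [TopologicalSpace M] [ChartedSpace HM M]
    {𝒢 : ArrowGroupoid G M} (h𝒢 : 𝒢.IsLie IG IM)
    {EQ : Type*} [NormedAddCommGroup EQ] [NormedSpace ℝ EQ] {HQ : Type*} [TopologicalSpace HQ]
    {IQ : ModelWithCorners ℝ EQ HQ} {Q : Type*} [TopologicalSpace Q] [ChartedSpace HQ Q]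
    {f g : Q → G} {y : Q} (hf : ContMDiffAt IQ IG ∞ f y) (hg : ContMDiffAt IQ IG ∞ g y)
    (hfg : ∀ᶠ y' in 𝓝 y, 𝒢.s (f y') = 𝒢.t (g y')) :
    ContMDiffAt IQ IG ∞ (fun y' => 𝒢.mul (f y') (g y')) y :=
  ((h𝒢.contMDiffOn_mul (f y, g y) hfg.self_of_nhds).comp (t := {p | 𝒢.s p.1 = 𝒢.t p.2}) y
    (s := {y' | 𝒢.s (f y') = 𝒢.t (g y')}) (hf.prodMk hg).contMDiffWithinAt
    (by intro y' h; exact h)).contMDiffAt hfg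

namespace ExponentialChart

variable {E F : Type u} [NormedAddCommGroup E] [NormedSpace ℝ E]
  [NormedAddCommGroup F] [NormedSpace ℝ F]
  {M : Type u} [TopologicalSpace M] [ChartedSpace E M] [IsManifold 𝓘(ℝ, E) ∞ M]
  {G : Type u} [TopologicalSpace G] [ChartedSpace (ModelProd E F) G]
  [IsManifold (𝓘(ℝ, E).prod 𝓘(ℝ, F)) ∞ G]
  {𝒢 : ArrowGroupoid G M}
  {A : M → Type u} [TopologicalSpace (TotalSpace F A)]
  [∀ q, NormedAddCommGroup (A q)] [∀ q, InnerProductSpace ℝ (A q)]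
  [FiberBundle F A] [VectorBundle ℝ F A]
  {ι : ∀ q, A q →L[ℝ] TangentSpace (𝓘(ℝ, E).prod 𝓘(ℝ, F)) (𝒢.one q)}
  (a : ExponentialChart 𝒢 ι)

/-- The exponential chart in local coordinates. -/
def coord (q₀ : M) (p : E × F) : G := a.α (bundleCoord A q₀ p)

/-- The fibre coordinate of an element of `G` close to the units. -/
def fibreCoord (q₀ : M) (x : G) : F := (bundleCoordInv (E := E) q₀ (a.α.symm x)).2

/-- The base coordinate of the target of `α (b, ζ)`. -/
def targetCoord (q₀ : M) (p : E × F) : E := chartAt E q₀ (𝒢.t (a.coord q₀ p))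

/-- `(b, ζ)` is in the domain of the exponential chart in local coordinates. -/
def InCoord (q₀ : M) (p : E × F) : Prop :=
  p.1 ∈ coordDomain F A q₀ ∧ bundleCoord A q₀ p ∈ a.α.source

/-- The product `α (t (α (b, ζ)), x) α (b, ζ)`. -/
def mulArrow (q₀ : M) (p : E × F × F) : G :=
  𝒢.mul (a.coord q₀ (a.targetCoord q₀ (p.1, p.2.1), p.2.2)) (a.coord q₀ (p.1, p.2.1))

/-- The coordinates in which `mulArrow` is the product of composable arrows close to the units. -/
def Composable (q₀ : M) (p : E × F × F) : Prop :=
  a.InCoord q₀ (p.1, p.2.1) ∧ 𝒢.t (a.coord q₀ (p.1, p.2.1)) ∈ coordBase (E := E) F A q₀ ∧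
    a.InCoord q₀ (a.targetCoord q₀ (p.1, p.2.1), p.2.2)

variable {a}

theorem InCoord.s_coord {q₀ : M} {p : E × F} (hp : a.InCoord q₀ p) :
    𝒢.s (a.coord q₀ p) = (chartAt E q₀).symm p.1 :=
  a.s_α _ hp.2

theorem InCoord.coord_mem {q₀ : M} {p : E × F} (hp : a.InCoord q₀ p) :
    a.coord q₀ p ∈ a.α.target := a.α.map_source hp.2

theorem InCoord.fibreCoord_coord {q₀ : M} {p : E × F} (hp : a.InCoord q₀ p) :
    a.fibreCoord q₀ (a.coord q₀ p) = p.2 := by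
  rw [fibreCoord, coord, a.α.left_inv hp.2, bundleCoordInv_bundleCoord hp.1]

variable (a) in
theorem bundleCoord_fibreCoord {q₀ : M} {b : E} (hb : b ∈ coordDomain F A q₀) {x : G}
    (hx : x ∈ a.α.target) (hs : 𝒢.s x = (chartAt E q₀).symm b) :
    bundleCoord A q₀ (b, a.fibreCoord q₀ x) = a.α.symm x := by
  have h1 : (a.α.symm x).proj = (chartAt E q₀).symm b := by
    rw [← hs, ← a.s_α _ (a.α.map_target hx), a.α.right_inv hx]
  have h2 : (a.α.symm x).proj ∈ coordBase (E := E) F A q₀ := h1 ▸ symm_mem_coordBase hb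
  have h3 : (b, a.fibreCoord q₀ x) = bundleCoordInv q₀ (a.α.symm x) := by
    refine Prod.ext ?_ rfl
    rw [bundleCoordInv, h1, (chartAt E q₀).right_inv hb.1]
  rw [h3, bundleCoord_bundleCoordInv h2]

variable (a) in
theorem coord_fibreCoord {q₀ : M} {b : E} (hb : b ∈ coordDomain F A q₀) {x : G}
    (hx : x ∈ a.α.target) (hs : 𝒢.s x = (chartAt E q₀).symm b) :
    a.coord q₀ (b, a.fibreCoord q₀ x) = x := by
  rw [coord, a.bundleCoord_fibreCoord hb hx hs, a.α.right_inv hx]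

variable (a) in
theorem coord_zero (q₀ : M) (b : E) : a.coord q₀ (b, 0) = 𝒢.one ((chartAt E q₀).symm b) := by
  rw [coord, bundleCoord_zero, a.α_zero]

variable (a) in
theorem targetCoord_zero {q₀ : M} {b : E} (hb : b ∈ coordDomain F A q₀) :
    a.targetCoord q₀ (b, 0) = b := by
  rw [targetCoord, coord_zero, 𝒢.t_one, (chartAt E q₀).right_inv hb.1]

variable (a) in
theorem inCoord_zero {q₀ : M} {b : E} (hb : b ∈ coordDomain F A q₀) : a.InCoord q₀ (b, 0) :=
  ⟨hb, by simpa [bundleCoord_zero] using a.zero_mem _⟩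

variable (a) in
theorem composable_zero {q₀ : M} {b : E} (hb : b ∈ coordDomain F A q₀) :
    a.Composable q₀ (b, 0, 0) := by
  refine ⟨a.inCoord_zero hb, ?_, ?_⟩
  · simpa [coord_zero, 𝒢.t_one] using symm_mem_coordBase hb
  · simpa [a.targetCoord_zero hb] using a.inCoord_zero hb

theorem Composable.s_eq_t {q₀ : M} {p : E × F × F} (hp : a.Composable q₀ p) :
    𝒢.s (a.coord q₀ (a.targetCoord q₀ (p.1, p.2.1), p.2.2)) = 𝒢.t (a.coord q₀ (p.1, p.2.1)) := by
  rw [hp.2.2.s_coord]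
  exact (chartAt E q₀).left_inv hp.2.1.1

theorem Composable.s_mulArrow {q₀ : M} {p : E × F × F} (hp : a.Composable q₀ p) :
    𝒢.s (a.mulArrow q₀ p) = (chartAt E q₀).symm p.1 := by
  rw [mulArrow, 𝒢.s_mul _ _ hp.s_eq_t, hp.1.s_coord]

/-- This and `mulArrow_right` are the unit laws: they determine the partial derivatives of the
product along the zero section. -/
theorem mulArrow_left {q₀ : M} {b : E} {ζ : F}
    (ht : 𝒢.t (a.coord q₀ (b, ζ)) ∈ coordBase (E := E) F A q₀) :
    a.mulArrow q₀ (b, ζ, 0) = a.coord q₀ (b, ζ) := by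
  rw [mulArrow, targetCoord, coord_zero, (chartAt E q₀).left_inv ht.1, 𝒢.one_mul]

theorem mulArrow_right {q₀ : M} {b : E} {x : F} (hp : a.InCoord q₀ (b, x)) :
    a.mulArrow q₀ (b, 0, x) = a.coord q₀ (b, x) := by
  have := 𝒢.mul_one (a.coord q₀ (b, x))
  rw [hp.s_coord] at this
  rw [mulArrow]
  dsimp only
  rw [a.targetCoord_zero hp.1, coord_zero, this]

variable [ContMDiffVectorBundle ∞ F A 𝓘(ℝ, E)]

theorem InCoord.contMDiffAt_coord {q₀ : M} {p : E × F} (hp : a.InCoord q₀ p) :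
    ContMDiffAt 𝓘(ℝ, E × F) (𝓘(ℝ, E).prod 𝓘(ℝ, F)) ∞ (a.coord q₀) p :=
  (a.contMDiffOn_α.contMDiffAt (a.α.open_source.mem_nhds hp.2)).comp p
    (contMDiffAt_bundleCoord hp.1)

theorem InCoord.eventually {q₀ : M} {p : E × F} (hp : a.InCoord q₀ p) :
    ∀ᶠ p' in 𝓝 p, a.InCoord q₀ p' :=
  Filter.inter_mem (continuous_fst.continuousAt ((isOpen_coordDomain q₀).mem_nhds hp.1))
    ((contMDiffAt_bundleCoord hp.1).continuousAt (a.α.open_source.mem_nhds hp.2))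

theorem InCoord.contDiffAt_targetCoord (h𝒢 : 𝒢.IsLie (𝓘(ℝ, E).prod 𝓘(ℝ, F)) 𝓘(ℝ, E)) {q₀ : M}
    {p : E × F} (hp : a.InCoord q₀ p) (ht : 𝒢.t (a.coord q₀ p) ∈ coordBase (E := E) F A q₀) :
    ContDiffAt ℝ ∞ (a.targetCoord q₀) p := by
  rw [← contMDiffAt_iff_contDiffAt]
  exact ((contMDiffOn_chart (H := E) (I := 𝓘(ℝ, E)) (n := ∞) (x := q₀)).contMDiffAt
    ((chartAt E q₀).open_source.mem_nhds ht.1)).comp p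
    ((h𝒢.contMDiff_t.contMDiffAt).comp p hp.contMDiffAt_coord)

theorem InCoord.eventually_target_mem (h𝒢 : 𝒢.IsLie (𝓘(ℝ, E).prod 𝓘(ℝ, F)) 𝓘(ℝ, E)) {q₀ : M}
    {p : E × F} (hp : a.InCoord q₀ p) (ht : 𝒢.t (a.coord q₀ p) ∈ coordBase (E := E) F A q₀) :
    ∀ᶠ p' in 𝓝 p, 𝒢.t (a.coord q₀ p') ∈ coordBase (E := E) F A q₀ :=
  (h𝒢.contMDiff_t.continuous.continuousAt.comp hp.contMDiffAt_coord.continuousAt)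
    ((isOpen_coordBase q₀).mem_nhds ht)

theorem contDiffAt_fibreCoord_comp {q₀ : M} {V : Type*} [NormedAddCommGroup V] [NormedSpace ℝ V]
    {g : V → G} {v : V} (hg : ContMDiffAt 𝓘(ℝ, V) (𝓘(ℝ, E).prod 𝓘(ℝ, F)) ∞ g v)
    (hv : g v ∈ a.α.target) (hs : 𝒢.s (g v) ∈ coordBase (E := E) F A q₀) :
    ContDiffAt ℝ ∞ (fun v => a.fibreCoord q₀ (g v)) v := by
  rw [← contMDiffAt_iff_contDiffAt]
  have h1 : (a.α.symm (g v)).proj ∈ coordBase (E := E) F A q₀ := by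
    rwa [← a.s_α _ (a.α.map_target hv), a.α.right_inv hv]
  exact (contDiff_snd.contMDiff.contMDiffAt (I := 𝓘(ℝ, E × F))).comp v
    ((contMDiffAt_bundleCoordInv h1).comp v
    ((a.contMDiffOn_α_symm.contMDiffAt (a.α.open_target.mem_nhds hv)).comp v hg))

theorem Composable.contDiffAt_left (h𝒢 : 𝒢.IsLie (𝓘(ℝ, E).prod 𝓘(ℝ, F)) 𝓘(ℝ, E)) {q₀ : M}
    {p : E × F × F} (hp : a.Composable q₀ p) :
    ContDiffAt ℝ ∞ (fun p : E × F × F => (a.targetCoord q₀ (p.1, p.2.1), p.2.2)) p :=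
  ((hp.1.contDiffAt_targetCoord h𝒢 hp.2.1).comp p (f := fun p : E × F × F => (p.1, p.2.1))
    (contDiff_fst.prodMk contDiff_snd.fst).contDiffAt).prodMk contDiff_snd.snd.contDiffAt

theorem Composable.eventually (h𝒢 : 𝒢.IsLie (𝓘(ℝ, E).prod 𝓘(ℝ, F)) 𝓘(ℝ, E)) {q₀ : M}
    {p : E × F × F} (hp : a.Composable q₀ p) : ∀ᶠ p' in 𝓝 p, a.Composable q₀ p' := by
  have h1 : Filter.Tendsto (fun p : E × F × F => (p.1, p.2.1)) (𝓝 p) (𝓝 (p.1, p.2.1)) :=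
    Continuous.tendsto' (by fun_prop) _ _ rfl
  exact (h1.eventually hp.1.eventually).and
    ((h1.eventually (hp.1.eventually_target_mem h𝒢 hp.2.1)).and
      ((hp.contDiffAt_left h𝒢).continuousAt.tendsto.eventually hp.2.2.eventually))

theorem Composable.contMDiffAt_mulArrow (h𝒢 : 𝒢.IsLie (𝓘(ℝ, E).prod 𝓘(ℝ, F)) 𝓘(ℝ, E)) {q₀ : M}
    {p : E × F × F} (hp : a.Composable q₀ p) :
    ContMDiffAt 𝓘(ℝ, E × F × F) (𝓘(ℝ, E).prod 𝓘(ℝ, F)) ∞ (a.mulArrow q₀) p := by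
  refine h𝒢.contMDiffAt_mul ?_ ?_ ((hp.eventually h𝒢).mono fun _ h => h.s_eq_t)
  · exact ContMDiffAt.comp (g := a.coord q₀)
      (f := fun p : E × F × F => (a.targetCoord q₀ (p.1, p.2.1), p.2.2)) p
      hp.2.2.contMDiffAt_coord (hp.contDiffAt_left h𝒢).contMDiffAt
  · exact hp.1.contMDiffAt_coord.comp p
      (f := fun p : E × F × F => (p.1, p.2.1))
      (contDiff_fst.prodMk contDiff_snd.fst).contDiffAt.contMDiffAt

/-- The fibre coordinate of the product is smooth close to the units. -/
theorem eventually_mul (h𝒢 : 𝒢.IsLie (𝓘(ℝ, E).prod 𝓘(ℝ, F)) 𝓘(ℝ, E)) {q₀ : M} {b : E}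
    (hb : b ∈ coordDomain F A q₀) : ∀ᶠ p in 𝓝 (b, (0 : F × F)), a.Composable q₀ p ∧
      a.mulArrow q₀ p ∈ a.α.target ∧
      ContDiffAt ℝ ∞ (fun p => a.fibreCoord q₀ (a.mulArrow q₀ p)) p := by
  have h0 := a.composable_zero hb
  have h1 : a.mulArrow q₀ (b, 0, 0) ∈ a.α.target := by
    rw [mulArrow_right (a.inCoord_zero hb)]
    exact (a.inCoord_zero hb).coord_mem
  filter_upwards [h0.eventually h𝒢,
    (h0.contMDiffAt_mulArrow h𝒢).continuousAt (a.α.open_target.mem_nhds h1)] with p hp hp'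
  refine ⟨hp, hp', contDiffAt_fibreCoord_comp (hp.contMDiffAt_mulArrow h𝒢) hp' ?_⟩
  rw [hp.s_mulArrow]
  exact symm_mem_coordBase hp.1.1

/-- By the unit laws the product restricts to the identity in each fibre variable when the other one
is zero. Its derivative along the fibre, being linear, is the sum of these two partial derivatives.
-/
theorem fderiv_mul (h𝒢 : 𝒢.IsLie (𝓘(ℝ, E).prod 𝓘(ℝ, F)) 𝓘(ℝ, E)) {q₀ : M} {b : E}
    (hb : b ∈ coordDomain F A q₀) (v : F × F) :
    fderiv ℝ (fun p => a.fibreCoord q₀ (a.mulArrow q₀ p)) (b, 0) (0, v) = v.1 + v.2 := by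
  have hd : DifferentiableAt ℝ (fun p => a.fibreCoord q₀ (a.mulArrow q₀ p)) (b, (0 : F × F)) :=
    ((eventually_mul (a := a) h𝒢 hb).self_of_nhds.2.2).differentiableAt (by simp)
  have hl : ∀ ζ : F, Filter.Tendsto (fun r : ℝ => (b, r • ζ)) (𝓝 0) (𝓝 (b, 0)) := fun ζ =>
    Continuous.tendsto' (by fun_prop) _ _ (by simp)
  have h0 := a.inCoord_zero (F := F) hb
  have h1 := fderiv_fibre_eq hd (v := (v.1, (0 : F))) (w := v.1) (by
    have ht : 𝒢.t (a.coord q₀ (b, 0)) ∈ coordBase (E := E) F A q₀ := (a.composable_zero hb).2.1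
    filter_upwards [(hl v.1).eventually h0.eventually,
      (hl v.1).eventually (h0.eventually_target_mem h𝒢 ht)] with r hr hr'
    simp only [Prod.smul_mk, smul_zero]
    rw [mulArrow_left hr', hr.fibreCoord_coord])
  have h2 := fderiv_fibre_eq hd (v := ((0 : F), v.2)) (w := v.2) (by
    filter_upwards [(hl v.2).eventually h0.eventually] with r hr
    simp only [Prod.smul_mk, smul_zero]
    rw [mulArrow_right hr, hr.fibreCoord_coord])
  have h3 : ((0 : E), v) = (0, (v.1, 0)) + (0, (0, v.2)) := by simp
  rw [h3, map_add, h1, h2]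

/-- The fibre coordinate of the inverse is smooth close to the units. -/
theorem eventually_inv (h𝒢 : 𝒢.IsLie (𝓘(ℝ, E).prod 𝓘(ℝ, F)) 𝓘(ℝ, E)) {q₀ : M} {b : E}
    (hb : b ∈ coordDomain F A q₀) : ∀ᶠ p in 𝓝 (b, (0 : F)), a.InCoord q₀ p ∧
      𝒢.t (a.coord q₀ p) ∈ coordBase (E := E) F A q₀ ∧
      𝒢.inv (a.coord q₀ p) ∈ a.α.target ∧
      ContDiffAt ℝ ∞ (fun p => a.fibreCoord q₀ (𝒢.inv (a.coord q₀ p))) p := by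
  have h0 := a.inCoord_zero (F := F) hb
  have ht : 𝒢.t (a.coord q₀ (b, 0)) ∈ coordBase (E := E) F A q₀ := (a.composable_zero hb).2.1
  have h1 : 𝒢.inv (a.coord q₀ (b, 0)) ∈ a.α.target := by
    rw [coord_zero, 𝒢.inv_one, ← a.coord_zero]
    exact h0.coord_mem
  filter_upwards [h0.eventually, h0.eventually_target_mem h𝒢 ht,
    (h𝒢.contMDiff_inv.continuous.continuousAt.comp h0.contMDiffAt_coord.continuousAt)
      (a.α.open_target.mem_nhds h1)] with p hp hp' hp''
  refine ⟨hp, hp', hp'', contDiffAt_fibreCoord_comp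
    (h𝒢.contMDiff_inv.contMDiffAt.comp p hp.contMDiffAt_coord) hp'' ?_⟩
  rwa [𝒢.s_inv]

theorem fibreCoord_inv_zero {q₀ : M} {b : E} (hb : b ∈ coordDomain F A q₀) :
    a.fibreCoord q₀ (𝒢.inv (a.coord q₀ (b, 0))) = 0 := by
  rw [coord_zero, 𝒢.inv_one, ← a.coord_zero, (a.inCoord_zero hb).fibreCoord_coord]

/-- Differentiating `m (b, ζ, i (b, ζ)) = 0`, the coordinate form of `x⁻¹ x = 1`, and using
`fderiv_mul`, gives `v + di v = 0`. -/
theorem fderiv_inv (h𝒢 : 𝒢.IsLie (𝓘(ℝ, E).prod 𝓘(ℝ, F)) 𝓘(ℝ, E)) {q₀ : M} {b : E}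
    (hb : b ∈ coordDomain F A q₀) (v : F) :
    fderiv ℝ (fun p => a.fibreCoord q₀ (𝒢.inv (a.coord q₀ p))) (b, 0) (0, v) = -v := by
  set i : E × F → F := fun p => a.fibreCoord q₀ (𝒢.inv (a.coord q₀ p)) with hi
  set m : E × F × F → F := fun p => a.fibreCoord q₀ (a.mulArrow q₀ p) with hm
  have hi0 : i (b, 0) = 0 := fibreCoord_inv_zero (a := a) hb
  have hid : HasFDerivAt i (fderiv ℝ i (b, 0)) (b, 0) :=
    (((eventually_inv (a := a) h𝒢 hb).self_of_nhds.2.2.2).differentiableAt (by simp)).hasFDerivAt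
  have hmd : HasFDerivAt m (fderiv ℝ m (b, 0)) (b, 0, i (b, 0)) := by
    rw [hi0]
    exact (((eventually_mul (a := a) h𝒢 hb).self_of_nhds.2.2).differentiableAt (by simp)).hasFDerivAt
  have hcomp := hmd.comp (b, (0 : F)) (f := fun p : E × F => (p.1, p.2, i p))
    (hasFDerivAt_fst.prodMk (hasFDerivAt_snd.prodMk hid))
  have hzero : HasFDerivAt (m ∘ fun p : E × F => (p.1, p.2, i p)) (0 : E × F →L[ℝ] F) (b, 0) := by
    refine (hasFDerivAt_const (0 : F) (b, (0 : F))).congr_of_eventuallyEq ?_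
    filter_upwards [eventually_inv (a := a) h𝒢 hb] with p hp
    -- The inverse has source `t (α p)`, which is the base point of the left factor in `mulArrow`;
    -- hence that factor is the inverse itself.
    have h1 : a.coord q₀ (a.targetCoord q₀ p, i p) = 𝒢.inv (a.coord q₀ p) := by
      refine a.coord_fibreCoord (chart_mem_coordDomain hp.2.1) hp.2.2.1 ?_
      rw [𝒢.s_inv]
      exact ((chartAt E q₀).left_inv hp.2.1.1).symm
    have h2 : a.mulArrow q₀ (p.1, p.2, i p) = a.coord q₀ (p.1, 0) := by
      rw [mulArrow]
      dsimp only
      rw [h1, 𝒢.inv_mul, hp.1.s_coord, coord_zero]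
    simp only [Function.comp_apply, hm, h2]
    rw [(a.inCoord_zero hp.1.1).fibreCoord_coord]
  have := congrArg (fun T : E × F →L[ℝ] F => T (0, v)) (hcomp.unique hzero)
  simp [fderiv_mul h𝒢 hb, hm] at this
  exact eq_neg_of_add_eq_zero_right this

end ExponentialChart

/-! ### Smooth product and continuous inverse on the tangent groupoid. -/

namespace TangentGroupoid

variable {E F : Type u} [NormedAddCommGroup E] [NormedSpace ℝ E] [FiniteDimensional ℝ E]
  [NormedAddCommGroup F] [NormedSpace ℝ F] [FiniteDimensional ℝ F]
  {M : Type u} [TopologicalSpace M] [ChartedSpace E M] [IsManifold 𝓘(ℝ, E) ∞ M]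
  {G : Type u} [TopologicalSpace G] [ChartedSpace (ModelProd E F) G]
  [IsManifold (𝓘(ℝ, E).prod 𝓘(ℝ, F)) ∞ G]
  {𝒢 : ArrowGroupoid G M}
  {A : M → Type u} [TopologicalSpace (TotalSpace F A)]
  [∀ q, NormedAddCommGroup (A q)] [∀ q, InnerProductSpace ℝ (A q)]
  [FiberBundle F A] [VectorBundle ℝ F A]
  {ι : ∀ q, A q →L[ℝ] TangentSpace (𝓘(ℝ, E).prod 𝓘(ℝ, F)) (𝒢.one q)}
  (a : ExponentialChart 𝒢 ι)

theorem product_zero_zero (q₀ : M) (b : E) (ζ x : F) :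
    product a (zero (bundleCoord A q₀ (b, x))) (zero (bundleCoord A q₀ (b, ζ))) =
      zero (bundleCoord A q₀ (b, ζ + x)) := by
  rw [add_comm ζ x]
  simp [product, bundleCoord]
  rfl

theorem tildeα_bundleCoord {ħ : ℝ} (h : ħ ≠ 0) (q₀ : M) (b : E) (ζ : F) :
    tildeα a (ħ, bundleCoord A q₀ (b, ζ)) = off ħ h (a.coord q₀ (b, ħ • ζ)) := by
  rw [tildeα_of_ne a h, fibreSmul_bundleCoord, ExponentialChart.coord]

theorem fst_source (x : TangentGroupoid a) : (source a x).1 = (tildeαInv a x).1 := by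
  cases x <;> rfl

theorem fst_target (x : TangentGroupoid a) : (target a x).1 = (tildeαInv a x).1 := by
  cases x <;> rfl

/-- The fibre coordinate of `α̃⁻¹ (α̃ (ħ, X) α̃ (ħ, Z))`. -/
def mulCoord (q₀ : M) (p : ℝ × E × F × F) : F :=
  if p.1 = 0 then p.2.2.1 + p.2.2.2 else
    p.1⁻¹ • a.fibreCoord q₀ (a.mulArrow q₀ (p.2.1, p.1 • p.2.2))

/-- The fibre coordinate of `α̃⁻¹ (α̃ (ħ, Z)⁻¹)`. -/
def invCoord (q₀ : M) (p : ℝ × E × F) : F :=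
  if p.1 = 0 then -p.2.2 else p.1⁻¹ • a.fibreCoord q₀ (𝒢.inv (a.coord q₀ (p.2.1, p.1 • p.2.2)))

variable [ContMDiffVectorBundle ∞ F A 𝓘(ℝ, E)]

theorem eventually_mem_coordDomain {q₀ : M} {b : E} (hb : b ∈ coordDomain F A q₀) :
    ∀ᶠ b' in 𝓝 b, b' ∈ coordDomain F A q₀ := (isOpen_coordDomain q₀).mem_nhds hb

/-- The branch `ħ = 0` of `mulCoord`, namely addition, is the fibre derivative found in
`fderiv_mul`, so `contDiffAt_deformation` applies. It does so at every `v`, however large, since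
only `ħ v` has to be near zero. -/
theorem contDiffAt_mulCoord (h𝒢 : 𝒢.IsLie (𝓘(ℝ, E).prod 𝓘(ℝ, F)) 𝓘(ℝ, E)) {q₀ : M} {b : E}
    (hb : b ∈ coordDomain F A q₀) (v : F × F) : ContDiffAt ℝ ∞ (mulCoord a q₀) (0, b, v) := by
  have h1 := contDiffAt_deformation (m := fun p => a.fibreCoord q₀ (a.mulArrow q₀ p))
    ((ExponentialChart.eventually_mul h𝒢 hb).mono fun _ h => h.2.2)
    ((eventually_mem_coordDomain hb).mono fun b' hb' => by
      have h0 := a.inCoord_zero (F := F) hb'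
      exact (congrArg (a.fibreCoord q₀) (ExponentialChart.mulArrow_right h0)).trans
        h0.fibreCoord_coord) v
  refine h1.congr_of_eventuallyEq ?_
  have h2 : Filter.Tendsto (fun p : ℝ × E × F × F => p.2.1) (𝓝 (0, b, v)) (𝓝 b) :=
    Continuous.tendsto' (by fun_prop) _ _ rfl
  filter_upwards [h2.eventually (eventually_mem_coordDomain hb)] with p hp
  rw [mulCoord, ExponentialChart.fderiv_mul h𝒢 hp]

theorem contDiffAt_invCoord (h𝒢 : 𝒢.IsLie (𝓘(ℝ, E).prod 𝓘(ℝ, F)) 𝓘(ℝ, E)) {q₀ : M} {b : E}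
    (hb : b ∈ coordDomain F A q₀) (v : F) : ContDiffAt ℝ ∞ (invCoord a q₀) (0, b, v) := by
  have h1 := contDiffAt_deformation (m := fun p => a.fibreCoord q₀ (𝒢.inv (a.coord q₀ p)))
    ((ExponentialChart.eventually_inv h𝒢 hb).mono fun _ h => h.2.2.2)
    ((eventually_mem_coordDomain hb).mono fun b' hb' =>
      ExponentialChart.fibreCoord_inv_zero hb') v
  refine h1.congr_of_eventuallyEq ?_
  have h2 : Filter.Tendsto (fun p : ℝ × E × F => p.2.1) (𝓝 (0, b, v)) (𝓝 b) :=
    Continuous.tendsto' (by fun_prop) _ _ rfl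
  filter_upwards [h2.eventually (eventually_mem_coordDomain hb)] with p hp
  rw [invCoord, ExponentialChart.fderiv_inv h𝒢 hp]

/-- Composability forces the base point of `X`: it is the point with coordinate `b` when `ħ = 0`,
and the target of the right factor otherwise. Only the fibre coordinate of `X` is therefore free,
and `mulCoord` describes the product uniformly in `ħ`. -/
theorem product_tildeα {q₀ : M} {ħ : ℝ} {b : E} {ζ x : F} (hb : b ∈ coordDomain F A q₀)
    (h : a.Composable q₀ (b, ħ • (ζ, x)))
    (h' : a.mulArrow q₀ (b, ħ • (ζ, x)) ∈ a.α.target) {X : TotalSpace F A}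
    (hX : X.proj ∈ coordBase (E := E) F A q₀) (hXW : (ħ, X) ∈ tildeW a)
    (hXx : (bundleCoordInv (E := E) q₀ X).2 = x)
    (hcomp : source a (tildeα a (ħ, X)) = target a (tildeα a (ħ, bundleCoord A q₀ (b, ζ)))) :
    product a (tildeα a (ħ, X)) (tildeα a (ħ, bundleCoord A q₀ (b, ζ))) =
      tildeα a (ħ, bundleCoord A q₀ (b, mulCoord a q₀ (ħ, b, ζ, x))) := by
  have hX' := bundleCoord_bundleCoordInv hX
  by_cases hħ : ħ = 0
  · subst hħ
    have h1 : X.proj = (chartAt E q₀).symm b := by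
      simpa [source, target, bundleCoord] using hcomp
    have h2 : bundleCoordInv q₀ X = (b, x) := by
      refine Prod.ext ?_ hXx
      simp only [bundleCoordInv]
      rw [h1, (chartAt E q₀).right_inv hb.1]
    rw [h2] at hX'
    simp only [tildeα_zero, mulCoord, if_true]
    rw [← hX', product_zero_zero]
  · have h1 : X.proj = 𝒢.t (a.coord q₀ (b, ħ • ζ)) := by
      have h2 : 𝒢.s (a.α (fibreSmul (ħ, X))) = X.proj := a.s_α _ hXW
      rw [tildeα_bundleCoord a hħ, tildeα_of_ne a hħ] at hcomp
      simpa [source, target, h2] using hcomp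
    have h2 : bundleCoordInv q₀ X = (a.targetCoord q₀ (b, ħ • ζ), x) := by
      refine Prod.ext ?_ hXx
      simp only [bundleCoordInv]
      rw [h1, ExponentialChart.targetCoord]
    rw [h2] at hX'
    rw [← hX', tildeα_bundleCoord a hħ, tildeα_bundleCoord a hħ, tildeα_bundleCoord a hħ]
    simp only [product, mulCoord, hħ, if_false, smul_inv_smul₀ hħ]
    rw [a.coord_fibreCoord hb h' h.s_mulArrow]
    rfl

theorem inverse_tildeα {q₀ : M} {ħ : ℝ} {b : E} {ζ : F} (hb : b ∈ coordDomain F A q₀)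
    (h : 𝒢.t (a.coord q₀ (b, ħ • ζ)) ∈ coordBase (E := E) F A q₀)
    (h' : 𝒢.inv (a.coord q₀ (b, ħ • ζ)) ∈ a.α.target) :
    inverse a (tildeα a (ħ, bundleCoord A q₀ (b, ζ))) =
      tildeα a (ħ, bundleCoord A q₀ (a.targetCoord q₀ (b, ħ • ζ), invCoord a q₀ (ħ, b, ζ))) := by
  by_cases hħ : ħ = 0
  · subst hħ
    rw [zero_smul, a.targetCoord_zero hb]
    simp [invCoord, inverse, bundleCoord]
  · rw [tildeα_bundleCoord a hħ, tildeα_bundleCoord a hħ]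
    simp only [inverse, invCoord, hħ, if_false, smul_inv_smul₀ hħ]
    rw [a.coord_fibreCoord (b := a.targetCoord q₀ (b, ħ • ζ)) (chart_mem_coordDomain h) h']
    rw [𝒢.s_inv]
    exact ((chartAt E q₀).left_inv h.1).symm

theorem contMDiffWithinAt_product_off (h𝒢 : 𝒢.IsLie (𝓘(ℝ, E).prod 𝓘(ℝ, F)) 𝓘(ℝ, E))
    {w : TangentGroupoid a × TangentGroupoid a} (hw : source a w.1 = target a w.2)
    (h1 : w.1 ∈ offSet a) (h2 : w.2 ∈ offSet a) :
    ContMDiffWithinAt ((𝓘(ℝ, ℝ).prod (𝓘(ℝ, E).prod 𝓘(ℝ, F))).prod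
      (𝓘(ℝ, ℝ).prod (𝓘(ℝ, E).prod 𝓘(ℝ, F)))) (𝓘(ℝ, ℝ).prod (𝓘(ℝ, E).prod 𝓘(ℝ, F))) ∞
      (fun w => product a w.1 w.2) {w | source a w.1 = target a w.2} w := by
  have hI : ∀ x ∈ offSet a, ContMDiffAt (𝓘(ℝ, ℝ).prod (𝓘(ℝ, E).prod 𝓘(ℝ, F)))
      (𝓘(ℝ, ℝ).prod (𝓘(ℝ, E).prod 𝓘(ℝ, F))) ∞ (inclInv a) x := fun x hx =>
    (contMDiffOn_inclInv a).contMDiffAt ((isOpen_offSet a).mem_nhds hx)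
  have hI1 : ContMDiffAt ((𝓘(ℝ, ℝ).prod (𝓘(ℝ, E).prod 𝓘(ℝ, F))).prod
      (𝓘(ℝ, ℝ).prod (𝓘(ℝ, E).prod 𝓘(ℝ, F)))) (𝓘(ℝ, ℝ).prod (𝓘(ℝ, E).prod 𝓘(ℝ, F))) ∞
      (fun w : TangentGroupoid a × TangentGroupoid a => inclInv a w.1) w :=
    (hI _ h1).comp w contMDiffAt_fst
  have hI2 : ContMDiffAt ((𝓘(ℝ, ℝ).prod (𝓘(ℝ, E).prod 𝓘(ℝ, F))).prod
      (𝓘(ℝ, ℝ).prod (𝓘(ℝ, E).prod 𝓘(ℝ, F)))) (𝓘(ℝ, ℝ).prod (𝓘(ℝ, E).prod 𝓘(ℝ, F))) ∞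
      (fun w : TangentGroupoid a × TangentGroupoid a => inclInv a w.2) w :=
    (hI _ h2).comp w contMDiffAt_snd
  set S : Set (TangentGroupoid a × TangentGroupoid a) :=
    {w | source a w.1 = target a w.2} ∩ (Prod.fst ⁻¹' offSet a ∩ Prod.snd ⁻¹' offSet a) with hS
  have hO : IsOpen (Prod.fst ⁻¹' offSet a ∩ Prod.snd ⁻¹' offSet a :
      Set (TangentGroupoid a × TangentGroupoid a)) :=
    ((isOpen_offSet a).preimage continuous_fst).inter ((isOpen_offSet a).preimage continuous_snd)
  rw [← contMDiffWithinAt_inter (hO.mem_nhds ⟨h1, h2⟩)]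
  have hmaps : ∀ w ∈ S, 𝒢.s (inclInv a w.1).2 = 𝒢.t (inclInv a w.2).2 := by
    rintro ⟨⟨ħ, h, x⟩ | X, ⟨ħ', h', y⟩ | Y⟩ ⟨hw, hw1, hw2⟩
    · exact (Prod.ext_iff.1 hw).2
    · exact hw2.elim
    · exact hw1.elim
    · exact hw1.elim
  have hmul : ContMDiffWithinAt ((𝓘(ℝ, ℝ).prod (𝓘(ℝ, E).prod 𝓘(ℝ, F))).prod
      (𝓘(ℝ, ℝ).prod (𝓘(ℝ, E).prod 𝓘(ℝ, F)))) (𝓘(ℝ, E).prod 𝓘(ℝ, F)) ∞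
      (fun w => 𝒢.mul (inclInv a w.1).2 (inclInv a w.2).2) S w :=
    ContMDiffWithinAt.comp (g := fun p : G × G => 𝒢.mul p.1 p.2)
      (f := fun w : TangentGroupoid a × TangentGroupoid a =>
        ((inclInv a w.1).2, (inclInv a w.2).2))
      (t := {p : G × G | 𝒢.s p.1 = 𝒢.t p.2}) w (h𝒢.contMDiffOn_mul
        ((inclInv a w.1).2, (inclInv a w.2).2) (hmaps w ⟨hw, h1, h2⟩))
      ((contMDiffAt_snd.comp w hI1).prodMk (contMDiffAt_snd.comp w hI2)).contMDiffWithinAt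
      fun w hw => hmaps w hw
  have hne : ∀ x ∈ offSet a, (inclInv a x).1 ≠ 0 := by
    rintro (⟨ħ, h, x⟩ | X) hx
    · exact h
    · exact hx.elim
  have := ((contMDiffOn_incl a).contMDiffAt (x := ((inclInv a w.1).1,
    𝒢.mul (inclInv a w.1).2 (inclInv a w.2).2)) ((isOpen_ne_fun continuous_fst
      continuous_const).mem_nhds (hne _ h1))).comp_contMDiffWithinAt w
    (((contMDiffAt_fst.comp w hI1).contMDiffWithinAt (s := S)).prodMk hmul)
  have hprod : ∀ w ∈ S, product a w.1 w.2 =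
      incl a ((inclInv a w.1).1, 𝒢.mul (inclInv a w.1).2 (inclInv a w.2).2) := by
    rintro ⟨⟨ħ, h, x⟩ | X, ⟨ħ', h', y⟩ | Y⟩ ⟨hw, hw1, hw2⟩
    · exact (incl_of_ne a h _).symm
    · exact hw2.elim
    · exact hw1.elim
    · exact hw1.elim
  exact this.congr hprod (hprod w ⟨hw, h1, h2⟩)

/-- Near a composable pair over `ħ = 0` the product is `α̃ (ħ, (b, mulCoord))` in the coordinates at
the common base point, hence the restriction of a map smooth in all of the variables. -/
theorem contMDiffWithinAt_product_zero (h𝒢 : 𝒢.IsLie (𝓘(ℝ, E).prod 𝓘(ℝ, F)) 𝓘(ℝ, E))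
    {X₀ Z₀ : TotalSpace F A} (hw : X₀.proj = Z₀.proj) :
    ContMDiffWithinAt ((𝓘(ℝ, ℝ).prod (𝓘(ℝ, E).prod 𝓘(ℝ, F))).prod
      (𝓘(ℝ, ℝ).prod (𝓘(ℝ, E).prod 𝓘(ℝ, F)))) (𝓘(ℝ, ℝ).prod (𝓘(ℝ, E).prod 𝓘(ℝ, F))) ∞
      (fun w => product a w.1 w.2) {w | source a w.1 = target a w.2} (zero X₀, zero Z₀) := by
  set q₀ : M := Z₀.proj with hq₀
  have hT : ∀ X : TotalSpace F A, ContMDiffAt (𝓘(ℝ, ℝ).prod (𝓘(ℝ, E).prod 𝓘(ℝ, F)))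
      (𝓘(ℝ, ℝ).prod (𝓘(ℝ, E).prod 𝓘(ℝ, F))) ∞ (tildeαInv a) (zero X) := fun X =>
    (contMDiffOn_tildeαInv a).contMDiffAt ((isOpen_tildeV a).mem_nhds trivial)
  set P := (𝓘(ℝ, ℝ).prod (𝓘(ℝ, E).prod 𝓘(ℝ, F))).prod (𝓘(ℝ, ℝ).prod (𝓘(ℝ, E).prod 𝓘(ℝ, F)))
  let w₀ : TangentGroupoid a × TangentGroupoid a := (zero X₀, zero Z₀)
  have hT1 : ContMDiffAt P (𝓘(ℝ, ℝ).prod (𝓘(ℝ, E).prod 𝓘(ℝ, F))) ∞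
      (fun w : TangentGroupoid a × TangentGroupoid a => tildeαInv a w.1) w₀ :=
    (hT X₀).comp w₀ contMDiffAt_fst
  have hT2 : ContMDiffAt P (𝓘(ℝ, ℝ).prod (𝓘(ℝ, E).prod 𝓘(ℝ, F))) ∞
      (fun w : TangentGroupoid a × TangentGroupoid a => tildeαInv a w.2) w₀ :=
    (hT Z₀).comp w₀ contMDiffAt_snd
  have hX₀ : X₀.proj ∈ coordBase (E := E) F A q₀ := by
    rw [hw]
    exact mem_coordBase_self q₀
  have hZ₀ : Z₀.proj ∈ coordBase (E := E) F A q₀ := mem_coordBase_self q₀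
  have hħ : ContMDiffAt P 𝓘(ℝ, ℝ) ∞
      (fun w : TangentGroupoid a × TangentGroupoid a => (tildeαInv a w.2).1) w₀ :=
    contMDiffAt_fst.comp w₀ hT2
  have hX : ContMDiffAt P 𝓘(ℝ, E × F) ∞ (fun w : TangentGroupoid a × TangentGroupoid a =>
      bundleCoordInv (E := E) q₀ (tildeαInv a w.1).2) w₀ :=
    (contMDiffAt_bundleCoordInv hX₀).comp w₀ (contMDiffAt_snd.comp w₀ hT1)
  have hZ : ContMDiffAt P 𝓘(ℝ, E × F) ∞ (fun w : TangentGroupoid a × TangentGroupoid a =>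
      bundleCoordInv (E := E) q₀ (tildeαInv a w.2).2) w₀ :=
    (contMDiffAt_bundleCoordInv hZ₀).comp w₀ (contMDiffAt_snd.comp w₀ hT2)
  have hb : ContMDiffAt P 𝓘(ℝ, E) ∞ (fun w : TangentGroupoid a × TangentGroupoid a =>
      (bundleCoordInv (E := E) q₀ (tildeαInv a w.2).2).1) w₀ :=
    contDiff_fst.contMDiff.contMDiffAt.comp w₀ hZ
  have hv : ContMDiffAt P 𝓘(ℝ, F × F) ∞ (fun w : TangentGroupoid a × TangentGroupoid a =>
      ((bundleCoordInv (E := E) q₀ (tildeαInv a w.2).2).2,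
        (bundleCoordInv (E := E) q₀ (tildeαInv a w.1).2).2)) w₀ :=
    (contDiff_snd.contMDiff.contMDiffAt.comp w₀ hZ).prodMk_space
      (contDiff_snd.contMDiff.contMDiffAt.comp w₀ hX)
  have hb₀ : chartAt E q₀ q₀ ∈ coordDomain F A q₀ := chart_mem_coordDomain hZ₀
  have hm : ContMDiffAt P 𝓘(ℝ, F) ∞ (fun w : TangentGroupoid a × TangentGroupoid a =>
      mulCoord a q₀ ((tildeαInv a w.2).1, (bundleCoordInv (E := E) q₀ (tildeαInv a w.2).2).1,
        ((bundleCoordInv (E := E) q₀ (tildeαInv a w.2).2).2,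
        (bundleCoordInv (E := E) q₀ (tildeαInv a w.1).2).2))) w₀ :=
    (contDiffAt_mulCoord a h𝒢 hb₀ _).contMDiffAt.comp w₀
      (hħ.prodMk_space (hb.prodMk_space hv))
  have hY : ContMDiffAt P (𝓘(ℝ, ℝ).prod (𝓘(ℝ, E).prod 𝓘(ℝ, F))) ∞
      (fun w : TangentGroupoid a × TangentGroupoid a => ((tildeαInv a w.2).1,
        bundleCoord A q₀ ((bundleCoordInv (E := E) q₀ (tildeαInv a w.2).2).1,
      mulCoord a q₀ ((tildeαInv a w.2).1, (bundleCoordInv (E := E) q₀ (tildeαInv a w.2).2).1,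
        ((bundleCoordInv (E := E) q₀ (tildeαInv a w.2).2).2,
        (bundleCoordInv (E := E) q₀ (tildeαInv a w.1).2).2))))) w₀ :=
    hħ.prodMk ((contMDiffAt_bundleCoord hb₀).comp w₀ (hb.prodMk_space hm))
  have hα := ((contMDiffOn_tildeα a).contMDiffAt ((isOpen_tildeW a).mem_nhds
    (zero_mem_tildeW a _))).comp w₀ hY
  refine hα.contMDiffWithinAt.congr_of_eventuallyEq_of_mem ?_ ?_
  · have e1 : ∀ᶠ w in 𝓝 w₀, w.1 ∈ tildeV a ∧ w.2 ∈ tildeV a :=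
      Filter.inter_mem
        (continuous_fst.continuousAt ((isOpen_tildeV a).mem_nhds (show zero X₀ ∈ _ from trivial)))
        (continuous_snd.continuousAt ((isOpen_tildeV a).mem_nhds (show zero Z₀ ∈ _ from trivial)))
    have e2 : ∀ᶠ w in 𝓝 w₀, (tildeαInv a w.1).2.proj ∈ coordBase (E := E) F A q₀ ∧
        (tildeαInv a w.2).2.proj ∈ coordBase (E := E) F A q₀ :=
      Filter.inter_mem
        (((FiberBundle.continuous_proj F A).continuousAt.comp
          (contMDiffAt_snd.comp w₀ hT1).continuousAt) ((isOpen_coordBase q₀).mem_nhds hX₀))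
        (((FiberBundle.continuous_proj F A).continuousAt.comp
          (contMDiffAt_snd.comp w₀ hT2).continuousAt) ((isOpen_coordBase q₀).mem_nhds hZ₀))
    -- At the limit `ħ = 0` the rescaled fibre coordinates vanish, whatever `X₀` and `Z₀` are. The
    -- facts valid only near the units of `𝒢` thus hold near every such pair.
    have e3 : Filter.Tendsto (fun w : TangentGroupoid a × TangentGroupoid a =>
        ((bundleCoordInv (E := E) q₀ (tildeαInv a w.2).2).1, (tildeαInv a w.2).1 •
          ((bundleCoordInv (E := E) q₀ (tildeαInv a w.2).2).2,
            (bundleCoordInv (E := E) q₀ (tildeαInv a w.1).2).2))) (𝓝 w₀)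
        (𝓝 (chartAt E q₀ q₀, 0)) := by
      have := (hb.continuousAt.prodMk (hħ.continuousAt.smul hv.continuousAt)).tendsto
      have h0 : ((bundleCoordInv (E := E) q₀ (tildeαInv a w₀.2).2).1, (tildeαInv a w₀.2).1 •
          ((bundleCoordInv (E := E) q₀ (tildeαInv a w₀.2).2).2,
            (bundleCoordInv (E := E) q₀ (tildeαInv a w₀.1).2).2)) = (chartAt E q₀ q₀, 0) := by
        simp [w₀, tildeαInv, bundleCoordInv, hq₀]
      rw [← h0]
      exact this
    filter_upwards [nhdsWithin_le_nhds e1, nhdsWithin_le_nhds e2,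
      nhdsWithin_le_nhds (e3.eventually (ExponentialChart.eventually_mul h𝒢 hb₀)),
      self_mem_nhdsWithin] with w h1 h2 h3 h4
    have h5 : (tildeαInv a w.1).1 = (tildeαInv a w.2).1 := by
      rw [← fst_source, ← fst_target]
      exact congrArg Prod.fst h4
    have h6 := bundleCoord_bundleCoordInv h2.2
    have h7 : w.1 = tildeα a ((tildeαInv a w.2).1, (tildeαInv a w.1).2) := by
      rw [← h5]
      exact (tildeα_right_inv a _ h1.1).symm
    have h8 : w.2 = tildeα a ((tildeαInv a w.2).1,
        bundleCoord A q₀ (bundleCoordInv (E := E) q₀ (tildeαInv a w.2).2)) := by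
      rw [h6]
      exact (tildeα_right_inv a _ h1.2).symm
    have h9 : ((tildeαInv a w.2).1, (tildeαInv a w.1).2) ∈ tildeW a := by
      rw [← h5]
      exact tildeαInv_mem a _ h1.1
    have key := product_tildeα a (chart_mem_coordDomain h2.2) h3.1 h3.2.1 h2.1 h9 rfl (by
      rw [← h7]
      exact h4.trans (congrArg (target a) h8))
    exact ((congrArg₂ (product a) h7 h8).trans key)
  · exact Prod.ext rfl hw

/-- The product of the tangent groupoid is smooth. -/
theorem contMDiffOn_product (h𝒢 : 𝒢.IsLie (𝓘(ℝ, E).prod 𝓘(ℝ, F)) 𝓘(ℝ, E)) :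
    ContMDiffOn ((𝓘(ℝ, ℝ).prod (𝓘(ℝ, E).prod 𝓘(ℝ, F))).prod
      (𝓘(ℝ, ℝ).prod (𝓘(ℝ, E).prod 𝓘(ℝ, F)))) (𝓘(ℝ, ℝ).prod (𝓘(ℝ, E).prod 𝓘(ℝ, F))) ∞
      (fun w : TangentGroupoid a × TangentGroupoid a => product a w.1 w.2)
      {w | source a w.1 = target a w.2} := by
  -- Composable arrows lie over the same `ħ`, which rules out the two mixed cases.
  rintro ⟨⟨ħ, h, x⟩ | X, ⟨ħ', h', y⟩ | Y⟩ hw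
  · exact contMDiffWithinAt_product_off a h𝒢 hw trivial trivial
  · exact (h (congrArg Prod.fst hw)).elim
  · exact (h' (congrArg Prod.fst hw).symm).elim
  · exact contMDiffWithinAt_product_zero a h𝒢 (congrArg Prod.snd hw)

/-- The inverse of the tangent groupoid is continuous. -/
theorem continuous_inverse (h𝒢 : 𝒢.IsLie (𝓘(ℝ, E).prod 𝓘(ℝ, F)) 𝓘(ℝ, E)) :
    Continuous (inverse a) := by
  rw [continuous_iff_continuousAt]
  rintro (⟨ħ, h, x⟩ | Z₀)
  · have h1 : ContinuousAt (inclInv a) (off ħ h x) :=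
      ((contMDiffOn_inclInv a).continuousOn).continuousAt ((isOpen_offSet a).mem_nhds trivial)
    have h2 : ContinuousAt (incl a) (ħ, 𝒢.inv x) :=
      (contMDiffOn_incl a).continuousOn.continuousAt
        ((isOpen_ne_fun continuous_fst continuous_const).mem_nhds h)
    have h3 := ContinuousAt.comp (x := off ħ h x) (g := incl a)
      (f := fun y => ((inclInv a y).1, 𝒢.inv (inclInv a y).2)) h2
      (h1.fst.prodMk (h𝒢.contMDiff_inv.continuous.continuousAt.comp h1.snd))
    refine h3.congr ?_
    filter_upwards [(isOpen_offSet a).mem_nhds (show off ħ h x ∈ offSet a from trivial)]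
    rintro (⟨ħ', h', y⟩ | Y) hy
    · exact incl_of_ne a h' _
    · exact hy.elim
  · set q₀ : M := Z₀.proj with hq₀
    have hT : ContinuousAt (tildeαInv a) (zero Z₀) :=
      ((contMDiffOn_tildeαInv a).continuousOn).continuousAt ((isOpen_tildeV a).mem_nhds trivial)
    have hZ₀ : Z₀.proj ∈ coordBase (E := E) F A q₀ := mem_coordBase_self q₀
    have hb₀ : chartAt E q₀ q₀ ∈ coordDomain F A q₀ := chart_mem_coordDomain hZ₀
    have hZ : ContinuousAt (fun w => bundleCoordInv (E := E) q₀ (tildeαInv a w).2) (zero Z₀) :=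
      ContinuousAt.comp (g := bundleCoordInv (E := E) q₀) (f := fun w => (tildeαInv a w).2)
        (contMDiffAt_bundleCoordInv hZ₀).continuousAt hT.snd
    have hr : ContinuousAt (fun w => ((bundleCoordInv (E := E) q₀ (tildeαInv a w).2).1,
        (tildeαInv a w).1 • (bundleCoordInv (E := E) q₀ (tildeαInv a w).2).2)) (zero Z₀) :=
      hZ.fst.prodMk (hT.fst.smul hZ.snd)
    have hr0 : ((bundleCoordInv (E := E) q₀ (tildeαInv a (zero Z₀)).2).1,
        (tildeαInv a (zero Z₀)).1 • (bundleCoordInv (E := E) q₀ (tildeαInv a (zero Z₀)).2).2) =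
        (chartAt E q₀ q₀, 0) := by simp [tildeαInv, bundleCoordInv, hq₀]
    have h0 := a.inCoord_zero (F := F) hb₀
    have ht : ContinuousAt (fun w => a.targetCoord q₀
        ((bundleCoordInv (E := E) q₀ (tildeαInv a w).2).1,
        (tildeαInv a w).1 • (bundleCoordInv (E := E) q₀ (tildeαInv a w).2).2)) (zero Z₀) := by
      refine ContinuousAt.comp (g := a.targetCoord q₀) ?_ hr
      rw [hr0]
      exact (h0.contDiffAt_targetCoord h𝒢 (a.composable_zero hb₀).2.1).continuousAt
    have hi : ContinuousAt (fun w => invCoord a q₀ ((tildeαInv a w).1,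
        (bundleCoordInv (E := E) q₀ (tildeαInv a w).2).1,
        (bundleCoordInv (E := E) q₀ (tildeαInv a w).2).2)) (zero Z₀) :=
      ContinuousAt.comp (g := invCoord a q₀) (contDiffAt_invCoord a h𝒢 hb₀ _).continuousAt
        (hT.fst.prodMk (hZ.fst.prodMk hZ.snd))
    have hY : ContinuousAt (fun w => tildeα a ((tildeαInv a w).1, bundleCoord A q₀
        (a.targetCoord q₀ ((bundleCoordInv (E := E) q₀ (tildeαInv a w).2).1,
        (tildeαInv a w).1 • (bundleCoordInv (E := E) q₀ (tildeαInv a w).2).2),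
        invCoord a q₀ ((tildeαInv a w).1,
        (bundleCoordInv (E := E) q₀ (tildeαInv a w).2).1,
        (bundleCoordInv (E := E) q₀ (tildeαInv a w).2).2)))) (zero Z₀) := by
      refine ContinuousAt.comp (g := tildeα a) ((contMDiffOn_tildeα a).continuousOn.continuousAt
        ((isOpen_tildeW a).mem_nhds (zero_mem_tildeW a _))) (hT.fst.prodMk ?_)
      refine ContinuousAt.comp (g := bundleCoord A q₀)
        (contMDiffAt_bundleCoord ?_).continuousAt (ht.prodMk hi)
      have := a.targetCoord_zero (F := F) hb₀
      rw [← hr0] at this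
      exact this ▸ hb₀
    refine hY.congr ?_
    have e2 : ∀ᶠ w in 𝓝 (zero Z₀), (tildeαInv a w).2.proj ∈ coordBase (E := E) F A q₀ :=
      (ContinuousAt.comp (g := TotalSpace.proj) (f := fun w => (tildeαInv a w).2)
        (FiberBundle.continuous_proj F A).continuousAt hT.snd) ((isOpen_coordBase q₀).mem_nhds hZ₀)
    have hr' := hr.tendsto
    rw [hr0] at hr'
    filter_upwards [(isOpen_tildeV a).mem_nhds (show zero Z₀ ∈ tildeV a from trivial), e2,
      hr'.eventually (ExponentialChart.eventually_inv h𝒢 hb₀)] with w h1 h2 h3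
    have h6 := bundleCoord_bundleCoordInv h2
    have h8 : w = tildeα a ((tildeαInv a w).1,
        bundleCoord A q₀ (bundleCoordInv (E := E) q₀ (tildeαInv a w).2)) := by
      rw [h6]
      exact (tildeα_right_inv a _ h1).symm
    exact (inverse_tildeα a (chart_mem_coordDomain h2) h3.2.1 h3.2.2.1).symm.trans
      (congrArg (inverse a) h8.symm)

end TangentGroupoid

/-! ### Properness of `α̃` over the support of `ψ`, and test functions on the source fibres. -/

namespace TangentGroupoid

variable {E F : Type u} [NormedAddCommGroup E] [NormedSpace ℝ E] [FiniteDimensional ℝ E]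
  [NormedAddCommGroup F] [NormedSpace ℝ F] [FiniteDimensional ℝ F]
  {M : Type u} [TopologicalSpace M] [ChartedSpace E M] [IsManifold 𝓘(ℝ, E) ∞ M]
  {G : Type u} [TopologicalSpace G] [ChartedSpace (ModelProd E F) G]
  [IsManifold (𝓘(ℝ, E).prod 𝓘(ℝ, F)) ∞ G]
  {𝒢 : ArrowGroupoid G M}
  {A : M → Type u} [TopologicalSpace (TotalSpace F A)]
  [∀ q, NormedAddCommGroup (A q)] [∀ q, InnerProductSpace ℝ (A q)]
  [FiberBundle F A] [VectorBundle ℝ F A]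
  {ι : ∀ q, A q →L[ℝ] TangentSpace (𝓘(ℝ, E).prod 𝓘(ℝ, F)) (𝒢.one q)}
  (a : ExponentialChart 𝒢 ι)

/-- The image under `α̃` of the pairs `(ħ, X)` with `ħ X ∈ T`. -/
def scaledImage (T : Set (TotalSpace F A)) : Set (TangentGroupoid a) :=
  tildeV a ∩ (fun x => fibreSmul (tildeαInv a x)) ⁻¹' T

/-- The traces in the two charts are `α(T)` for each `ħ ≠ 0`, and `{ħ X ∈ T}` on `W̃`. The first is
closed in all of `G`, and not merely in the open set `V`, by the assumption on `α '' T`. -/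
theorem isClosed_scaledImage {T : Set (TotalSpace F A)} (hT : IsClosed T)
    (hTW : T ⊆ a.α.source) (hαT : IsClosed (a.α '' T)) : IsClosed (scaledImage a T) := by
  rw [← isOpen_compl_iff, isOpen_iff]
  constructor
  · convert (isOpen_ne_fun continuous_fst continuous_const).inter
      (hαT.isOpen_compl.preimage (continuous_snd (X := ℝ))) using 1
    ext ⟨ħ, x⟩
    refine and_congr_right fun (h : ħ ≠ 0) => not_congr ?_
    rw [incl_of_ne a h]
    have h1 : off ħ h x ∈ scaledImage a T ↔ x ∈ a.α.target ∧ a.α.symm x ∈ T := by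
      simp [scaledImage, tildeV, tildeαInv, fibreSmul_smul_inv h]
    rw [h1]
    constructor
    · rintro ⟨h2, h3⟩
      exact ⟨_, h3, a.α.right_inv h2⟩
    · rintro ⟨X, hX, rfl⟩
      exact ⟨a.α.map_source (hTW hX), by rwa [a.α.left_inv (hTW hX)]⟩
  · convert (isOpen_tildeW a).inter (hT.isOpen_compl.preimage continuous_fibreSmul) using 1
    ext p
    refine and_congr_right fun h => not_congr ?_
    change tildeα a p ∈ tildeV a ∧ fibreSmul (tildeαInv a (tildeα a p)) ∈ T ↔ _
    rw [tildeα_left_inv a p h]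
    exact and_iff_right (tildeα_mem a p h)

/-- Properness: the set is the image under `α̃⁻¹` of the intersection of `J` with a closed set
contained in `Ṽ`. -/
theorem isCompact_setOf_tildeα_mem {T : Set (TotalSpace F A)} (hT : IsClosed T)
    (hTW : T ⊆ a.α.source) (hαT : IsClosed (a.α '' T)) {J : Set (TangentGroupoid a)}
    (hJ : IsCompact J) : IsCompact {p | fibreSmul p ∈ T ∧ tildeα a p ∈ J} := by
  have h1 : IsCompact (J ∩ scaledImage a T) := hJ.inter_right (isClosed_scaledImage a hT hTW hαT)
  have h2 : ContinuousOn (tildeαInv a) (tildeV a) := (tildeαHomeo a).continuousOn_symm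
  convert h1.image_of_continuousOn (h2.mono fun x hx => hx.2.1) using 1
  ext p
  constructor
  · rintro ⟨h3, h4⟩
    refine ⟨tildeα a p, ⟨h4, tildeα_mem a p (hTW h3), ?_⟩, tildeα_left_inv a p (hTW h3)⟩
    rwa [mem_preimage, tildeα_left_inv a p (hTW h3)]
  · rintro ⟨x, ⟨hxJ, hxV, hxT⟩, rfl⟩
    exact ⟨hxT, by rwa [tildeα_right_inv a x hxV]⟩

theorem isCompact_fibre_setOf_tildeα_mem [T2Space M] {T : Set (TotalSpace F A)} (hT : IsClosed T)
    (hTW : T ⊆ a.α.source) (hαT : IsClosed (a.α '' T)) {J : Set (TangentGroupoid a)}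
    (hJ : IsCompact J) (ħ : ℝ) (q : M) :
    IsCompact {ξ : A q | fibreSmul (ħ, (⟨q, ξ⟩ : TotalSpace F A)) ∈ T ∧
      tildeα a (ħ, (⟨q, ξ⟩ : TotalSpace F A)) ∈ J} := by
  have h1 := ((isCompact_setOf_tildeα_mem a hT hTW hαT hJ).inter_right
    (isClosed_eq continuous_fst (continuous_const (y := ħ)))).image continuous_snd
  convert (FiberBundle.totalSpaceMk_isClosedEmbedding F A q).isCompact_preimage h1 using 1
  ext ξ
  constructor
  · intro h
    exact ⟨(ħ, ⟨q, ξ⟩), ⟨h, rfl⟩, rfl⟩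
  · rintro ⟨⟨ħ', X⟩, ⟨h, rfl⟩, rfl⟩
    exact h

open Classical in
/-- The function `X ↦ ψ (ħ X) h (α̃ (ħ, X))` on `A_q`, zero where `ħ X ∉ W`. -/
def fibreFunction (ψ : TotalSpace F A → ℂ) (p : ℝ × M)
    (h : {x : TangentGroupoid a // (tangentGroupoid a).s x = p} → ℂ) (X : A p.2) : ℂ :=
  if hX : (p.1, (⟨p.2, X⟩ : TotalSpace F A)) ∈ tildeW a then
    ψ (fibreSmul (p.1, ⟨p.2, X⟩)) *
      h ⟨tildeα a (p.1, ⟨p.2, X⟩), tangentGroupoid_s_tildeα a hX⟩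
  else 0

theorem tildeOperator_eq (ψ : TotalSpace F A → ℂ) (D : ∀ q, (A q → ℂ) → ℂ) (p : ℝ × M)
    (h : {x : TangentGroupoid a // (tangentGroupoid a).s x = p} → ℂ) :
    tildeOperator a ψ D p h = D p.2 (fibreFunction a ψ p h) := rfl

theorem fibreFunction_of_mem (ψ : TotalSpace F A → ℂ) (p : ℝ × M) (H : TangentGroupoid a → ℂ)
    {X : A p.2} (hX : (p.1, (⟨p.2, X⟩ : TotalSpace F A)) ∈ tildeW a) :
    fibreFunction a ψ p (fun x => H x.1) X =
      ψ (fibreSmul (p.1, ⟨p.2, X⟩)) * H (tildeα a (p.1, ⟨p.2, X⟩)) := by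
  rw [fibreFunction, dif_pos hX]

theorem fibreFunction_ne_zero {ψ : TotalSpace F A → ℂ} {p : ℝ × M} {H : TangentGroupoid a → ℂ}
    {X : A p.2} (hX : fibreFunction a ψ p (fun x => H x.1) X ≠ 0) :
    fibreSmul (p.1, (⟨p.2, X⟩ : TotalSpace F A)) ∈ tsupport ψ ∧
      H (tildeα a (p.1, ⟨p.2, X⟩)) ≠ 0 := by
  rw [fibreFunction] at hX
  split_ifs at hX with h
  · exact ⟨subset_tsupport _ (left_ne_zero_of_mul hX), right_ne_zero_of_mul hX⟩
  · exact (hX rfl).elim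

theorem fibreFunction_add (ψ : TotalSpace F A → ℂ) (p : ℝ × M)
    (h₁ h₂ : {x : TangentGroupoid a // (tangentGroupoid a).s x = p} → ℂ) :
    fibreFunction a ψ p (h₁ + h₂) = fibreFunction a ψ p h₁ + fibreFunction a ψ p h₂ := by
  ext X
  simp only [fibreFunction, Pi.add_apply]
  split_ifs
  · ring
  · simp

theorem fibreFunction_smul (ψ : TotalSpace F A → ℂ) (p : ℝ × M) (z : ℂ)
    (h : {x : TangentGroupoid a // (tangentGroupoid a).s x = p} → ℂ) :
    fibreFunction a ψ p (z • h) = z • fibreFunction a ψ p h := by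
  ext X
  simp only [fibreFunction, Pi.smul_apply, smul_eq_mul]
  split_ifs
  · ring
  · simp

variable [ContMDiffVectorBundle ∞ F A 𝓘(ℝ, E)] [T2Space M] [T2Space G]

/-- The support lies where `ħ X` is in the support of `ψ`, hence inside `W̃`; extension by zero is
therefore smooth. Compactness is the properness of `α̃` there. -/
theorem isCc_fibreFunction {ψ : TotalSpace F A → ℂ}
    (hψ : ContMDiff (𝓘(ℝ, E).prod 𝓘(ℝ, F)) 𝓘(ℝ, ℂ) ∞ ψ)
    (hψ_supp : tsupport ψ ⊆ a.α.source) (hψ_closed : IsClosed (a.α '' tsupport ψ)) {p : ℝ × M}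
    {h : {x : TangentGroupoid a // (tangentGroupoid a).s x = p} → ℂ}
    (hh : (tangentGroupoid a).IsCcOnSourceFibre (𝓘(ℝ, ℝ).prod (𝓘(ℝ, E).prod 𝓘(ℝ, F))) p h) :
    IsCc (fibreFunction a ψ p h) := by
  obtain ⟨hc, H, hH, hHh⟩ := hh
  obtain rfl : h = fun x => H x.1 := funext hHh
  obtain ⟨ħ, q⟩ := p
  have hmk : ContMDiff 𝓘(ℝ, A q) (𝓘(ℝ, ℝ).prod (𝓘(ℝ, E).prod 𝓘(ℝ, F))) ∞
      (fun ξ : A q => (ħ, (⟨q, ξ⟩ : TotalSpace F A))) :=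
    contMDiff_const.prodMk (contMDiff_totalSpaceMk q)
  have hsm : ContMDiff 𝓘(ℝ, A q) (𝓘(ℝ, E).prod 𝓘(ℝ, F)) ∞
      (fun ξ : A q => fibreSmul (ħ, (⟨q, ξ⟩ : TotalSpace F A))) := contMDiff_fibreSmul.comp hmk
  constructor
  · rw [← contMDiff_iff_contDiff]
    refine contMDiff_of_tsupport fun X hX => ?_
    have hXT : fibreSmul (ħ, (⟨q, X⟩ : TotalSpace F A)) ∈ tsupport ψ :=
      closure_minimal (fun ξ hξ => (fibreFunction_ne_zero a hξ).1)
        ((isClosed_tsupport ψ).preimage hsm.continuous) hX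
    have hU : IsOpen {ξ : A q | (ħ, (⟨q, ξ⟩ : TotalSpace F A)) ∈ tildeW a} :=
      (isOpen_tildeW a).preimage hmk.continuous
    have h1 : ContMDiffOn 𝓘(ℝ, A q) 𝓘(ℝ, ℂ) ∞
        (fun ξ : A q => ψ (fibreSmul (ħ, ⟨q, ξ⟩)) * H (tildeα a (ħ, ⟨q, ξ⟩)))
        {ξ : A q | (ħ, (⟨q, ξ⟩ : TotalSpace F A)) ∈ tildeW a} := by
      refine (contDiff_mul (𝕜 := ℝ) (𝔸 := ℂ)).contMDiff.comp_contMDiffOn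
        ((hψ.comp hsm).contMDiffOn.prodMk_space ?_)
      refine hH.comp (f := fun ξ : A q => tildeα a (ħ, ⟨q, ξ⟩))
        ((contMDiffOn_tildeα a).comp hmk.contMDiffOn fun _ h => h) fun ξ hξ => ?_
      exact tangentGroupoid_s_tildeα a hξ
    refine (h1.contMDiffAt (hU.mem_nhds (hψ_supp hXT))).congr_of_eventuallyEq ?_
    filter_upwards [hU.mem_nhds (hψ_supp hXT)] with ξ hξ
    exact fibreFunction_of_mem a ψ (ħ, q) H hξ
  · refine HasCompactSupport.intro (isCompact_fibre_setOf_tildeα_mem a (isClosed_tsupport ψ)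
      hψ_supp hψ_closed (hc.isCompact.image continuous_subtype_val) ħ q) fun X hX => ?_
    by_contra hne
    have h1 := fibreFunction_ne_zero a hne
    refine hX ⟨h1.1, ⟨_, tangentGroupoid_s_tildeα a (hψ_supp h1.1)⟩, subset_tsupport _ h1.2, rfl⟩

/-- If `x z` is in the projected support of `H`, then `x = (x z) z⁻¹` lies in the image of a compact
set under right translation by `z⁻¹`. -/
theorem isCcOnSourceFibre_translate (h𝒢 : 𝒢.IsLie (𝓘(ℝ, E).prod 𝓘(ℝ, F)) 𝓘(ℝ, E))
    {EN : Type u} [NormedAddCommGroup EN] [NormedSpace ℝ EN]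
    {HN : Type u} [TopologicalSpace HN] (IN : ModelWithCorners ℝ EN HN)
    {N : Type u} [TopologicalSpace N] [ChartedSpace HN N]
    {H : N × TangentGroupoid a → ℂ}
    (hH : ContMDiff (IN.prod (𝓘(ℝ, ℝ).prod (𝓘(ℝ, E).prod 𝓘(ℝ, F)))) 𝓘(ℝ, ℂ) ∞ H)
    (hHc : HasCompactSupport H) (u : N) (z : TangentGroupoid a) :
    (tangentGroupoid a).IsCcOnSourceFibre (𝓘(ℝ, ℝ).prod (𝓘(ℝ, E).prod 𝓘(ℝ, F)))
      ((tangentGroupoid a).t z) (fun x => H (u, (tangentGroupoid a).mul x.1 z)) := by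
  have hcont : ContinuousOn (fun w : TangentGroupoid a × TangentGroupoid a => product a w.1 w.2)
    {w | source a w.1 = target a w.2} := (contMDiffOn_product a h𝒢).continuousOn
  have hs := continuous_source a h𝒢
  have := t2Space a h𝒢
  refine ⟨?_, fun x => H (u, (tangentGroupoid a).mul x z), ?_, fun x => rfl⟩
  · have hJ : IsCompact ((fun w => product a w (inverse a z)) ''
        ((Prod.snd '' tsupport H) ∩ {w | source a w = source a z})) := by
      refine ((hHc.isCompact.image continuous_snd).inter_right
        (isClosed_eq hs continuous_const)).image_of_continuousOn ?_
      refine hcont.comp (f := fun w => (w, inverse a z)) (by fun_prop) fun w hw => ?_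
      exact hw.2.trans ((tangentGroupoid a).t_inv z).symm
    have hcl : IsClosed {x : TangentGroupoid a | (tangentGroupoid a).s x =
        (tangentGroupoid a).t z} := isClosed_eq hs continuous_const
    refine HasCompactSupport.intro (hcl.isClosedEmbedding_subtypeVal.isCompact_preimage hJ)
      fun ⟨x, hxz⟩ hx => ?_
    by_contra hne
    refine hx ⟨product a x z, ⟨⟨_, subset_tsupport _ hne, rfl⟩,
      (tangentGroupoid a).s_mul _ _ hxz⟩, ?_⟩
    have h1 := (tangentGroupoid a).mul_assoc x z ((tangentGroupoid a).inv z) hxz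
      ((tangentGroupoid a).t_inv z).symm
    rw [(tangentGroupoid a).mul_inv, ← hxz, (tangentGroupoid a).mul_one] at h1
    exact h1
  · refine hH.comp_contMDiffOn (contMDiffOn_const.prodMk ?_)
    exact (contMDiffOn_product a h𝒢).comp
      (f := fun x => (x, z)) (contMDiffOn_id.prodMk contMDiffOn_const) fun x hx => hx

end TangentGroupoid

/-! ### The translated test function on the pullback bundle is sufficiently compact. -/

theorem contMDiff_pullback_lift {E F : Type u} [NormedAddCommGroup E] [NormedSpace ℝ E]
    [NormedAddCommGroup F] [NormedSpace ℝ F]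
    {M : Type u} [TopologicalSpace M] [ChartedSpace E M]
    {A : M → Type u} [TopologicalSpace (TotalSpace F A)]
    [∀ q, NormedAddCommGroup (A q)] [∀ q, InnerProductSpace ℝ (A q)]
    [FiberBundle F A] [VectorBundle ℝ F A]
    {EN : Type u} [NormedAddCommGroup EN] [NormedSpace ℝ EN]
    {HN : Type u} [TopologicalSpace HN] {IN : ModelWithCorners ℝ EN HN}
    {N : Type u} [TopologicalSpace N] [ChartedSpace HN N] (θ : ContMDiffMap IN 𝓘(ℝ, E) N M ∞) :
    ContMDiff (IN.prod 𝓘(ℝ, F)) (𝓘(ℝ, E).prod 𝓘(ℝ, F)) ∞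
      (fun X : TotalSpace F (θ *ᵖ A) => (⟨θ X.proj, X.snd⟩ : TotalSpace F A)) := by
  intro X
  rw [contMDiffAt_totalSpace]
  refine ⟨θ.contMDiff.contMDiffAt.comp X (contMDiff_proj (IB := IN) (θ *ᵖ A)).contMDiffAt, ?_⟩
  exact (contMDiffAt_totalSpace.1 (contMDiffAt_id (I := IN.prod 𝓘(ℝ, F)) (x := X))).2

namespace TangentGroupoid

variable {E F : Type u} [NormedAddCommGroup E] [NormedSpace ℝ E] [FiniteDimensional ℝ E]
  [NormedAddCommGroup F] [NormedSpace ℝ F] [FiniteDimensional ℝ F]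
  {M : Type u} [TopologicalSpace M] [ChartedSpace E M] [IsManifold 𝓘(ℝ, E) ∞ M]
  [T2Space M]
  {G : Type u} [TopologicalSpace G] [ChartedSpace (ModelProd E F) G]
  [IsManifold (𝓘(ℝ, E).prod 𝓘(ℝ, F)) ∞ G] [T2Space G]
  {𝒢 : ArrowGroupoid G M}
  {A : M → Type u} [TopologicalSpace (TotalSpace F A)]
  [∀ q, NormedAddCommGroup (A q)] [∀ q, InnerProductSpace ℝ (A q)]
  [FiberBundle F A] [VectorBundle ℝ F A] [ContMDiffVectorBundle ∞ F A 𝓘(ℝ, E)]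
  {ι : ∀ q, A q →L[ℝ] TangentSpace (𝓘(ℝ, E).prod 𝓘(ℝ, F)) (𝒢.one q)}
  (a : ExponentialChart 𝒢 ι)
  {EN : Type u} [NormedAddCommGroup EN] [NormedSpace ℝ EN]
  {HN : Type u} [TopologicalSpace HN] (IN : ModelWithCorners ℝ EN HN)
  {N : Type u} [TopologicalSpace N] [ChartedSpace HN N]

/-- The map `N × G̃ → M` sending `(u, z)` to the base point of the target of `z`. -/
def targetBase (h𝒢 : 𝒢.IsLie (𝓘(ℝ, E).prod 𝓘(ℝ, F)) 𝓘(ℝ, E)) :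
    ContMDiffMap (IN.prod (𝓘(ℝ, ℝ).prod (𝓘(ℝ, E).prod 𝓘(ℝ, F)))) 𝓘(ℝ, E)
      (N × TangentGroupoid a) M ∞ :=
  ⟨fun n => (target a n.2).2, contMDiff_snd.comp ((contMDiff_target a h𝒢).comp contMDiff_snd)⟩

/-- The function `((u, z), X) ↦ ψ (ħ X) H (u, α̃ (ħ, X) z)` on the pullback of `A`. -/
def translatedFunction (h𝒢 : 𝒢.IsLie (𝓘(ℝ, E).prod 𝓘(ℝ, F)) 𝓘(ℝ, E)) (ψ : TotalSpace F A → ℂ)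
    (H : N × TangentGroupoid a → ℂ)
    (X : TotalSpace F (targetBase (N := N) a IN h𝒢 *ᵖ A)) : ℂ :=
  fibreFunction a ψ (target a X.proj.2)
    (fun x => H (X.proj.1, product a x.1 X.proj.2)) X.snd

/-- The pair `(ħ, X)` of a point `((u, z), X)` of the pullback of `A`, with `z` over `ħ`. -/
def pullbackPair (h𝒢 : 𝒢.IsLie (𝓘(ℝ, E).prod 𝓘(ℝ, F)) 𝓘(ℝ, E))
    (X : TotalSpace F (targetBase (N := N) a IN h𝒢 *ᵖ A)) : ℝ × TotalSpace F A :=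
  ((target a X.proj.2).1, ⟨targetBase a IN h𝒢 X.proj, X.snd⟩)

/-- The pair `(u, α̃ (ħ, X) z)`. -/
def pullbackProduct (h𝒢 : 𝒢.IsLie (𝓘(ℝ, E).prod 𝓘(ℝ, F)) 𝓘(ℝ, E))
    (X : TotalSpace F (targetBase (N := N) a IN h𝒢 *ᵖ A)) : N × TangentGroupoid a :=
  (X.proj.1, product a (tildeα a (pullbackPair a IN h𝒢 X)) X.proj.2)

variable (h𝒢 : 𝒢.IsLie (𝓘(ℝ, E).prod 𝓘(ℝ, F)) 𝓘(ℝ, E))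

theorem contMDiff_pullbackPair : ContMDiff
    ((IN.prod (𝓘(ℝ, ℝ).prod (𝓘(ℝ, E).prod 𝓘(ℝ, F)))).prod 𝓘(ℝ, F))
    (𝓘(ℝ, ℝ).prod (𝓘(ℝ, E).prod 𝓘(ℝ, F))) ∞ (pullbackPair (N := N) a IN h𝒢) := by
  refine ContMDiff.prodMk ?_ (contMDiff_pullback_lift _)
  exact contMDiff_fst.comp ((contMDiff_target a h𝒢).comp (contMDiff_snd.comp
    (contMDiff_proj (IB := IN.prod (𝓘(ℝ, ℝ).prod (𝓘(ℝ, E).prod 𝓘(ℝ, F))))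
      (targetBase (N := N) a IN h𝒢 *ᵖ A))))

theorem isOpen_preimage_tildeW : IsOpen (pullbackPair (N := N) a IN h𝒢 ⁻¹' tildeW a) :=
  (isOpen_tildeW a).preimage (contMDiff_pullbackPair a IN h𝒢).continuous

theorem source_tildeα_pullbackPair {X : TotalSpace F (targetBase (N := N) a IN h𝒢 *ᵖ A)}
    (hX : pullbackPair a IN h𝒢 X ∈ tildeW a) :
    source a (tildeα a (pullbackPair a IN h𝒢 X)) = target a X.proj.2 :=
  tangentGroupoid_s_tildeα a hX

theorem contMDiffOn_pullbackProduct : ContMDiffOn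
    ((IN.prod (𝓘(ℝ, ℝ).prod (𝓘(ℝ, E).prod 𝓘(ℝ, F)))).prod 𝓘(ℝ, F))
    (IN.prod (𝓘(ℝ, ℝ).prod (𝓘(ℝ, E).prod 𝓘(ℝ, F)))) ∞ (pullbackProduct (N := N) a IN h𝒢)
    (pullbackPair a IN h𝒢 ⁻¹' tildeW a) := by
  have hproj := contMDiff_proj (n := ∞) (IB := IN.prod (𝓘(ℝ, ℝ).prod (𝓘(ℝ, E).prod 𝓘(ℝ, F))))
      (targetBase (N := N) a IN h𝒢 *ᵖ A) (F := F)
  refine (contMDiff_fst.comp hproj).contMDiffOn.prodMk ?_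
  refine (contMDiffOn_product a h𝒢).comp
    (f := fun X : TotalSpace F (targetBase (N := N) a IN h𝒢 *ᵖ A) =>
      (tildeα a (pullbackPair a IN h𝒢 X), X.proj.2))
    (ContMDiffOn.prodMk ?_ (contMDiff_snd.comp hproj).contMDiffOn) fun X hX =>
      source_tildeα_pullbackPair a IN h𝒢 hX
  exact (contMDiffOn_tildeα a).comp (contMDiff_pullbackPair a IN h𝒢).contMDiffOn fun _ h => h

theorem translatedFunction_of_mem (ψ : TotalSpace F A → ℂ) (H : N × TangentGroupoid a → ℂ)
    {X : TotalSpace F (targetBase (N := N) a IN h𝒢 *ᵖ A)}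
    (hX : pullbackPair a IN h𝒢 X ∈ tildeW a) :
    translatedFunction a IN h𝒢 ψ H X =
      ψ (fibreSmul (pullbackPair a IN h𝒢 X)) * H (pullbackProduct a IN h𝒢 X) :=
  fibreFunction_of_mem a ψ _ (fun x => H (X.proj.1, product a x X.proj.2)) hX

variable {ψ : TotalSpace F A → ℂ} {H : N × TangentGroupoid a → ℂ}

/-- Sufficient compactness is about the closed support. The product is continuous only over `W̃`,
but the condition on `ψ` cuts out a closed set contained in it, so the conditions on the right
define a closed set. -/
theorem tsupport_translatedFunction_subset (hψ_supp : tsupport ψ ⊆ a.α.source) :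
    tsupport (translatedFunction a IN h𝒢 ψ H) ⊆
      {X | fibreSmul (pullbackPair a IN h𝒢 X) ∈ tsupport ψ ∧
        pullbackProduct a IN h𝒢 X ∈ tsupport H} := by
  refine closure_minimal (fun X hX => ?_) ?_
  · have h1 := fibreFunction_ne_zero a
      (H := fun x => H (X.proj.1, product a x X.proj.2)) hX
    exact ⟨h1.1, subset_tsupport _ h1.2⟩
  · have h1 : IsClosed {X | fibreSmul (pullbackPair (N := N) a IN h𝒢 X) ∈ tsupport ψ} :=
      (isClosed_tsupport ψ).preimage
        (continuous_fibreSmul.comp (contMDiff_pullbackPair a IN h𝒢).continuous)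
    exact ((contMDiffOn_pullbackProduct a IN h𝒢).continuousOn.mono
      fun X hX => hψ_supp hX).preimage_isClosed_of_isClosed h1 (isClosed_tsupport H)

theorem contMDiff_translatedFunction (hψ : ContMDiff (𝓘(ℝ, E).prod 𝓘(ℝ, F)) 𝓘(ℝ, ℂ) ∞ ψ)
    (hψ_supp : tsupport ψ ⊆ a.α.source)
    (hH : ContMDiff (IN.prod (𝓘(ℝ, ℝ).prod (𝓘(ℝ, E).prod 𝓘(ℝ, F)))) 𝓘(ℝ, ℂ) ∞ H) :
    ContMDiff ((IN.prod (𝓘(ℝ, ℝ).prod (𝓘(ℝ, E).prod 𝓘(ℝ, F)))).prod 𝓘(ℝ, F)) 𝓘(ℝ, ℂ) ∞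
      (translatedFunction a IN h𝒢 ψ H) := by
  refine contMDiff_of_tsupport fun X hX => ?_
  have hXT := (tsupport_translatedFunction_subset a IN h𝒢 hψ_supp hX).1
  have hU := (isOpen_preimage_tildeW (N := N) a IN h𝒢).mem_nhds (hψ_supp hXT)
  have h1 : ContMDiffOn ((IN.prod (𝓘(ℝ, ℝ).prod (𝓘(ℝ, E).prod 𝓘(ℝ, F)))).prod 𝓘(ℝ, F))
      𝓘(ℝ, ℂ) ∞ (fun X => ψ (fibreSmul (pullbackPair a IN h𝒢 X)) * H (pullbackProduct a IN h𝒢 X))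
      (pullbackPair a IN h𝒢 ⁻¹' tildeW a) :=
    (contDiff_mul (𝕜 := ℝ) (𝔸 := ℂ)).contMDiff.comp_contMDiffOn
      ((hψ.comp (contMDiff_fibreSmul.comp (contMDiff_pullbackPair a IN h𝒢))).contMDiffOn.prodMk_space
        (hH.comp_contMDiffOn (contMDiffOn_pullbackProduct a IN h𝒢)))
  refine (h1.contMDiffAt hU).congr_of_eventuallyEq ?_
  filter_upwards [hU] with Y hY
  exact translatedFunction_of_mem a IN h𝒢 ψ H hY

theorem tildeα_zero_section (ħ : ℝ) (q : M) :
    tildeα a (ħ, (⟨q, 0⟩ : TotalSpace F A)) = (tangentGroupoid a).one (ħ, q) := by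
  by_cases h : ħ = 0
  · subst h
    simp [tangentGroupoid, unit]
  · have : fibreSmul (ħ, (⟨q, 0⟩ : TotalSpace F A)) = ⟨q, 0⟩ := by simp [fibreSmul]
    simp [tangentGroupoid, unit, h, tildeα, this, a.α_zero]

/-- The heart of the proof. Modulo the zero section, `K` allows only compactly many `ξ`, hence
compactly many arrows `x = α̃ (ħ, ξ)`; then `z` is recovered as `x⁻¹ (x z)` from a point of the
support of `H`. -/
theorem isSufficientlyCompact_translatedFunction [T2Space N]
    (hψ : ContMDiff (𝓘(ℝ, E).prod 𝓘(ℝ, F)) 𝓘(ℝ, ℂ) ∞ ψ)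
    (hψ_supp : tsupport ψ ⊆ a.α.source) (hψ_closed : IsClosed (a.α '' tsupport ψ))
    (hH : ContMDiff (IN.prod (𝓘(ℝ, ℝ).prod (𝓘(ℝ, E).prod 𝓘(ℝ, F)))) 𝓘(ℝ, ℂ) ∞ H)
    (hHc : HasCompactSupport H) :
    IsSufficientlyCompact (targetBase a IN h𝒢) (translatedFunction a IN h𝒢 ψ H) := by
  refine ⟨contMDiff_translatedFunction a IN h𝒢 hψ hψ_supp hH, fun n => ?_, fun K hK => ?_⟩
  · exact (isCc_fibreFunction a hψ hψ_supp hψ_closed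
      (isCcOnSourceFibre_translate a h𝒢 IN hH hHc n.1 n.2)).2
  have hT2 := t2Space a h𝒢
  have htarget := (contMDiff_target a h𝒢).continuous
  set L := tsupport H
  have hL : IsCompact L := hHc
  have hneg : Continuous fun X : TotalSpace F A => fibreSmul ((-1 : ℝ), X) :=
    continuous_fibreSmul.comp (by fun_prop)
  -- The possible pairs `(ħ, ξ)` with `ξ ≠ 0`: `ħ` is a height reached by the support of `H`, as `x
  -- z` lies over the same `ħ` as `z`, and `-ξ` is in the compact closure of the part of `K` off the
  -- zero section.
  have hC : IsCompact (((fun l : N × TangentGroupoid a => (target a l.2).1) '' L) ×ˢ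
      ((fun X : TotalSpace F A => fibreSmul ((-1 : ℝ), X)) ''
        closure {X ∈ K | X.snd ≠ 0}) ∩ fibreSmul ⁻¹' tsupport ψ) :=
    ((hL.image (by fun_prop)).prod (hK.2.image hneg)).inter_right
      ((isClosed_tsupport ψ).preimage continuous_fibreSmul)
  have hX := hC.image_of_continuousOn
    ((contMDiffOn_tildeα a).continuousOn.mono fun p hp => hψ_supp hp.2)
  -- The map `((u, y), x) ↦ (u, x⁻¹ y)`, defined when `x` and `y` have the same target; it will be
  -- applied to `y = x z`.
  have hprod : ContinuousOn (fun w : (N × TangentGroupoid a) × TangentGroupoid a =>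
      (w.1.1, product a (inverse a w.2) w.1.2)) {w | target a w.2 = target a w.1.2} := by
    refine continuousOn_fst.fst.prodMk ((contMDiffOn_product a h𝒢).continuousOn.comp
      (f := fun w : (N × TangentGroupoid a) × TangentGroupoid a => (inverse a w.2, w.1.2))
      (((continuous_inverse a h𝒢).comp continuous_snd).prodMk
        continuous_fst.snd).continuousOn fun w hw => ?_)
    exact ((tangentGroupoid a).s_inv w.2).trans hw
  have hcomp := ((hL.prod hX).inter_right (isClosed_eq (htarget.comp continuous_snd)
    (htarget.comp continuous_fst.snd))).image_of_continuousOn (hprod.mono inter_subset_right)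
  refine (hL.union hcomp).closure_of_subset ?_
  rintro ⟨u, z⟩ ⟨ξ, ζ, hξ, hζ, hξζ⟩
  obtain ⟨h1, h2⟩ := tsupport_translatedFunction_subset a IN h𝒢 hψ_supp hξ
  have hs := source_tildeα_pullbackPair a IN h𝒢 (hψ_supp h1)
  set x := tildeα a (pullbackPair a IN h𝒢 ⟨(u, z), ξ⟩) with hx
  have hxz : target a (product a x z) = target a x := (tangentGroupoid a).t_mul _ _ hs
  have hinv : product a (inverse a x) (product a x z) = z := by
    have h3 := (tangentGroupoid a).mul_assoc _ _ _ ((tangentGroupoid a).s_inv x) hs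
    refine h3.symm.trans ?_
    rw [(tangentGroupoid a).inv_mul, show (tangentGroupoid a).s x = (tangentGroupoid a).t z from hs,
      (tangentGroupoid a).one_mul]
  -- Here `ξ = 0`, so `x` is a unit and `x z = z`: no compactness of the zero section is needed.
  by_cases hζ0 : ζ = 0
  · left
    have hξ0 : ξ = 0 := by simpa [hζ0] using hξζ
    have hx1 : x = (tangentGroupoid a).one ((tangentGroupoid a).t z) := by
      rw [hx, hξ0]
      exact tildeα_zero_section a _ _
    have h3 : (u, product a x z) ∈ L := h2
    rw [hx1] at h3
    have h4 := (tangentGroupoid a).one_mul z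
    change (u, (tangentGroupoid a).mul _ z) ∈ L at h3
    rwa [h4] at h3
  · right
    refine ⟨((u, product a x z), x), ⟨⟨h2, ?_⟩, hxz.symm⟩, Prod.ext rfl hinv⟩
    refine ⟨_, ⟨⟨⟨_, h2, ?_⟩, ⟨_, subset_closure ⟨hζ, hζ0⟩, ?_⟩⟩, h1⟩, rfl⟩
    · change (target a (product a x z)).1 = (target a z).1
      rw [hxz, fst_target, hx, tildeα_left_inv a _ (hψ_supp h1)]
      rfl
    · change (⟨_, (-1 : ℝ) • ζ⟩ : TotalSpace F A) = ⟨_, ξ⟩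
      rw [neg_one_smul, ← eq_neg_of_add_eq_zero_left hξζ]

end TangentGroupoid

end

/-! ### The operator as evaluation along the zero section. -/

theorem mainTheorem2
    {E F : Type u} [NormedAddCommGroup E] [NormedSpace ℝ E] [FiniteDimensional ℝ E]
    [NormedAddCommGroup F] [NormedSpace ℝ F] [FiniteDimensional ℝ F]
    {M : Type u} [TopologicalSpace M] [ChartedSpace E M] [IsManifold 𝓘(ℝ, E) ∞ M]
    [T2Space M] [SecondCountableTopology M]
    {G : Type u} [TopologicalSpace G] [ChartedSpace (ModelProd E F) G]
    [IsManifold (𝓘(ℝ, E).prod 𝓘(ℝ, F)) ∞ G] [T2Space G] [SecondCountableTopology G]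
    (𝒢 : ArrowGroupoid G M) (h𝒢 : 𝒢.IsLie (𝓘(ℝ, E).prod 𝓘(ℝ, F)) 𝓘(ℝ, E))
    {A : M → Type u} [TopologicalSpace (TotalSpace F A)]
    [∀ q, NormedAddCommGroup (A q)] [∀ q, InnerProductSpace ℝ (A q)]
    [∀ q, FiniteDimensional ℝ (A q)] [∀ q, MeasurableSpace (A q)] [∀ q, BorelSpace (A q)]
    [FiberBundle F A] [VectorBundle ℝ F A] [ContMDiffVectorBundle ∞ F A 𝓘(ℝ, E)]
    [IsContMDiffRiemannianBundle 𝓘(ℝ, E) ∞ F A]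
    (ι : ∀ q, A q →L[ℝ] TangentSpace (𝓘(ℝ, E).prod 𝓘(ℝ, F)) (𝒢.one q))
    (hι : IsLieAlgebroidIdentification 𝒢 ι)
    (a : ExponentialChart 𝒢 ι)
    (ψ : TotalSpace F A → ℂ) (hψ : ContMDiff (𝓘(ℝ, E).prod 𝓘(ℝ, F)) 𝓘(ℝ, ℂ) ∞ ψ)
    (hψ_supp : tsupport ψ ⊆ a.α.source)
    (hψ_one : ∀ X ∈ a.α.source, ψ (fibreSmul (1 / 2, X)) = 1)
    (hψ_closed : IsClosed (a.α '' tsupport ψ))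
    (ρ : M → ℝ) (hρ : ContMDiff 𝓘(ℝ, E) 𝓘(ℝ, ℝ) ∞ ρ) (hρ_pos : ∀ q, 0 < ρ q)
    (c : ℝ) (hc : 0 < c)
    (f : TotalSpace (F →L[ℝ] ℝ) (DualBundle A) → ℂ) (hf : AcceptableForQuantisation E ρ f) :
    (tangentGroupoid a).IsOp (𝓘(ℝ, ℝ).prod (𝓘(ℝ, E).prod 𝓘(ℝ, F)))
      (tildeOperator a ψ (fourierOperator ρ c f)) := by
  have hE : ProperSpace F := FiniteDimensional.proper ℝ F
  have hT2 := TangentGroupoid.t2Space a h𝒢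
  have hSC := TangentGroupoid.secondCountableTopology a
  have hA : T2Space (TotalSpace F A) := t2Space_totalSpace
  -- Fourier inversion. The rank is that of the model fibre `F`, so the constant does not depend on
  -- the point `p`.
  have hval : ∀ (p : ℝ × M) (h : {x : TangentGroupoid a // (tangentGroupoid a).s x = p} → ℂ)
      (k : A p.2 → ℂ), IsFourierMultiple ρ f p.2 (TangentGroupoid.fibreFunction a ψ p h) k →
      tildeOperator a ψ (fourierOperator ρ c f) p h =
        c * (2 * Real.pi) ^ Module.finrank ℝ F * k 0 := fun p h k hk => by
    rw [TangentGroupoid.tildeOperator_eq, fourierOperator_eq hc (hρ_pos _) hk,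
      finrank_fibre (F := F) p.2]
  have hcc := fun (p : ℝ × M) (h : {x : TangentGroupoid a // (tangentGroupoid a).s x = p} → ℂ) =>
    TangentGroupoid.isCc_fibreFunction a (p := p) (h := h) hψ hψ_supp hψ_closed
  refine ⟨fun p h₁ h₂ hh₁ hh₂ => ?_, fun p z h hh => ?_, ?_⟩
  · obtain ⟨k₁, hk₁⟩ := hf.exists_multiple _ _ (hcc p h₁ hh₁)
    obtain ⟨k₂, hk₂⟩ := hf.exists_multiple _ _ (hcc p h₂ hh₂)
    rw [hval p h₁ k₁ hk₁, hval p h₂ k₂ hk₂, hval p (h₁ + h₂) (k₁ + k₂) (by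
      rw [TangentGroupoid.fibreFunction_add]
      exact hk₁.add (hcc p h₁ hh₁) (hcc p h₂ hh₂) hk₂), Pi.add_apply, mul_add]
  · obtain ⟨k, hk⟩ := hf.exists_multiple _ _ (hcc p h hh)
    rw [hval p h k hk, hval p (z • h) (z • k) (by
      rw [TangentGroupoid.fibreFunction_smul]
      exact hk.smul z), Pi.smul_apply, smul_eq_mul, mul_left_comm]
  intro EN _ _ _ HN _ IN _ N _ _ _ _ _ H hH hHc
  let θ := TangentGroupoid.targetBase (N := N) a IN h𝒢
  let Φ := TangentGroupoid.translatedFunction a IN h𝒢 ψ H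
  -- Condition 3 with `N × G̃` itself as the parameter manifold; this is why `G̃` had to be shown
  -- Hausdorff and second countable.
  have hsc := hf.preserves_sc (EN × ℝ × E × F) (ModelProd HN (ModelProd ℝ (ModelProd E F)))
    (IN.prod (𝓘(ℝ, ℝ).prod (𝓘(ℝ, E).prod 𝓘(ℝ, F)))) (N × TangentGroupoid a) θ Φ
    (TangentGroupoid.isSufficientlyCompact_translatedFunction a IN h𝒢 hψ hψ_supp hψ_closed hH hHc)
  set mΦ : TotalSpace F (θ *ᵖ A) → ℂ := fun X => fourierMultiplier ρ f (θ X.proj)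
    (fun ξ : A (θ X.proj) => Φ (⟨X.proj, ξ⟩ : TotalSpace F (θ *ᵖ A))) X.snd with hmΦ
  have hres : (fun p : N × TangentGroupoid a => tildeOperator a ψ (fourierOperator ρ c f)
      ((tangentGroupoid a).t p.2) (fun x => H (p.1, (tangentGroupoid a).mul x.1 p.2))) =
      fun p => ((c : ℂ) * (2 * Real.pi) ^ Module.finrank ℝ F) *
        mΦ (⟨p, 0⟩ : TotalSpace F (θ *ᵖ A)) := by
    ext ⟨u, z⟩
    have hex := hf.exists_multiple _ _ (hcc _ _
      (TangentGroupoid.isCcOnSourceFibre_translate a h𝒢 IN hH hHc u z))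
    exact hval _ _ _ (isFourierMultiple_fourierMultiplier hex)
  rw [hres]
  constructor
  · have h0 : ContMDiff (IN.prod (𝓘(ℝ, ℝ).prod (𝓘(ℝ, E).prod 𝓘(ℝ, F)))) 𝓘(ℝ, ℂ) ∞
        (fun p : N × TangentGroupoid a => mΦ (⟨p, 0⟩ : TotalSpace F (θ *ᵖ A))) :=
      hsc.contMDiff.comp (contMDiff_zeroSection ℝ (θ *ᵖ A))
    exact (contDiff_const.mul contDiff_id).contMDiff.comp h0
  · refine HasCompactSupport.mul_left ?_
    -- With the zero section as `K`, nothing is left off the zero section. The choice `ξ = ζ = 0`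
    -- then places every point where `mΦ` is nonzero on the zero section in a relatively compact
    -- set.
    have hK : IsCompactModuloBase {X : TotalSpace F A | X.snd = 0} := by
      refine ⟨isClosed_zeroSection, ?_⟩
      simp
    refine (hsc.isCompact_closure _ hK).of_isClosed_subset (isClosed_tsupport _)
      (closure_mono fun p hp => ⟨0, 0, subset_tsupport _ hp, rfl, add_zero 0⟩)
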